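/- Let $n\ge 0$ and let $(M^{2n+1},\xi)$ be a contact manifold: $M$ is a smooth $(2n+1)$-manifold and $\xi\subset TM$ is a distribution which, near every point, is the kernel of a smooth one-form $\theta$ such that $\theta\wedge(d\theta)^n$ vanishes nowhere. A local contact form is a smooth one-form $\theta$ on an open set $U\subseteq M$ with kernel $\xi$. Denote by $\mathscr{A}^k$ the space of smooth $k$-forms on $M$, by $\mathscr{A}_0^k\subset\mathscr{A}^k$ the subspace of vertical forms, i.e. those annihilated by the wedge product with any local contact form, and set $\mathscr{A}=\bigoplus_k\mathscr{A}^k$. Let $\mathscr{R}=\bigoplus_k\mathscr{R}^k$, where $$\mathscr{R}^k=\{\omega\in\mathscr{A}^k : \theta\wedge\omega\wedge d\theta^{n+1-k}=0,\ \theta\wedge d\omega\wedge d\theta^{n-k}=0\}\quad (k\le n),$$ $$\mathscr{R}^k=\{\omega\in\mathscr{A}^k : \theta\wedge\omega=0,\ \theta\wedge d\omega=0\}\quad (k\ge n+1),$$ the conditions being required for all local contact forms $\theta$. There is a unique family of linear maps $\Gamma\colon\mathscr{A}^k\to\mathscr{A}_0^{k-1}$ (zero for $k=0$) such that for every $\omega\in\mathscr{A}^k$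 and every local contact form $\theta$, on the domain of $\theta$: * if $k\le n$, then $\theta\wedge\omega\wedge d\theta^{n+1-k}=\Gamma\omega\wedge d\theta^{n+2-k}$; * if $k\ge n+1$, then $\theta\wedge\omega=\Gamma\omega\wedge d\theta$ and, for $k\le 2n+1$, $\Gamma\omega=\zeta\wedge d\theta^{k-n-1}$ for some smooth form $\zeta$ of degree $2n+1-k$ on the domain of $\theta$ with $\theta\wedge\zeta=0$. Moreover, for this $\Gamma$: 1. $\pi\omega:=\omega-d\Gamma\omega-\Gamma d\omega$ is homogeneous of degree zero, maps $\mathscr{A}$ into $\mathscr{R}$, and is the identity on $\mathscr{R}$. 2. $(\mathscr{R},d)$ is a subcomplex of the de Rham complex $(\mathscr{A},d)$ and, with $i\colon\mathscr{R}\to\mathscr{A}$ the inclusion, $(\mathscr{A},d)\rightleftarrows(\mathscr{R},d)$ is a deformation retract with projection $\pi$, inclusion $i$ and homotopy $\Gamma$: $\pi$ and $i$ are cochain maps, $\Gamma$ is homogeneous of degree $-1$, $i\pi=1_{\mathscr{A}}-d\Gamma-\Gamma d$, and $\pi i=1_{\mathscr{R}}$. 3. The deformation retract is contact invariant: $\Gamma$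 is determined by $\xi$ alone as above, and if $\Phi\colon(M,\xi)\to(M',\xi')$ is a contactomorphism (a diffeomorphism whose differential maps $\xi$ to $\xi'$), with operators $\Gamma',\pi'$ and Rumin space $\mathscr{R}'$ on $M'$, then $\Gamma\Phi^*\omega'=\Phi^*\Gamma'\omega'$, $\pi\Phi^*\omega'=\Phi^*\pi'\omega'$, and $\Phi^*\omega'\in\mathscr{R}$ if and only if $\omega'\in\mathscr{R}'$, for every form $\omega'$ on $M'$. -/

import Mathlib

open scoped Manifold ContDiff Topology

noncomputable section

namespace Contact

/-! ### Wedge products of alternating forms -/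

section Wedge

variable {V : Type*} [AddCommGroup V] [Module ℝ V] [TopologicalSpace V]

/-- The wedge product of two real alternating forms as an algebraic alternating map: the sum over
`(p, q)`-shuffles `σ` of `sign σ * α (v (σ 1), …, v (σ p)) * β (v (σ (p+1)), …, v (σ (p+q)))`. -/
def wedgeAlg {p q : ℕ} (α : V [⋀^Fin p]→L[ℝ] ℝ) (β : V [⋀^Fin q]→L[ℝ] ℝ) :
    V [⋀^Fin (p + q)]→ₗ[ℝ] ℝ :=
  ((LinearMap.mul' ℝ ℝ).compAlternatingMap
    (α.toAlternatingMap.domCoprod β.toAlternatingMap)).domDomCongr finSumFinEquiv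

theorem continuous_wedgeAlg {p q : ℕ} (α : V [⋀^Fin p]→L[ℝ] ℝ) (β : V [⋀^Fin q]→L[ℝ] ℝ) :
    Continuous (wedgeAlg α β) := by
  have h : ∀ v, wedgeAlg α β v = ∑ σ : Equiv.Perm.ModSumCongr (Fin p) (Fin q),
      LinearMap.mul' ℝ ℝ (AlternatingMap.domCoprod.summand α.toAlternatingMap β.toAlternatingMap σ
        (v ∘ finSumFinEquiv)) := by
    intro v
    simp [wedgeAlg, AlternatingMap.domCoprod_apply, map_sum]
  rw [show (⇑(wedgeAlg α β)) = _ from funext h]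
  refine continuous_finsetSum _ fun σ _ => ?_
  induction σ using Quotient.inductionOn' with | _ σ
  rw [AlternatingMap.domCoprod.summand_mk'']
  have h1 : Continuous fun v : Fin (p + q) → V =>
      α (fun i => v (finSumFinEquiv (σ (Sum.inl i)))) *
        β (fun i => v (finSumFinEquiv (σ (Sum.inr i)))) :=
    (α.cont.comp (by fun_prop)).mul (β.cont.comp (by fun_prop))
  have h2 := h1.const_smul (Equiv.Perm.sign σ)
  convert h2 using 2 with v
  rw [_root_.smul_apply, LinearMap.map_smul_of_tower]
  rfl

/-- The wedge product of two real continuous alternating forms. -/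
def wedge {p q : ℕ} (α : V [⋀^Fin p]→L[ℝ] ℝ) (β : V [⋀^Fin q]→L[ℝ] ℝ) :
    V [⋀^Fin (p + q)]→L[ℝ] ℝ where
  toMultilinearMap := (wedgeAlg α β).toMultilinearMap
  cont := continuous_wedgeAlg α β
  map_eq_zero_of_eq' := (wedgeAlg α β).map_eq_zero_of_eq'

theorem wedge_apply {p q : ℕ} (α : V [⋀^Fin p]→L[ℝ] ℝ) (β : V [⋀^Fin q]→L[ℝ] ℝ)
    (v : Fin (p + q) → V) :
    wedge α β v = LinearMap.mul' ℝ ℝ (AlternatingMap.domCoprod'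
      (α.toAlternatingMap ⊗ₜ[ℝ] β.toAlternatingMap) (v ∘ finSumFinEquiv)) := rfl

theorem wedge_add_right {p q : ℕ} (α : V [⋀^Fin p]→L[ℝ] ℝ) (β γ : V [⋀^Fin q]→L[ℝ] ℝ) :
    wedge α (β + γ) = wedge α β + wedge α γ := by
  ext v
  rw [ContinuousAlternatingMap.add_apply, wedge_apply, wedge_apply, wedge_apply,
    show (β + γ).toAlternatingMap = β.toAlternatingMap + γ.toAlternatingMap from rfl,
    TensorProduct.tmul_add, map_add, AlternatingMap.add_apply, map_add]

theorem wedge_smul_right {p q : ℕ} (c : ℝ) (α : V [⋀^Fin p]→L[ℝ] ℝ) (β : V [⋀^Fin q]→L[ℝ] ℝ) :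
    wedge α (c • β) = c • wedge α β := by
  ext v
  rw [ContinuousAlternatingMap.smul_apply, wedge_apply, wedge_apply,
    show (c • β).toAlternatingMap = c • β.toAlternatingMap from rfl,
    TensorProduct.tmul_smul, map_smul, AlternatingMap.smul_apply, map_smul]

theorem wedge_add_left {p q : ℕ} (α β : V [⋀^Fin p]→L[ℝ] ℝ) (γ : V [⋀^Fin q]→L[ℝ] ℝ) :
    wedge (α + β) γ = wedge α γ + wedge β γ := by
  ext v
  rw [ContinuousAlternatingMap.add_apply, wedge_apply, wedge_apply, wedge_apply,
    show (α + β).toAlternatingMap = α.toAlternatingMap + β.toAlternatingMap from rfl,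
    TensorProduct.add_tmul, map_add, AlternatingMap.add_apply, map_add]

theorem wedge_smul_left {p q : ℕ} (c : ℝ) (α : V [⋀^Fin p]→L[ℝ] ℝ) (β : V [⋀^Fin q]→L[ℝ] ℝ) :
    wedge (c • α) β = c • wedge α β := by
  ext v
  rw [ContinuousAlternatingMap.smul_apply, wedge_apply, wedge_apply,
    show (c • α).toAlternatingMap = c • α.toAlternatingMap from rfl,
    ← TensorProduct.smul_tmul', map_smul, AlternatingMap.smul_apply, map_smul]

theorem wedge_add_eq_zero {p q : ℕ} {α : V [⋀^Fin p]→L[ℝ] ℝ} {β γ : V [⋀^Fin q]→L[ℝ] ℝ}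
    (h : wedge α β = 0) (h' : wedge α γ = 0) : wedge α (β + γ) = 0 := by
  rw [wedge_add_right, h, h', add_zero]

theorem wedge_smul_eq_zero {p q : ℕ} (c : ℝ) {α : V [⋀^Fin p]→L[ℝ] ℝ}
    {β : V [⋀^Fin q]→L[ℝ] ℝ} (h : wedge α β = 0) : wedge α (c • β) = 0 := by
  rw [wedge_smul_right, h, smul_zero]

theorem wedge_zero_right {p q : ℕ} (α : V [⋀^Fin p]→L[ℝ] ℝ) :
    wedge α (0 : V [⋀^Fin q]→L[ℝ] ℝ) = 0 := by
  simpa using wedge_smul_right (0 : ℝ) α (0 : V [⋀^Fin q]→L[ℝ] ℝ)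

/-- `wedgePow β j α` is `α ∧ β ∧ ⋯ ∧ β` with `j` factors equal to the two-form `β`. -/
def wedgePow (β : V [⋀^Fin 2]→L[ℝ] ℝ) {p : ℕ} :
    (j : ℕ) → (V [⋀^Fin p]→L[ℝ] ℝ) → V [⋀^Fin (p + 2 * j)]→L[ℝ] ℝ
  | 0, α => α
  | j + 1, α => wedge (p := p + 2 * j) (q := 2) (wedgePow β j α) β

theorem wedgePow_add (β : V [⋀^Fin 2]→L[ℝ] ℝ) {p : ℕ} (j : ℕ) (α α' : V [⋀^Fin p]→L[ℝ] ℝ) :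
    wedgePow β j (α + α') = wedgePow β j α + wedgePow β j α' := by
  induction j with
  | zero => rfl
  | succ j ih => rw [wedgePow, ih, wedge_add_left]; rfl

theorem wedgePow_smul (β : V [⋀^Fin 2]→L[ℝ] ℝ) {p : ℕ} (j : ℕ) (c : ℝ)
    (α : V [⋀^Fin p]→L[ℝ] ℝ) : wedgePow β j (c • α) = c • wedgePow β j α := by
  induction j with
  | zero => rfl
  | succ j ih => rw [wedgePow, ih, wedge_smul_left]; rfl

/-- The linear map `α ↦ θ ∧ α ∧ β ∧ ⋯ ∧ β` with `j` factors equal to the two-form `β`. -/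
def wedgeWith (θ : V [⋀^Fin 1]→L[ℝ] ℝ) (β : V [⋀^Fin 2]→L[ℝ] ℝ) (p j : ℕ) :
    (V [⋀^Fin p]→L[ℝ] ℝ) →ₗ[ℝ] V [⋀^Fin (1 + p + 2 * j)]→L[ℝ] ℝ where
  toFun α := wedgePow β j (wedge θ α)
  map_add' α α' := by rw [wedge_add_right, wedgePow_add]
  map_smul' c α := by rw [wedge_smul_right, wedgePow_smul]; rfl

/-- The same alternating form, with its degree `p` written as `q`. -/
def castDeg {p q : ℕ} (h : p = q) (α : V [⋀^Fin p]→L[ℝ] ℝ) : V [⋀^Fin q]→L[ℝ] ℝ :=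
  h ▸ α

end Wedge

/-! ### Differential forms and the exterior derivative on a manifold -/

section Forms

variable {n : ℕ} {M : Type*} [TopologicalSpace M]
  [ChartedSpace (EuclideanSpace ℝ (Fin (2 * n + 1))) M]

/-- A not necessarily smooth `k`-form on a `(2n+1)`-manifold: an alternating `k`-linear form on
each tangent space. Forms that are only meant to be defined on an open set are represented by
forms on all of `M`, and all conditions on them are imposed on the open set only. -/
abbrev RawForm (n : ℕ) (M : Type*) [TopologicalSpace M]
    [ChartedSpace (EuclideanSpace ℝ (Fin (2 * n + 1))) M] (k : ℕ) : Type _ :=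
  (x : M) → TangentSpace (𝓡 (2 * n + 1)) x [⋀^Fin k]→L[ℝ] ℝ

/-- The coordinate expression of a form in the preferred chart at `c`: its pullback under the
inverse of the chart. It is meaningful on the target of the chart. -/
def inChart (c : M) {k : ℕ} (η : RawForm n M k) (y : EuclideanSpace ℝ (Fin (2 * n + 1))) :
    EuclideanSpace ℝ (Fin (2 * n + 1)) [⋀^Fin k]→L[ℝ] ℝ :=
  (η ((extChartAt (𝓡 (2 * n + 1)) c).symm y)).compContinuousLinearMap
    (mfderiv 𝓘(ℝ, EuclideanSpace ℝ (Fin (2 * n + 1))) (𝓡 (2 * n + 1))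
      (extChartAt (𝓡 (2 * n + 1)) c).symm y)

/-- Smoothness of a form on a set `U` (used for open `U`): all of its coordinate expressions are
smooth. -/
def SmoothFormOn {k : ℕ} (η : RawForm n M k) (U : Set M) : Prop :=
  ∀ c : M, ContDiffOn ℝ ∞ (inChart c η)
    ((extChartAt (𝓡 (2 * n + 1)) c).target ∩ (extChartAt (𝓡 (2 * n + 1)) c).symm ⁻¹' U)

/-- The exterior derivative of a form, computed at `x` in the preferred chart at `x`. -/
def extD {k : ℕ} (η : RawForm n M k) : RawForm n M (k + 1) := fun x =>
  (extDeriv (inChart x η) (extChartAt (𝓡 (2 * n + 1)) x x)).compContinuousLinearMap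
    (mfderiv (𝓡 (2 * n + 1)) 𝓘(ℝ, EuclideanSpace ℝ (Fin (2 * n + 1)))
      (extChartAt (𝓡 (2 * n + 1)) x) x)

theorem RawForm.congr_point {k : ℕ} (η : RawForm n M k) {x y : M} (h : x = y)
    (v : Fin k → EuclideanSpace ℝ (Fin (2 * n + 1))) : η x v = η y v := by
  subst h; rfl

theorem inChart_add (c : M) {k : ℕ} (η ζ : RawForm n M k) :
    inChart c (η + ζ) = inChart c η + inChart c ζ := rfl

theorem inChart_smul (c : M) {k : ℕ} (a : ℝ) (η : RawForm n M k) :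
    inChart c (a • η) = a • inChart c η := rfl

/-- The subspace of smooth `k`-forms on `M`. -/
def smoothForms (n : ℕ) (M : Type*) [TopologicalSpace M]
    [ChartedSpace (EuclideanSpace ℝ (Fin (2 * n + 1))) M] (k : ℕ) :
    Submodule ℝ (RawForm n M k) where
  carrier := {η | SmoothFormOn η Set.univ}
  add_mem' hη hζ c := (hη c).add (hζ c)
  zero_mem' _ := contDiffOn_const (c := 0)
  smul_mem' a _ hη c := (hη c).const_smul a

/-- The space `𝒜ᵏ` of smooth `k`-forms on `M`. -/
def Form (n : ℕ) (M : Type*) [TopologicalSpace M]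
    [ChartedSpace (EuclideanSpace ℝ (Fin (2 * n + 1))) M] (k : ℕ) : Type _ :=
  smoothForms n M k

instance (k : ℕ) : AddCommGroup (Form n M k) :=
  inferInstanceAs (AddCommGroup (smoothForms n M k))

instance (k : ℕ) : Module ℝ (Form n M k) :=
  inferInstanceAs (Module ℝ (smoothForms n M k))

theorem isOpen_chart_preimage {U : Set M} (hU : IsOpen U) (c : M) :
    IsOpen ((extChartAt (𝓡 (2 * n + 1)) c).target ∩
      (extChartAt (𝓡 (2 * n + 1)) c).symm ⁻¹' U) :=
  (continuousOn_extChartAt_symm c).isOpen_inter_preimage (isOpen_extChartAt_target c) hU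

theorem SmoothFormOn.differentiableAt {k : ℕ} {η : RawForm n M k} {U : Set M} (hU : IsOpen U)
    (h : SmoothFormOn η U) (c : M) {y : EuclideanSpace ℝ (Fin (2 * n + 1))}
    (hy : y ∈ (extChartAt (𝓡 (2 * n + 1)) c).target)
    (hyU : (extChartAt (𝓡 (2 * n + 1)) c).symm y ∈ U) :
    DifferentiableAt ℝ (inChart c η) y :=
  ((h c).contDiffAt ((isOpen_chart_preimage hU c).mem_nhds ⟨hy, hyU⟩)).differentiableAt
    (by norm_num)

variable [IsManifold (𝓡 (2 * n + 1)) ∞ M]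

theorem mdifferentiableAt_symm (c : M) {y : EuclideanSpace ℝ (Fin (2 * n + 1))}
    (hy : y ∈ (extChartAt (𝓡 (2 * n + 1)) c).target) :
    MDifferentiableAt 𝓘(ℝ, EuclideanSpace ℝ (Fin (2 * n + 1))) (𝓡 (2 * n + 1))
      (extChartAt (𝓡 (2 * n + 1)) c).symm y := by
  have : IsManifold (𝓡 (2 * n + 1)) 1 M := IsManifold.of_le (n := ∞) (by norm_num)
  exact (mdifferentiableOn_extChartAt_symm y hy).mdifferentiableAt
    ((isOpen_extChartAt_target c).mem_nhds hy)

theorem mdifferentiableAt_chart (c : M) {x : M}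
    (hx : x ∈ (extChartAt (𝓡 (2 * n + 1)) c).source) :
    MDifferentiableAt (𝓡 (2 * n + 1)) 𝓘(ℝ, EuclideanSpace ℝ (Fin (2 * n + 1)))
      (extChartAt (𝓡 (2 * n + 1)) c) x := by
  have : IsManifold (𝓡 (2 * n + 1)) 1 M := IsManifold.of_le (n := ∞) (by norm_num)
  exact mdifferentiableAt_extChartAt (by rwa [extChartAt_source] at hx)

/-- Coordinate expressions in two charts are related by pullback under the transition map. -/
theorem inChart_eq_pullback (c p : M) {k : ℕ} (η : RawForm n M k)
    {y : EuclideanSpace ℝ (Fin (2 * n + 1))}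
    (hy : y ∈ (extChartAt (𝓡 (2 * n + 1)) p).target)
    (hc : (extChartAt (𝓡 (2 * n + 1)) p).symm y ∈ (extChartAt (𝓡 (2 * n + 1)) c).source) :
    inChart p η y =
      (inChart c η (extChartAt (𝓡 (2 * n + 1)) c ((extChartAt (𝓡 (2 * n + 1)) p).symm y))
        ).compContinuousLinearMap
        (fderiv ℝ (extChartAt (𝓡 (2 * n + 1)) c ∘ (extChartAt (𝓡 (2 * n + 1)) p).symm) y) := by
  set C := extChartAt (𝓡 (2 * n + 1)) c with hC
  set P := extChartAt (𝓡 (2 * n + 1)) p with hP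
  have hmP := mdifferentiableAt_symm p hy
  have hmC := mdifferentiableAt_chart c hc
  have hmCs := mdifferentiableAt_symm c (C.map_source hc)
  have hd : DifferentiableAt ℝ (C ∘ P.symm) y :=
    (MDifferentiableAt.comp y hmC hmP).differentiableAt
  have hev : P.symm =ᶠ[𝓝 y] C.symm ∘ (C ∘ P.symm) := by
    filter_upwards [(isOpen_extChartAt_target (I := 𝓡 (2 * n + 1)) p).mem_nhds hy,
      hmP.continuousAt.preimage_mem_nhds
        ((isOpen_extChartAt_source (I := 𝓡 (2 * n + 1)) c).mem_nhds hc)] with z _ hz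
    exact (C.left_inv hz).symm
  have hpt : C.symm (C (P.symm y)) = P.symm y := C.left_inv hc
  have hder : ∀ w : EuclideanSpace ℝ (Fin (2 * n + 1)),
      (mfderiv 𝓘(ℝ, EuclideanSpace ℝ (Fin (2 * n + 1))) (𝓡 (2 * n + 1)) P.symm y w :
        EuclideanSpace ℝ (Fin (2 * n + 1))) =
      mfderiv 𝓘(ℝ, EuclideanSpace ℝ (Fin (2 * n + 1))) (𝓡 (2 * n + 1)) C.symm
        (C (P.symm y)) (fderiv ℝ (C ∘ P.symm) y w) := by
    intro w
    have h := mfderiv_comp y (g := C.symm) (f := C ∘ P.symm) hmCs hd.mdifferentiableAt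
    rw [hev.mfderiv_eq, h, mfderiv_eq_fderiv]
    rfl
  ext v
  refine (congrArg (η (P.symm y)) (funext fun i => hder (v i))).trans ?_
  exact (RawForm.congr_point η hpt _).symm

theorem extD_eq (c : M) {k : ℕ} (η : RawForm n M k) {x : M}
    (hx : x ∈ (extChartAt (𝓡 (2 * n + 1)) c).source)
    (hη : DifferentiableAt ℝ (inChart c η) (extChartAt (𝓡 (2 * n + 1)) c x)) :
    extD η x =
      (extDeriv (inChart c η) (extChartAt (𝓡 (2 * n + 1)) c x)).compContinuousLinearMap
        (mfderiv (𝓡 (2 * n + 1)) 𝓘(ℝ, EuclideanSpace ℝ (Fin (2 * n + 1)))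
          (extChartAt (𝓡 (2 * n + 1)) c) x) := by
  set C := extChartAt (𝓡 (2 * n + 1)) c with hC
  set P := extChartAt (𝓡 (2 * n + 1)) x with hP
  have hxP : x ∈ P.source := mem_extChartAt_source x
  have hyP : P x ∈ P.target := P.map_source hxP
  have hsymm : P.symm (P x) = x := P.left_inv hxP
  have hev : ∀ᶠ y in 𝓝 (P x), y ∈ P.target ∧ P.symm y ∈ C.source := by
    have h1 := (isOpen_extChartAt_target (I := 𝓡 (2 * n + 1)) x).mem_nhds hyP
    have h2 := (mdifferentiableAt_symm x hyP).continuousAt.preimage_mem_nhds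
      ((isOpen_extChartAt_source (I := 𝓡 (2 * n + 1)) c).mem_nhds (by rwa [hsymm]))
    exact Filter.inter_mem h1 h2
  have hsm : ContDiffAt ℝ ∞ (C ∘ P.symm) (P x) := by
    have h := contDiffWithinAt_ext_coord_change (I := 𝓡 (2 * n + 1)) (n := ∞) c x (y := P x)
      ⟨hyP, show P.symm (P x) ∈ C.source by rwa [hsymm]⟩
    rwa [ModelWithCorners.range_eq_univ, contDiffWithinAt_univ] at h
  have hmd := (mdifferentiableAt_chart c hx)
  have hmP := (mdifferentiableAt_chart x hxP)
  have hd : DifferentiableAt ℝ (C ∘ P.symm) (P x) := hsm.differentiableAt (by norm_num)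
  have h1 : inChart x η =ᶠ[𝓝 (P x)] fun y => (inChart c η ((C ∘ P.symm) y)
      ).compContinuousLinearMap (fderiv ℝ (C ∘ P.symm) y) := by
    filter_upwards [hev] with y hy using inChart_eq_pullback c x η hy.1 hy.2
  have hval : (C ∘ P.symm) (P x) = C x := by simp [hsymm]
  have h2 := extDeriv_pullback (f := C ∘ P.symm) (x := P x) (by rwa [hval] : DifferentiableAt ℝ
    (inChart c η) ((C ∘ P.symm) (P x))) hsm
    (by simpa using! (WithTop.coe_le_coe.2 le_top : ((2 : ℕ∞) : WithTop ℕ∞) ≤ ∞))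
  have hevx : C =ᶠ[𝓝 x] (C ∘ P.symm) ∘ P := by
    filter_upwards [(isOpen_extChartAt_source (I := 𝓡 (2 * n + 1)) x).mem_nhds hxP] with z hz
    simp [P.left_inv hz]
  have h3 : mfderiv (𝓡 (2 * n + 1)) 𝓘(ℝ, EuclideanSpace ℝ (Fin (2 * n + 1))) C x =
      (mfderiv 𝓘(ℝ, EuclideanSpace ℝ (Fin (2 * n + 1)))
        𝓘(ℝ, EuclideanSpace ℝ (Fin (2 * n + 1))) (C ∘ P.symm) (P x)).comp
      (mfderiv (𝓡 (2 * n + 1)) 𝓘(ℝ, EuclideanSpace ℝ (Fin (2 * n + 1))) P x) := by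
    rw [hevx.mfderiv_eq]
    exact mfderiv_comp x hd.mdifferentiableAt hmP
  rw [extD, ← hP, h1.extDeriv_eq, h2, hval, h3, mfderiv_eq_fderiv]
  rfl

theorem inChart_extD (c : M) {k : ℕ} (η : RawForm n M k)
    {y : EuclideanSpace ℝ (Fin (2 * n + 1))}
    (hy : y ∈ (extChartAt (𝓡 (2 * n + 1)) c).target)
    (hη : DifferentiableAt ℝ (inChart c η) y) :
    inChart c (extD η) y = extDeriv (inChart c η) y := by
  have : IsManifold (𝓡 (2 * n + 1)) 1 M := IsManifold.of_le (n := ∞) (by norm_num)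
  have hr := (extChartAt (𝓡 (2 * n + 1)) c).right_inv hy
  have hid := mfderiv_extChartAt_comp_mfderivWithin_extChartAt_symm hy
  rw [ModelWithCorners.range_eq_univ, mfderivWithin_univ] at hid
  rw [inChart, extD_eq c η ((extChartAt (𝓡 (2 * n + 1)) c).map_target hy) (by rwa [hr]), hr]
  ext v
  exact congrArg (extDeriv (inChart c η) y) (funext fun i => DFunLike.congr_fun hid (v i))

theorem SmoothFormOn.extD {k : ℕ} {η : RawForm n M k} {U : Set M} (hU : IsOpen U)
    (h : SmoothFormOn η U) : SmoothFormOn (extD η) U := by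
  intro c
  have h1 : ContDiffOn ℝ ∞ (fun y => extDeriv (inChart c η) y)
      ((extChartAt (𝓡 (2 * n + 1)) c).target ∩ (extChartAt (𝓡 (2 * n + 1)) c).symm ⁻¹' U) :=
    (ContinuousAlternatingMap.alternatizeUncurryFinCLM ℝ
      (EuclideanSpace ℝ (Fin (2 * n + 1))) ℝ).contDiff.comp_contDiffOn
      ((h c).fderiv_of_isOpen (isOpen_chart_preimage hU c) (by norm_num))
  exact h1.congr fun y hy => inChart_extD c η hy.1 (h.differentiableAt hU c hy.1 hy.2)

/-- The exterior derivative `d : Λᵏ → Λᵏ⁺¹` on smooth forms. -/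
def dForm (n : ℕ) (M : Type*) [TopologicalSpace M]
    [ChartedSpace (EuclideanSpace ℝ (Fin (2 * n + 1))) M] [IsManifold (𝓡 (2 * n + 1)) ∞ M]
    (k : ℕ) : Form n M k →ₗ[ℝ] Form n M (k + 1) where
  toFun η := ⟨extD η.1, SmoothFormOn.extD isOpen_univ η.2⟩
  map_add' η ζ := by
    apply Subtype.ext
    funext x
    have h (η : Form n M k) : DifferentiableAt ℝ (inChart x η.1)
        (extChartAt (𝓡 (2 * n + 1)) x x) :=
      SmoothFormOn.differentiableAt isOpen_univ η.2 x
        ((extChartAt _ x).map_source (mem_extChartAt_source x)) (Set.mem_univ _)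
    change extD (η.1 + ζ.1) x = extD η.1 x + extD ζ.1 x
    simp only [Contact.extD]
    rw [inChart_add, extDeriv_add (h η) (h ζ)]
    rfl
  map_smul' a η := by
    apply Subtype.ext
    funext x
    change Contact.extD (a • η.1) x = a • Contact.extD η.1 x
    simp only [Contact.extD]
    rw [inChart_smul, extDeriv_smul]
    rfl

end Forms

/-! ### Contact structures -/

section ContactStructures

/-- A contact form, defined on the open set `U`, for the distribution `ξ`: a smooth one-form on `U`
with kernel `ξ`. -/
structure IsContactForm {n : ℕ} {M : Type*} [TopologicalSpace M]
    [ChartedSpace (EuclideanSpace ℝ (Fin (2 * n + 1))) M]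
    (ξ : (x : M) → Submodule ℝ (TangentSpace (𝓡 (2 * n + 1)) x)) (U : Set M)
    (θ : RawForm n M 1) : Prop where
  isOpen : IsOpen U
  smooth : SmoothFormOn θ U
  ker : ∀ x ∈ U, ∀ v : TangentSpace (𝓡 (2 * n + 1)) x, v ∈ ξ x ↔ θ x (fun _ => v) = 0

/-- A contact structure on a `(2n+1)`-manifold: a maximally non-integrable hyperplane
distribution, that is, one which near every point is the kernel of a smooth one-form `θ` such that
`θ ∧ (dθ)ⁿ` vanishes nowhere. -/
structure ContactStructure (n : ℕ) (M : Type*) [TopologicalSpace M]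
    [ChartedSpace (EuclideanSpace ℝ (Fin (2 * n + 1))) M] where
  dist : (x : M) → Submodule ℝ (TangentSpace (𝓡 (2 * n + 1)) x)
  exists_contactForm : ∀ x : M, ∃ (U : Set M) (θ : RawForm n M 1), x ∈ U ∧
    IsContactForm dist U θ ∧ ∀ y ∈ U, wedgePow (extD θ y) n (θ y) ≠ 0

variable {n : ℕ} {M : Type*} [TopologicalSpace M]
  [ChartedSpace (EuclideanSpace ℝ (Fin (2 * n + 1))) M] [IsManifold (𝓡 (2 * n + 1)) ∞ M]

/-- Vertical `k`-forms: those annihilated by the wedge product with any local contact form. -/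
def ContactStructure.vertical (ξ : ContactStructure n M) (k : ℕ) : Submodule ℝ (Form n M k) where
  carrier := {η | ∀ (U : Set M) (θ : RawForm n M 1), IsContactForm ξ.dist U θ →
    ∀ x ∈ U, wedge (θ x) (η.1 x) = 0}
  add_mem' hη hζ U θ hθ x hx := wedge_add_eq_zero (hη U θ hθ x hx) (hζ U θ hθ x hx)
  zero_mem' _ _ _ _ _ := wedge_zero_right _
  smul_mem' a _ hη U θ hθ x hx := wedge_smul_eq_zero a (hη U θ hθ x hx)

/-- The space `ℛᵏ` of Rumin `k`-forms, where `θ` ranges over the local contact forms: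
`θ ∧ η ∧ dθⁿ⁺¹⁻ᵏ = 0` and `θ ∧ dη ∧ dθⁿ⁻ᵏ = 0` if `k ≤ n`,
and `θ ∧ η = 0` and `θ ∧ dη = 0` if `k ≥ n + 1`. -/
def ContactStructure.ruminForm (ξ : ContactStructure n M) (k : ℕ) :
    Submodule ℝ (Form n M k) where
  carrier := {η | ∀ (U : Set M) (θ : RawForm n M 1), IsContactForm ξ.dist U θ → ∀ x ∈ U,
    (k ≤ n →
      wedgeWith (θ x) (extD θ x) k (n + 1 - k) (η.1 x) = 0 ∧
      wedgeWith (θ x) (extD θ x) (k + 1) (n - k) ((dForm n M k η).1 x) = 0) ∧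
    (n + 1 ≤ k → wedge (θ x) (η.1 x) = 0 ∧ wedge (θ x) ((dForm n M k η).1 x) = 0)}
  add_mem' {η ζ} hη hζ U θ hθ x hx := by
    have e : (dForm n M k (η + ζ)).1 x = (dForm n M k η).1 x + (dForm n M k ζ).1 x := by
      rw [map_add]; rfl
    rw [e, show (η + ζ).1 x = η.1 x + ζ.1 x from rfl]
    obtain ⟨h1, h2⟩ := hη U θ hθ x hx
    obtain ⟨h1', h2'⟩ := hζ U θ hθ x hx
    exact ⟨fun hk => ⟨add_mem (S := Submodule ℝ _) (s := LinearMap.ker _) (h1 hk).1 (h1' hk).1,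
      add_mem (S := Submodule ℝ _) (s := LinearMap.ker _) (h1 hk).2 (h1' hk).2⟩,
      fun hk => ⟨wedge_add_eq_zero (h2 hk).1 (h2' hk).1, wedge_add_eq_zero (h2 hk).2 (h2' hk).2⟩⟩
  zero_mem' U θ _ x _ := by
    have e : (dForm n M k 0).1 x = 0 := by rw [map_zero]; rfl
    rw [e, show (0 : Form n M k).1 x = 0 from rfl]
    exact ⟨fun _ => ⟨LinearMap.map_zero _, LinearMap.map_zero _⟩,
      fun _ => ⟨wedge_zero_right _, wedge_zero_right _⟩⟩
  smul_mem' a η hη U θ hθ x hx := by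
    have e : (dForm n M k (a • η)).1 x = a • (dForm n M k η).1 x := by
      rw [map_smul]; rfl
    rw [e, show (a • η).1 x = a • η.1 x from rfl]
    obtain ⟨h1, h2⟩ := hη U θ hθ x hx
    exact ⟨fun hk => ⟨Submodule.smul_mem (LinearMap.ker _) a (h1 hk).1,
      Submodule.smul_mem (LinearMap.ker _) a (h1 hk).2⟩,
      fun hk => ⟨wedge_smul_eq_zero a (h2 hk).1, wedge_smul_eq_zero a (h2 hk).2⟩⟩

/-- The characterization of the operator `Γ : 𝒜ᵏ⁺¹ → 𝒜₀ᵏ` of a contact manifold, for all local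
contact forms `θ` (there is nothing to say about `Γ` on `𝒜⁰`, where it is zero, or on forms of
degree greater than `2n + 1`, which are zero). In degree `K = k + 1`:
* if `K ≤ n`, then `θ ∧ η ∧ dθⁿ⁺¹⁻ᴷ = Γη ∧ dθⁿ⁺²⁻ᴷ`;
* if `K ≥ n + 1`, then `θ ∧ η = Γη ∧ dθ`, and `Γη = ζ ∧ dθᴷ⁻ⁿ⁻¹` for a vertical form `ζ` of degree
  `2n + 1 - K` on the domain of `θ`. -/
structure ContactStructure.IsGamma (ξ : ContactStructure n M)
    (Γ : (k : ℕ) → Form n M (k + 1) →ₗ[ℝ] Form n M k) : Prop where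
  vertical : ∀ (k : ℕ) (η : Form n M (k + 1)), Γ k η ∈ ξ.vertical k
  low : ∀ (k : ℕ) (hk : k + 1 ≤ n) (η : Form n M (k + 1)) (U : Set M) (θ : RawForm n M 1),
    IsContactForm ξ.dist U θ → ∀ x ∈ U,
      wedgePow (extD θ x) (n - k) (wedge (θ x) (η.1 x)) =
        castDeg (by omega) (wedgePow (extD θ x) (n + 1 - k) ((Γ k η).1 x))
  high : ∀ (k : ℕ), n ≤ k → ∀ (η : Form n M (k + 1)) (U : Set M) (θ : RawForm n M 1),
    IsContactForm ξ.dist U θ → ∀ x ∈ U,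
      wedge (θ x) (η.1 x) = castDeg (by omega) (wedge ((Γ k η).1 x) (extD θ x))
  exists_factor : ∀ (k : ℕ) (hk : n ≤ k) (hk' : k ≤ 2 * n) (η : Form n M (k + 1)) (U : Set M)
    (θ : RawForm n M 1), IsContactForm ξ.dist U θ →
      ∃ ζ : RawForm n M (2 * n - k), SmoothFormOn ζ U ∧ ∀ x ∈ U, wedge (θ x) (ζ x) = 0 ∧
        (Γ k η).1 x = castDeg (by omega) (wedgePow (extD θ x) (k - n) (ζ x))

end ContactStructures

/-! ### Graded spaces, cochain complexes and deformation retracts -/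

section Retracts

variable {A B : Type*} [AddCommGroup A] [Module ℝ A] [AddCommGroup B] [Module ℝ B]

/-- `f` is homogeneous of degree `l` with respect to the gradings `𝒜` and `ℬ`. -/
def IsHomogeneousMap (𝒜 : ℤ → Submodule ℝ A) (ℬ : ℤ → Submodule ℝ B) (l : ℤ) (f : A →ₗ[ℝ] B) :
    Prop :=
  ∀ i, ∀ a ∈ 𝒜 i, f a ∈ ℬ (i + l)

/-- `d` is the differential of a cochain complex on the graded space `A`. -/
structure IsCochainComplex (𝒜 : ℤ → Submodule ℝ A) (d : A →ₗ[ℝ] A) : Prop where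
  homogeneous : IsHomogeneousMap 𝒜 𝒜 1 d
  sq_eq_zero : d ∘ₗ d = 0

/-- `f` is a cochain map from `(A, dA)` to `(B, dB)`. -/
structure IsCochainMap (𝒜 : ℤ → Submodule ℝ A) (ℬ : ℤ → Submodule ℝ B) (dA : A →ₗ[ℝ] A)
    (dB : B →ₗ[ℝ] B) (f : A →ₗ[ℝ] B) : Prop where
  homogeneous : IsHomogeneousMap 𝒜 ℬ 0 f
  comm : f ∘ₗ dA = dB ∘ₗ f

/-- `(A, dA) ⇄ (B, dB)`, with projection `π`, inclusion `i` and homotopy `h`, is a deformation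
retract. -/
structure IsDeformationRetract (𝒜 : ℤ → Submodule ℝ A) (ℬ : ℤ → Submodule ℝ B) (dA : A →ₗ[ℝ] A)
    (dB : B →ₗ[ℝ] B) (π : A →ₗ[ℝ] B) (i : B →ₗ[ℝ] A) (h : A →ₗ[ℝ] A) : Prop where
  complexA : IsCochainComplex 𝒜 dA
  complexB : IsCochainComplex ℬ dB
  cochain_π : IsCochainMap 𝒜 ℬ dA dB π
  cochain_i : IsCochainMap ℬ 𝒜 dB dA i
  homogeneous_h : IsHomogeneousMap 𝒜 𝒜 (-1) h
  homotopy : i ∘ₗ π = LinearMap.id - dA ∘ₗ h - h ∘ₗ dA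
  retract : π ∘ₗ i = LinearMap.id

end Retracts

/-! ### The de Rham complex and the Rumin complex -/

section Complexes

/-- The total space `𝒜 = ⨁ₖ 𝒜ᵏ` of smooth differential forms. -/
abbrev DeRham (n : ℕ) (M : Type*) [TopologicalSpace M]
    [ChartedSpace (EuclideanSpace ℝ (Fin (2 * n + 1))) M] : Type _ :=
  DirectSum ℕ fun k => Form n M k

/-- The homogeneous elements of degree `i` in `𝒜`; there are none but `0` if `i < 0`. -/
def degreePart (n : ℕ) (M : Type*) [TopologicalSpace M]
    [ChartedSpace (EuclideanSpace ℝ (Fin (2 * n + 1))) M] (i : ℤ) :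
    Submodule ℝ (DeRham n M) where
  carrier := {a | ∀ k : ℕ, (k : ℤ) ≠ i → a k = 0}
  add_mem' {a b} ha hb k hk := by rw [DirectSum.add_apply, ha k hk, hb k hk, add_zero]
  zero_mem' _ _ := rfl
  smul_mem' c a ha k hk := by rw [DirectSum.smul_apply, ha k hk, smul_zero]

variable {n : ℕ} {M : Type*} [TopologicalSpace M]
  [ChartedSpace (EuclideanSpace ℝ (Fin (2 * n + 1))) M]

/-- The endomorphism of `𝒜` of degree `-1` with the components `Γ k : 𝒜ᵏ⁺¹ → 𝒜ᵏ`. -/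
def lower (Γ : (k : ℕ) → Form n M (k + 1) →ₗ[ℝ] Form n M k) : DeRham n M →ₗ[ℝ] DeRham n M :=
  DirectSum.toModule ℝ ℕ _ fun
    | 0 => 0
    | k + 1 => DirectSum.lof ℝ ℕ (fun k => Form n M k) k ∘ₗ Γ k

variable [IsManifold (𝓡 (2 * n + 1)) ∞ M]

/-- The exterior derivative on `𝒜`. -/
def dTotal (n : ℕ) (M : Type*) [TopologicalSpace M]
    [ChartedSpace (EuclideanSpace ℝ (Fin (2 * n + 1))) M] [IsManifold (𝓡 (2 * n + 1)) ∞ M] :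
    DeRham n M →ₗ[ℝ] DeRham n M :=
  DirectSum.toModule ℝ ℕ _ fun k =>
    DirectSum.lof ℝ ℕ (fun k => Form n M k) (k + 1) ∘ₗ dForm n M k

/-- `π = 1 - dΓ - Γd` as an endomorphism of `𝒜`. -/
def projection (Γ : (k : ℕ) → Form n M (k + 1) →ₗ[ℝ] Form n M k) :
    DeRham n M →ₗ[ℝ] DeRham n M :=
  (LinearMap.id : DeRham n M →ₗ[ℝ] DeRham n M) - (dTotal n M).comp (lower Γ) -
    (lower Γ).comp (dTotal n M)

/-- The subspace `ℛ = ⨁ₖ ℛᵏ` of `𝒜`. -/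
def ContactStructure.rumin (ξ : ContactStructure n M) : Submodule ℝ (DeRham n M) where
  carrier := {a | ∀ k, a k ∈ ξ.ruminForm k}
  add_mem' {a b} ha hb k := by rw [DirectSum.add_apply]; exact add_mem (ha k) (hb k)
  zero_mem' k := zero_mem (ξ.ruminForm k)
  smul_mem' c a ha k := by rw [DirectSum.smul_apply]; exact Submodule.smul_mem _ c (ha k)

/-- The homogeneous elements of degree `i` in `ℛ`. -/
def ContactStructure.ruminDegreePart (ξ : ContactStructure n M) (i : ℤ) :
    Submodule ℝ ξ.rumin :=
  (degreePart n M i).comap ξ.rumin.subtype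

end Complexes

/-! ### Contactomorphisms -/

section Contactomorphisms

variable {n : ℕ} {M M' : Type*} [TopologicalSpace M]
  [ChartedSpace (EuclideanSpace ℝ (Fin (2 * n + 1))) M] [TopologicalSpace M']
  [ChartedSpace (EuclideanSpace ℝ (Fin (2 * n + 1))) M']

/-- A diffeomorphism whose differential maps `ξ` to `ξ'`. -/
def IsContactomorphism (ξ : ContactStructure n M) (ξ' : ContactStructure n M')
    (Φ : Diffeomorph (𝓡 (2 * n + 1)) (𝓡 (2 * n + 1)) M M' ∞) : Prop :=
  ∀ (x : M) (v : TangentSpace (𝓡 (2 * n + 1)) x),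
    v ∈ ξ.dist x ↔ mfderiv (𝓡 (2 * n + 1)) (𝓡 (2 * n + 1)) Φ x v ∈ ξ'.dist (Φ x)

/-- `a` is the pullback `Φ^* a'`. -/
def IsPullback (Φ : Diffeomorph (𝓡 (2 * n + 1)) (𝓡 (2 * n + 1)) M M' ∞)
    (a : DeRham n M) (a' : DeRham n M') : Prop :=
  ∀ (k : ℕ) (x : M), (a k).1 x = ((a' k).1 (Φ x)).compContinuousLinearMap
    (mfderiv (𝓡 (2 * n + 1)) (𝓡 (2 * n + 1)) Φ x)

end Contactomorphisms

end Contact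

end

universe u

/-! Fix a point, and let `α` and `β` be the values there of a contact form `θ` and of `dθ`, so that
`α ∧ βⁿ ≠ 0`. Vertical `p`-forms are the multiples of `α`, that is, `(p-1)`-forms on the symplectic
space `(ξ, β)` times `α`. The linear Lefschetz theorem therefore says that for `p + m = n + 1`
multiplication by `βᵐ` is an isomorphism from vertical `p`-forms onto vertical `(p + 2m)`-forms
(`lefschetz_injective`, `lefschetz_surjective`). This solves the defining equations of `Γ` uniquely
at each point: in low degree the equation for `Γη` itself, in high degree the equation for its
factor `ζ` (`IsGammaAt.unique`, `IsGammaAt.exists`).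

Any other contact form is `cθ` with `c` nowhere zero, and its derivative acts on vertical forms as
`c dθ`. The powers of `c` in the equations cancel, so `Γη` depends on `ξ` alone
(`IsGammaAt.rescale`). As the solution of a linear system with smooth coefficients and injective
matrix, it is smooth (`contDiffAt_of_isGammaAt`).

The rest is formal. The operator `Γ` has vertical values and kills vertical forms, so `Γ² = 0`.
Differentiating `θ ∧ Γη = 0` gives `θ ∧ dΓη = Γη ∧ dθ`, so `Γη` solves the equations posed by `dΓη`,
and `ΓdΓ = Γ`. The Rumin conditions on `ω` say exactly that `Γω = 0` and `Γdω = 0`. With `d² = 0`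
these identities make `1 - dΓ - Γd` a cochain projection onto `ℛ`. A contactomorphism pulls the
defining equations back to the defining equations, so uniqueness gives invariance. -/

noncomputable section

namespace Contact

/-! ### Two-vectors and contractions in the exterior algebra -/

section ExteriorAlgebraLemmas

open ExteriorAlgebra CliffordAlgebra

variable {W : Type*} [AddCommGroup W] [Module ℝ W]

theorem ι_mul_ι_swap (a b : W) :
    ExteriorAlgebra.ι ℝ a * ExteriorAlgebra.ι ℝ b =
      -(ExteriorAlgebra.ι ℝ b * ExteriorAlgebra.ι ℝ a) :=
  eq_neg_of_add_eq_zero_left (ExteriorAlgebra.ι_add_mul_swap a b)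

theorem exteriorPower_two_induction {C : ExteriorAlgebra ℝ W → Prop}
    (mul : ∀ a b, C (ExteriorAlgebra.ι ℝ a * ExteriorAlgebra.ι ℝ b))
    (add : ∀ x y, C x → C y → C (x + y)) {x : ExteriorAlgebra ℝ W} (hx : x ∈ ⋀[ℝ]^2 W) : C x := by
  rw [exteriorPower, pow_two] at hx
  induction hx using Submodule.mul_induction_on' with
  | mem_mul_mem m hm n hn =>
    obtain ⟨a, rfl⟩ := hm
    obtain ⟨b, rfl⟩ := hn
    exact mul a b
  | add x _ y _ hx hy => exact add x y hx hy

theorem exteriorPower_succ_induction {p : ℕ} {C : ExteriorAlgebra ℝ W → Prop}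
    (mul : ∀ a, ∀ y ∈ ⋀[ℝ]^p W, C (ExteriorAlgebra.ι ℝ a * y))
    (add : ∀ x y, C x → C y → C (x + y)) {x : ExteriorAlgebra ℝ W} (hx : x ∈ ⋀[ℝ]^(p + 1) W) :
    C x := by
  rw [exteriorPower, pow_succ'] at hx
  induction hx using Submodule.mul_induction_on' with
  | mem_mul_mem m hm n hn =>
    obtain ⟨a, rfl⟩ := hm
    exact mul a n hn
  | add x _ y _ hx hy => exact add x y hx hy

theorem mem_exteriorPower_zero {x : ExteriorAlgebra ℝ W} (hx : x ∈ ⋀[ℝ]^0 W) :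
    ∃ c : ℝ, x = algebraMap ℝ _ c := by
  rw [exteriorPower, pow_zero, Submodule.mem_one] at hx
  obtain ⟨c, rfl⟩ := hx
  exact ⟨c, rfl⟩

theorem exists_ι_eq {x : ExteriorAlgebra ℝ W} (hx : x ∈ ⋀[ℝ]^1 W) :
    ∃ w, ExteriorAlgebra.ι ℝ w = x := by
  rwa [exteriorPower, pow_one] at hx

theorem mul_mem_exteriorPower {p q : ℕ} {x y : ExteriorAlgebra ℝ W} (hx : x ∈ ⋀[ℝ]^p W)
    (hy : y ∈ ⋀[ℝ]^q W) : x * y ∈ ⋀[ℝ]^(p + q) W := by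
  rw [exteriorPower, pow_add]
  exact Submodule.mul_mem_mul hx hy

theorem ι_mem_exteriorPower (a : W) : ExteriorAlgebra.ι ℝ a ∈ ⋀[ℝ]^1 W := by
  rw [exteriorPower, pow_one]
  exact ⟨a, rfl⟩

theorem pow_mem_exteriorPower {β : ExteriorAlgebra ℝ W} (hβ : β ∈ ⋀[ℝ]^2 W) (m : ℕ) :
    β ^ m ∈ ⋀[ℝ]^(2 * m) W := by
  rw [exteriorPower, pow_mul]
  exact Submodule.pow_mem_pow _ hβ m

/-- Elements of degree two are central in the exterior algebra. -/
theorem commute_of_mem_exteriorPower_two {β : ExteriorAlgebra ℝ W} (hβ : β ∈ ⋀[ℝ]^2 W)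
    (x : ExteriorAlgebra ℝ W) : Commute β x := by
  induction x using ExteriorAlgebra.induction with
  | algebraMap r => exact (Algebra.commutes r β).symm
  | add x y hx hy => exact hx.add_right hy
  | mul x y hx hy => exact hx.mul_right hy
  | ι c =>
    refine exteriorPower_two_induction (C := fun β => Commute β (ExteriorAlgebra.ι ℝ c))
      (fun a b => ?_) (fun x y hx hy => hx.add_left hy) hβ
    -- Moving `c` past `b` and then past `a` costs two signs, which cancel.
    rw [Commute, SemiconjBy, mul_assoc, ι_mul_ι_swap b c, mul_neg, ← mul_assoc, ι_mul_ι_swap a c,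
      neg_mul, neg_neg, mul_assoc]

theorem contractLeft_mem_exteriorPower (d : Module.Dual ℝ W) {p : ℕ} :
    ∀ {x : ExteriorAlgebra ℝ W}, x ∈ ⋀[ℝ]^(p + 1) W →
      contractLeft (Q := (0 : QuadraticForm ℝ W)) d x ∈ ⋀[ℝ]^p W := by
  induction p with
  | zero =>
    intro x hx
    refine exteriorPower_succ_induction
      (C := fun x => contractLeft (Q := (0 : QuadraticForm ℝ W)) d x ∈ ⋀[ℝ]^_ W)
      (fun a y hy => ?_) (fun x y hx hy => by rw [map_add]; exact add_mem hx hy) hx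
    obtain ⟨c, rfl⟩ := mem_exteriorPower_zero hy
    rw [contractLeft_mul_algebraMap, contractLeft_ι]
    rw [← map_mul, exteriorPower, pow_zero, Submodule.mem_one]
    exact ⟨_, rfl⟩
  | succ p ih =>
    intro x hx
    refine exteriorPower_succ_induction
      (C := fun x => contractLeft (Q := (0 : QuadraticForm ℝ W)) d x ∈ ⋀[ℝ]^_ W)
      (fun a y hy => ?_) (fun x y hx hy => by rw [map_add]; exact add_mem hx hy) hx
    rw [contractLeft_ι_mul]
    refine sub_mem (Submodule.smul_mem _ _ hy) ?_
    have := mul_mem_exteriorPower (ι_mem_exteriorPower a) (ih hy)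
    rwa [add_comm] at this

theorem contractLeft_eq_zero_of_mem_exteriorPower_zero (d : Module.Dual ℝ W)
    {x : ExteriorAlgebra ℝ W} (hx : x ∈ ⋀[ℝ]^0 W) :
    contractLeft (Q := (0 : QuadraticForm ℝ W)) d x = 0 := by
  obtain ⟨c, rfl⟩ := mem_exteriorPower_zero hx
  exact contractLeft_algebraMap ..

/-- The exterior algebra is the Clifford algebra of the zero form, and its left contraction is the
interior product, an antiderivation. Past a factor of even degree the Leibniz rule carries no sign.
-/
theorem contractLeft_two_mul (d : Module.Dual ℝ W) {β : ExteriorAlgebra ℝ W} (hβ : β ∈ ⋀[ℝ]^2 W)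
    (x : ExteriorAlgebra ℝ W) :
    contractLeft (Q := (0 : QuadraticForm ℝ W)) d (β * x) =
      contractLeft (Q := (0 : QuadraticForm ℝ W)) d β * x +
        β * contractLeft (Q := (0 : QuadraticForm ℝ W)) d x := by
  refine exteriorPower_two_induction (C := fun β =>
    contractLeft (Q := (0 : QuadraticForm ℝ W)) d (β * x) =
      contractLeft (Q := (0 : QuadraticForm ℝ W)) d β * x +
        β * contractLeft (Q := (0 : QuadraticForm ℝ W)) d x) (fun a b => ?_)
    (fun x y hx hy => ?_) hβ
  · rw [mul_assoc, contractLeft_ι_mul, contractLeft_ι_mul, contractLeft_ι_mul, contractLeft_ι]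
    rw [mul_sub, sub_mul, mul_assoc, mul_assoc, smul_mul_assoc, ← Algebra.smul_def]
    abel
  · rw [add_mul, map_add, hx, hy, map_add, add_mul, add_mul]
    abel

/-- Since `β` is central, contraction differentiates its powers by the usual power rule. -/
theorem contractLeft_pow_mul (d : Module.Dual ℝ W) {β : ExteriorAlgebra ℝ W}
    (hβ : β ∈ ⋀[ℝ]^2 W) (m : ℕ) (x : ExteriorAlgebra ℝ W) :
    contractLeft (Q := (0 : QuadraticForm ℝ W)) d (β ^ (m + 1) * x) =
      (m + 1 : ℝ) • (contractLeft (Q := (0 : QuadraticForm ℝ W)) d β * (β ^ m * x)) +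
        β ^ (m + 1) * contractLeft (Q := (0 : QuadraticForm ℝ W)) d x := by
  induction m with
  | zero => simp [contractLeft_two_mul d hβ]
  | succ m ih =>
    rw [pow_succ' β (m + 1), mul_assoc, contractLeft_two_mul d hβ, ih, mul_add, mul_smul_comm,
      ← mul_assoc β (contractLeft d β), (commute_of_mem_exteriorPower_two hβ _).eq,
      mul_assoc _ β, ← mul_assoc β (β ^ m), ← pow_succ', ← mul_assoc β (β ^ (m + 1)),
      ← pow_succ', ← add_assoc]
    congr 1
    push_cast
    module

/-- Euler's identity: `∑ᵢ eᵢ ∧ (eⁱ ⌋ x) = p x` for `x` of degree `p`. -/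
theorem sum_ι_mul_contractLeft {I : Type*} [Fintype I] (b : Module.Basis I ℝ W) {p : ℕ} :
    ∀ {x : ExteriorAlgebra ℝ W}, x ∈ ⋀[ℝ]^p W →
      ∑ i, ExteriorAlgebra.ι ℝ (b i) *
        contractLeft (Q := (0 : QuadraticForm ℝ W)) (b.coord i) x = (p : ℝ) • x := by
  induction p with
  | zero =>
    intro x hx
    simp [contractLeft_eq_zero_of_mem_exteriorPower_zero _ hx]
  | succ p ih =>
    intro x hx
    refine exteriorPower_succ_induction (C := fun x => ∑ i, ExteriorAlgebra.ι ℝ (b i) *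
      contractLeft (Q := (0 : QuadraticForm ℝ W)) (b.coord i) x = ((p + 1 : ℕ) : ℝ) • x)
      (fun a y hy => ?_) (fun x y hx hy => ?_) hx
    · have h : ∀ i, ExteriorAlgebra.ι ℝ (b i) * contractLeft (Q := (0 : QuadraticForm ℝ W))
          (b.coord i) (ExteriorAlgebra.ι ℝ a * y) =
          ExteriorAlgebra.ι ℝ (b.repr a i • b i) * y + ExteriorAlgebra.ι ℝ a *
            (ExteriorAlgebra.ι ℝ (b i) *
              contractLeft (Q := (0 : QuadraticForm ℝ W)) (b.coord i) y) := by
        intro i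
        rw [contractLeft_ι_mul, mul_sub, ← mul_assoc, ι_mul_ι_swap (b i) a, map_smul,
          smul_mul_assoc, mul_smul_comm, neg_mul, sub_neg_eq_add, mul_assoc, Module.Basis.coord_apply]
      rw [Finset.sum_congr rfl fun i _ => h i, Finset.sum_add_distrib, ← Finset.sum_mul, ← map_sum,
        b.sum_repr, ← Finset.mul_sum, ih hy, mul_smul_comm]
      push_cast
      module
    · simp only [map_add, mul_add, Finset.sum_add_distrib, hx, hy, smul_add]

/-- By Euler's identity a form of positive degree is recovered from its contractions. -/
theorem eq_zero_of_contractLeft_eq_zero [FiniteDimensional ℝ W] {p : ℕ} {x : ExteriorAlgebra ℝ W}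
    (hx : x ∈ ⋀[ℝ]^(p + 1) W)
    (h : ∀ d, contractLeft (Q := (0 : QuadraticForm ℝ W)) d x = 0) : x = 0 := by
  have h1 := sum_ι_mul_contractLeft (Module.finBasis ℝ W) hx
  simp only [h, mul_zero, Finset.sum_const_zero] at h1
  exact (smul_eq_zero.1 h1.symm).resolve_left (by positivity)

/-- If `w ∧ x = 0` and `d w = 1`, then `x = w ∧ (d ⌋ x)`. -/
theorem eq_ι_mul_contractLeft {w : W} {d : Module.Dual ℝ W} (hd : d w = 1)
    {x : ExteriorAlgebra ℝ W} (hx : ExteriorAlgebra.ι ℝ w * x = 0) :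
    x = ExteriorAlgebra.ι ℝ w * contractLeft (Q := (0 : QuadraticForm ℝ W)) d x := by
  have h := contractLeft_ι_mul (Q := (0 : QuadraticForm ℝ W)) (d := d) w x
  rw [hx, map_zero, hd, one_smul] at h
  exact sub_eq_zero.1 h.symm

/-- Injectivity in the Lefschetz theorem for vertical forms: if `w ∧ βⁿ ≠ 0`, then
multiplication by `βⁿ⁺¹⁻ᵖ` is injective on the forms of degree `p` annihilated by `w`. -/
theorem lefschetz_injective [FiniteDimensional ℝ W] {n : ℕ} {w : W} {β : ExteriorAlgebra ℝ W}
    (hβ : β ∈ ⋀[ℝ]^2 W) (hn : ExteriorAlgebra.ι ℝ w * β ^ n ≠ 0) {p : ℕ} :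
    ∀ {m : ℕ}, p + m = n + 1 → ∀ {x : ExteriorAlgebra ℝ W}, x ∈ ⋀[ℝ]^p W →
      ExteriorAlgebra.ι ℝ w * x = 0 → β ^ m * x = 0 → x = 0 := by
  have hw : w ≠ 0 := by
    rintro rfl
    simp at hn
  obtain ⟨d, hd⟩ := Module.Projective.exists_dual_eq_one ℝ hw
  induction p with
  | zero =>
    intro m _ x hx hwx _
    obtain ⟨c, rfl⟩ := mem_exteriorPower_zero hx
    rw [← Algebra.commutes, ← Algebra.smul_def, smul_eq_zero, ExteriorAlgebra.ι_eq_zero_iff] at hwx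
    rw [hwx.resolve_right hw, map_zero]
  | succ p ih =>
    intro m hm x hx hwx hβx
    -- Here `W` is a dual space, so `w` is the contact form and `v` is a vector in its kernel.
    -- Contraction with `v` lowers `p` by one and keeps the form vertical; the induction hypothesis
    -- then applies with exponent `m + 1`.
    have hker : ∀ v : Module.Dual ℝ W, v w = 0 →
        contractLeft (Q := (0 : QuadraticForm ℝ W)) v x = 0 := by
      intro v hv
      refine ih (m := m + 1) (by omega) (contractLeft_mem_exteriorPower v hx) ?_ ?_
      · have h := contractLeft_ι_mul (Q := (0 : QuadraticForm ℝ W)) (d := v) w x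
        rw [hwx, map_zero, hv, zero_smul, zero_sub] at h
        exact neg_eq_zero.1 h.symm
      -- In the power rule for `βᵐ⁺¹ ∧ x = 0`, the term containing `βᵐ ∧ x` vanishes too, which
      -- leaves `βᵐ⁺¹ ∧ (v ⌋ x) = 0`.
      · have h := contractLeft_pow_mul v hβ m x
        rwa [hβx, pow_succ', mul_assoc, hβx, mul_zero, mul_zero, map_zero, smul_zero, zero_add,
          eq_comm, ← pow_succ'] at h
    have hx' := eq_ι_mul_contractLeft hd hwx
    set y := contractLeft (Q := (0 : QuadraticForm ℝ W)) d x with hy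
    have hyp : y ∈ ⋀[ℝ]^p W := contractLeft_mem_exteriorPower d hx
    -- Split `v` into a vector killed by `w` and a multiple of `d`. The first anticommutes with `d`
    -- and kills `x`; the second contributes `d ⌋ d ⌋ x = 0`.
    have hyd : ∀ v, contractLeft (Q := (0 : QuadraticForm ℝ W)) v y = 0 := by
      intro v
      have hv : v = (v - v w • d) + v w • d := by abel
      have h0 : (v - v w • d) w = 0 := by simp [hd]
      rw [hv, map_add, LinearMap.add_apply, map_smul, LinearMap.smul_apply, hy, contractLeft_comm,
        hker _ h0, map_zero, contractLeft_contractLeft, smul_zero, neg_zero, add_zero]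
    -- Now `y` has all contractions zero. In positive degree it vanishes; in degree zero `x` is a
    -- multiple of `w` with `m = n`, and this is where `w ∧ βⁿ ≠ 0` is used.
    rcases p with _ | p
    · obtain ⟨c, hc⟩ := mem_exteriorPower_zero hyp
      obtain rfl : m = n := by omega
      rw [hx', hc, ← Algebra.commutes, ← Algebra.smul_def, mul_smul_comm, smul_eq_zero,
        ((commute_of_mem_exteriorPower_two hβ _).pow_left m).eq] at hβx
      rw [hx', hc, hβx.resolve_right hn, map_zero, mul_zero]
    · rw [hx', eq_zero_of_contractLeft_eq_zero hyp hyd, mul_zero]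

/-- The elements of degree `p` of the exterior algebra that are annihilated by `w`. -/
def annihilated (w : W) (p : ℕ) : Submodule ℝ (ExteriorAlgebra ℝ W) :=
  ⋀[ℝ]^p W ⊓ LinearMap.ker (LinearMap.mulLeft ℝ (ExteriorAlgebra.ι ℝ w))

instance [FiniteDimensional ℝ W] (w : W) (p : ℕ) : FiniteDimensional ℝ (annihilated w p) :=
  Submodule.finiteDimensional_of_le (inf_le_left : annihilated w p ≤ ⋀[ℝ]^p W)

theorem annihilated_zero {w : W} (hw : w ≠ 0) : annihilated w 0 = ⊥ := by
  rw [eq_bot_iff]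
  rintro x ⟨hx, hwx : ExteriorAlgebra.ι ℝ w * x = 0⟩
  obtain ⟨c, rfl⟩ := mem_exteriorPower_zero hx
  rw [← Algebra.commutes, ← Algebra.smul_def, smul_eq_zero, ExteriorAlgebra.ι_eq_zero_iff] at hwx
  rw [hwx.resolve_right hw, map_zero]
  exact zero_mem _

/-- Multiplication by `w ≠ 0` gives an exact Koszul complex, so its kernel in degree `p` and its
image in degree `p + 1` are both spaces of annihilated elements. Rank-nullity adds up their
dimensions. -/
theorem finrank_annihilated_succ_add [FiniteDimensional ℝ W] {w : W} (hw : w ≠ 0) (p : ℕ) :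
    Module.finrank ℝ (annihilated w (p + 1)) + Module.finrank ℝ (annihilated w p) =
      (Module.finrank ℝ W).choose p := by
  obtain ⟨d, hd⟩ := Module.Projective.exists_dual_eq_one ℝ hw
  set f := (LinearMap.mulLeft ℝ (ExteriorAlgebra.ι ℝ w)).domRestrict (⋀[ℝ]^p W) with hf
  have hr : LinearMap.range f = annihilated w (p + 1) := by
    ext x
    constructor
    · rintro ⟨y, rfl⟩
      refine ⟨?_, ?_⟩
      · have := mul_mem_exteriorPower (ι_mem_exteriorPower w) y.2
        rwa [add_comm] at this
      · change ExteriorAlgebra.ι ℝ w * (ExteriorAlgebra.ι ℝ w * y.1) = 0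
        rw [← mul_assoc, ExteriorAlgebra.ι_sq_zero, zero_mul]
    · rintro ⟨hx, hwx⟩
      exact ⟨⟨_, contractLeft_mem_exteriorPower d hx⟩, (eq_ι_mul_contractLeft hd hwx).symm⟩
  have hk : Module.finrank ℝ (LinearMap.ker f) = Module.finrank ℝ (annihilated w p) := by
    rw [← Submodule.finrank_map_subtype_eq, hf, LinearMap.ker_domRestrict,
      Submodule.map_comap_subtype]
    rfl
  rw [← hk, ← hr, LinearMap.finrank_range_add_finrank_ker, exteriorPower.finrank_eq]

/-- The recursion of `finrank_annihilated_succ_add` is Pascal's rule. -/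
theorem finrank_annihilated_succ [FiniteDimensional ℝ W] {w : W} (hw : w ≠ 0) (p : ℕ) :
    Module.finrank ℝ (annihilated w (p + 1)) = (Module.finrank ℝ W - 1).choose p := by
  have : Nontrivial W := ⟨w, 0, hw⟩
  obtain ⟨N, hN⟩ := Nat.exists_eq_succ_of_ne_zero (Module.finrank_pos (R := ℝ) (M := W)).ne'
  induction p with
  | zero =>
    have h := finrank_annihilated_succ_add hw 0
    rw [annihilated_zero hw, finrank_bot, add_zero, Nat.choose_zero_right] at h
    rw [h, Nat.choose_zero_right]
  | succ p ih =>
    have h := finrank_annihilated_succ_add hw (p + 1)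
    rw [ih, hN, Nat.succ_eq_add_one, Nat.add_sub_cancel, Nat.choose_succ_succ'] at h
    rw [hN, Nat.succ_eq_add_one, Nat.add_sub_cancel]
    omega

/-- Surjectivity in the Lefschetz theorem for vertical forms. -/
theorem lefschetz_surjective [FiniteDimensional ℝ W] {n : ℕ}
    (hW : Module.finrank ℝ W = 2 * n + 1) {w : W} {β : ExteriorAlgebra ℝ W}
    (hβ : β ∈ ⋀[ℝ]^2 W) (hn : ExteriorAlgebra.ι ℝ w * β ^ n ≠ 0) {p m : ℕ} (hm : p + m = n + 1)
    {y : ExteriorAlgebra ℝ W} (hy : y ∈ ⋀[ℝ]^(p + 2 * m) W) (hwy : ExteriorAlgebra.ι ℝ w * y = 0) :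
    ∃ x ∈ ⋀[ℝ]^p W, ExteriorAlgebra.ι ℝ w * x = 0 ∧ β ^ m * x = y := by
  have hw : w ≠ 0 := by
    rintro rfl
    simp at hn
  have hmem : ∀ x ∈ annihilated w p,
      LinearMap.mulLeft ℝ (β ^ m) x ∈ annihilated w (p + 2 * m) := by
    rintro x ⟨hx, hwx : ExteriorAlgebra.ι ℝ w * x = 0⟩
    refine ⟨?_, ?_⟩
    · have := mul_mem_exteriorPower (pow_mem_exteriorPower hβ m) hx
      rwa [add_comm] at this
    · change ExteriorAlgebra.ι ℝ w * (β ^ m * x) = 0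
      rw [← mul_assoc, ← ((commute_of_mem_exteriorPower_two hβ _).pow_left m).eq, mul_assoc, hwx,
        mul_zero]
  have hinj : Function.Injective ((LinearMap.mulLeft ℝ (β ^ m)).restrict hmem) := by
    rw [injective_iff_map_eq_zero]
    rintro ⟨x, hx, hwx⟩ h
    exact Subtype.ext (lefschetz_injective hβ hn hm hx hwx (congrArg Subtype.val h))
  -- Injectivity is promoted to bijectivity by counting: the dimensions are binomial coefficients of
  -- `2n` over `p - 1` and `n + m`, which add up to `2n`. For `p = 0` one has `m = n + 1`, and both
  -- spaces are zero.
  have hdim : Module.finrank ℝ (annihilated w p) = Module.finrank ℝ (annihilated w (p + 2 * m)) := by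
    have hq : p + 2 * m = (n + m) + 1 := by omega
    rw [hq, finrank_annihilated_succ hw, hW, Nat.add_sub_cancel]
    rcases p with _ | p
    · rw [annihilated_zero hw, finrank_bot, Nat.choose_eq_zero_of_lt (by omega)]
    · rw [finrank_annihilated_succ hw, hW, Nat.add_sub_cancel,
        ← Nat.choose_symm (show p ≤ 2 * n by omega)]
      congr 1
      omega
  obtain ⟨⟨x, hx, hwx⟩, h⟩ :=
    (LinearMap.injective_iff_surjective_of_finrank_eq_finrank hdim).1 hinj ⟨y, hy, hwy⟩
  exact ⟨x, hx, hwx, congrArg Subtype.val h⟩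

end ExteriorAlgebraLemmas

/-! ### Alternating forms as elements of the exterior algebra of the dual space -/

section ToExterior

variable {V : Type*} [NormedAddCommGroup V] [NormedSpace ℝ V]

/-- Each shuffle class has `p! q!` representatives in the symmetric group. The sum over all
permutations is easier to antisymmetrize than the sum over classes. -/
theorem factorial_mul_wedge {p q : ℕ} (α : V [⋀^Fin p]→L[ℝ] ℝ) (β : V [⋀^Fin q]→L[ℝ] ℝ)
    (v : Fin (p + q) → V) :
    (p.factorial * q.factorial : ℝ) * wedge α β v =
      ∑ τ : Equiv.Perm (Fin (p + q)), Equiv.Perm.sign τ •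
        (α (fun i => v (τ (Fin.castAdd q i))) * β (fun i => v (τ (Fin.natAdd p i)))) := by
  have h := congrArg (fun F => LinearMap.mul' ℝ ℝ (F (v ∘ finSumFinEquiv)))
    (MultilinearMap.domCoprod_alternization_eq α.toAlternatingMap β.toAlternatingMap)
  simp only [Fintype.card_fin, MultilinearMap.alternatization_apply, map_sum,
    AlternatingMap.smul_apply] at h
  rw [map_nsmul, nsmul_eq_mul, Nat.cast_mul] at h
  rw [wedge_apply, AlternatingMap.domCoprod'_apply, ← h]
  refine Fintype.sum_equiv (Equiv.permCongr finSumFinEquiv) _ _ fun σ => ?_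
  rw [LinearMap.map_smul_of_tower, Equiv.Perm.sign_permCongr]
  congr 1
  simp [Equiv.permCongr_apply]

theorem wedgePow_succ (β : V [⋀^Fin 2]→L[ℝ] ℝ) {p : ℕ} (j : ℕ) (α : V [⋀^Fin p]→L[ℝ] ℝ) :
    wedgePow β (j + 1) α = castDeg (by omega) (wedge (wedgePow β j α) β) := rfl

/-- The pairing of the exterior algebra of the dual space with a tuple of vectors. -/
def evalExterior {p : ℕ} (v : Fin p → V) : ExteriorAlgebra ℝ (Module.Dual ℝ V) →ₗ[ℝ] ℝ :=
  -- The pairing is zero outside degree `p`, and in degree `p` it is the determinant of the values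
  -- of the covectors on the vectors.
  ExteriorAlgebra.liftAlternating (Function.update 0 p
    (Matrix.detRowAlternating.compLinearMap (LinearMap.pi fun j => Module.Dual.eval ℝ V (v j))))

theorem evalExterior_ιMulti {p : ℕ} (v : Fin p → V) (f : Fin p → Module.Dual ℝ V) :
    evalExterior v (ExteriorAlgebra.ιMulti ℝ p f) = ∑ σ : Equiv.Perm (Fin p),
      Equiv.Perm.sign σ • ∏ i, f i (v (σ i)) := by
  rw [evalExterior, ExteriorAlgebra.liftAlternating_apply_ιMulti, Function.update_self]
  change Matrix.det (Matrix.of fun i j => f i (v j)) = _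
  rw [← Matrix.det_transpose, Matrix.det_apply]
  rfl

variable [FiniteDimensional ℝ V]

/-- The sum `∑ f (e_{i₁}, …, e_{iₚ}) eⁱ¹ ∧ ⋯ ∧ eⁱᵖ` over all multi-indices, for a fixed basis `e`. -/
def coordSum {p : ℕ} (f : (Fin p → V) → ℝ) : ExteriorAlgebra ℝ (Module.Dual ℝ V) :=
  ∑ i : Fin p → Fin (Module.finrank ℝ V), f (fun r => Module.finBasis ℝ V (i r)) •
    ExteriorAlgebra.ιMulti ℝ p (fun r => (Module.finBasis ℝ V).coord (i r))

/-- Relabelling the multi-indices by `τ` permutes the wedge of basis covectors, whose sign cancels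
the given one. -/
theorem coordSum_perm {p : ℕ} (f : (Fin p → V) → ℝ) (τ : Equiv.Perm (Fin p)) :
    coordSum (fun v => Equiv.Perm.sign τ • f (v ∘ τ)) = coordSum f := by
  unfold coordSum
  refine Fintype.sum_equiv (Equiv.arrowCongr τ.symm (Equiv.refl _)) _ _ fun i => ?_
  have h := (ExteriorAlgebra.ιMulti ℝ p (M := Module.Dual ℝ V)).map_perm
    (fun r => (Module.finBasis ℝ V).coord (i r)) τ
  change _ = f (fun r => Module.finBasis ℝ V (i (τ r))) •
    ExteriorAlgebra.ιMulti ℝ p (fun r => (Module.finBasis ℝ V).coord (i (τ r)))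
  rw [show (fun r => (Module.finBasis ℝ V).coord (i (τ r))) =
    (fun r => (Module.finBasis ℝ V).coord (i r)) ∘ τ from rfl, h, smul_comm, ← smul_assoc]
  rfl

theorem coordSum_sum {p : ℕ} {J : Type*} (s : Finset J) (f : J → (Fin p → V) → ℝ) :
    coordSum (fun v => ∑ j ∈ s, f j v) = ∑ j ∈ s, coordSum (f j) := by
  unfold coordSum
  rw [Finset.sum_comm]
  exact Finset.sum_congr rfl fun i _ => Finset.sum_smul

theorem coordSum_sum_perm {p : ℕ} (f : (Fin p → V) → ℝ) :
    coordSum (fun v => ∑ τ : Equiv.Perm (Fin p), Equiv.Perm.sign τ • f (fun r => v (τ r))) =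
      (p.factorial : ℝ) • coordSum f := by
  rw [coordSum_sum]
  refine (Finset.sum_congr rfl fun τ _ => coordSum_perm f τ).trans ?_
  simp [Fintype.card_perm, Nat.cast_smul_eq_nsmul]

theorem coordSum_const_mul {p : ℕ} (c : ℝ) (f : (Fin p → V) → ℝ) :
    coordSum (fun v => c * f v) = c • coordSum f := by
  unfold coordSum
  rw [Finset.smul_sum]
  exact Finset.sum_congr rfl fun i _ => mul_smul ..

/-- A continuous alternating form, as an element of the exterior algebra of the dual space. -/
def toExterior {p : ℕ} : (V [⋀^Fin p]→L[ℝ] ℝ) →ₗ[ℝ] ExteriorAlgebra ℝ (Module.Dual ℝ V) where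
  toFun α := ((p.factorial : ℝ)⁻¹) • coordSum α
  map_add' α β := by
    rw [← smul_add]
    congr 1
    simp only [coordSum, ContinuousAlternatingMap.add_apply, add_smul, Finset.sum_add_distrib]
  map_smul' c α := by
    rw [RingHom.id_apply, smul_comm]
    congr 1
    exact coordSum_const_mul c α

theorem toExterior_apply {p : ℕ} (α : V [⋀^Fin p]→L[ℝ] ℝ) :
    toExterior α = ((p.factorial : ℝ)⁻¹) • coordSum α := rfl

theorem toExterior_castDeg {p q : ℕ} (h : p = q) (α : V [⋀^Fin p]→L[ℝ] ℝ) :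
    toExterior (castDeg h α) = toExterior α := by
  subst h; rfl

theorem toExterior_mem {p : ℕ} (α : V [⋀^Fin p]→L[ℝ] ℝ) :
    toExterior α ∈ ⋀[ℝ]^p (Module.Dual ℝ V) :=
  Submodule.smul_mem _ _ (Submodule.sum_mem _ fun _ _ => Submodule.smul_mem _ _
    (ExteriorAlgebra.ιMulti_range ℝ p ⟨_, rfl⟩))

theorem coordSum_mul {p q : ℕ} (f : (Fin p → V) → ℝ) (g : (Fin q → V) → ℝ) :
    coordSum (fun v : Fin (p + q) → V => f (fun i => v (Fin.castAdd q i)) *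
      g (fun i => v (Fin.natAdd p i))) = coordSum f * coordSum g := by
  unfold coordSum
  rw [Finset.sum_mul_sum, ← Fintype.sum_prod_type']
  symm
  refine Fintype.sum_equiv (Fin.appendEquiv p q) _ _ fun ij => ?_
  rw [smul_mul_smul_comm, ExteriorAlgebra.ιMulti_mul_ιMulti]
  congr 2
  · simp [Fin.appendEquiv]
  · simp [Fin.appendEquiv]
  · funext r
    refine Fin.addCases (fun i => ?_) (fun i => ?_) r <;> simp [Fin.appendEquiv]

/-- The identification with the exterior algebra turns wedge products into products. -/
theorem toExterior_wedge {p q : ℕ} (α : V [⋀^Fin p]→L[ℝ] ℝ) (β : V [⋀^Fin q]→L[ℝ] ℝ) :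
    toExterior (wedge α β) = toExterior α * toExterior β := by
  -- The shuffle normalization of the wedge product contributes `p! q!` and antisymmetrization
  -- contributes `(p + q)!`. Dividing `coordSum` by the factorial of the degree is what makes the
  -- map multiplicative.
  have h : (p.factorial * q.factorial : ℝ) • coordSum (wedge α β) =
      ((p + q).factorial : ℝ) • (coordSum α * coordSum β) := by
    rw [← coordSum_const_mul]
    simp_rw [factorial_mul_wedge]
    rw [← coordSum_mul]
    exact coordSum_sum_perm (fun v : Fin (p + q) → V =>
      α (fun i => v (Fin.castAdd q i)) * β (fun i => v (Fin.natAdd p i)))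
  simp only [toExterior_apply]
  rw [smul_mul_smul_comm, ← mul_inv, eq_inv_smul_iff₀ (by positivity), smul_comm, h, smul_smul,
    inv_mul_cancel₀ (by positivity), one_smul]

theorem toExterior_wedgePow (β : V [⋀^Fin 2]→L[ℝ] ℝ) {p : ℕ} (j : ℕ) (α : V [⋀^Fin p]→L[ℝ] ℝ) :
    toExterior (wedgePow β j α) = toExterior α * toExterior β ^ j := by
  induction j with
  | zero => rw [pow_zero, mul_one, wedgePow]
  | succ j ih => rw [wedgePow_succ, toExterior_castDeg, toExterior_wedge, ih, pow_succ, mul_assoc]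

theorem sum_coord_mul_apply {p : ℕ} (α : V [⋀^Fin p]→L[ℝ] ℝ) (v : Fin p → V) :
    ∑ i : Fin p → Fin (Module.finrank ℝ V), α (fun r => Module.finBasis ℝ V (i r)) *
      ∏ r, (Module.finBasis ℝ V).coord (i r) (v r) = α v := by
  conv_rhs => rw [show v = fun r => ∑ j, (Module.finBasis ℝ V).coord j (v r) •
    Module.finBasis ℝ V j from funext fun r => ((Module.finBasis ℝ V).sum_repr (v r)).symm]
  change _ = α.toMultilinearMap _
  rw [MultilinearMap.map_sum]
  refine Finset.sum_congr rfl fun i _ => ?_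
  rw [MultilinearMap.map_smul_univ, smul_eq_mul, mul_comm]
  rfl

/-- Each of the `p!` permutations in the determinant contributes `α v`, against the factor `1 / p!`.
Evaluation is thus a left inverse, which allows identities of forms to be checked in the associative
algebra, where degrees need no casts. -/
theorem evalExterior_toExterior {p : ℕ} (α : V [⋀^Fin p]→L[ℝ] ℝ) (v : Fin p → V) :
    evalExterior v (toExterior α) = α v := by
  rw [toExterior_apply, map_smul, inv_smul_eq_iff₀ (by positivity), coordSum, map_sum]
  simp only [map_smul, evalExterior_ιMulti, smul_eq_mul, Finset.mul_sum, mul_smul_comm]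
  rw [Finset.sum_comm]
  have h : ∀ σ : Equiv.Perm (Fin p), α (v ∘ σ) = Equiv.Perm.sign σ • α v :=
    fun σ => α.toAlternatingMap.map_perm v σ
  have h' : ∀ σ : Equiv.Perm (Fin p), ∑ i : Fin p → Fin (Module.finrank ℝ V),
      Equiv.Perm.sign σ • (α (fun r => Module.finBasis ℝ V (i r)) *
        ∏ r, (Module.finBasis ℝ V).coord (i r) (v (σ r))) = α v := by
    intro σ
    rw [← Finset.smul_sum, sum_coord_mul_apply α (fun r => v (σ r))]
    change Equiv.Perm.sign σ • α (v ∘ σ) = α v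
    rw [h, smul_smul, Int.units_mul_self, one_smul]
  rw [Finset.sum_congr rfl fun σ _ => h' σ]
  simp [Fintype.card_perm]

theorem toExterior_injective {p : ℕ} :
    Function.Injective (toExterior : (V [⋀^Fin p]→L[ℝ] ℝ) →ₗ[ℝ] _) := fun α β h => by
  ext v
  rw [← evalExterior_toExterior α, h, evalExterior_toExterior]

theorem exists_toExterior_eq {p : ℕ} {x : ExteriorAlgebra ℝ (Module.Dual ℝ V)}
    (hx : x ∈ ⋀[ℝ]^p (Module.Dual ℝ V)) : ∃ α : V [⋀^Fin p]→L[ℝ] ℝ, toExterior α = x := by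
  suffices h : ⋀[ℝ]^p (Module.Dual ℝ V) ≤
      LinearMap.range (toExterior : (V [⋀^Fin p]→L[ℝ] ℝ) →ₗ[ℝ] _) from h hx
  rw [← ExteriorAlgebra.ιMulti_span_fixedDegree, Submodule.span_le]
  rintro _ ⟨f, rfl⟩
  -- A decomposable element `f₁ ∧ ⋯ ∧ fₚ` comes from the alternating form `v ↦ det (fⱼ (vᵢ))`.
  let A : V [⋀^Fin p]→ₗ[ℝ] ℝ :=
    Matrix.detRowAlternating.compLinearMap (LinearMap.pi fun i => f i)
  have hA : ∀ v, A v = ∑ σ : Equiv.Perm (Fin p), Equiv.Perm.sign σ • ∏ i, f i (v (σ i)) := by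
    intro v
    change Matrix.det (Matrix.of fun i j => f j (v i)) = _
    rw [Matrix.det_apply]
    rfl
  have hc : Continuous A := by
    have hf : ∀ i, Continuous (f i) := fun i => LinearMap.continuous_of_finiteDimensional _
    rw [show (⇑A) = _ from funext hA]
    fun_prop
  let α : V [⋀^Fin p]→L[ℝ] ℝ :=
    { toMultilinearMap := A.toMultilinearMap, cont := hc,
      map_eq_zero_of_eq' := A.map_eq_zero_of_eq' }
  refine ⟨α, ?_⟩
  have h1 : coordSum α = (p.factorial : ℝ) • coordSum (fun v => ∏ i, f i (v i)) := by
    rw [show (⇑α) = _ from funext hA]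
    exact coordSum_sum_perm (fun v : Fin p → V => ∏ i, f i (v i))
  rw [toExterior_apply, h1, smul_smul, inv_mul_cancel₀ (by positivity), one_smul]
  conv_rhs => rw [show f = fun r => ∑ j, f r (Module.finBasis ℝ V j) •
    (Module.finBasis ℝ V).coord j from funext fun r =>
      ((Module.finBasis ℝ V).sum_dual_apply_smul_coord (f r)).symm]
  change _ = (ExteriorAlgebra.ιMulti ℝ p).toMultilinearMap _
  rw [MultilinearMap.map_sum]
  refine Finset.sum_congr rfl fun i _ => ?_
  rw [MultilinearMap.map_smul_univ]
  rfl

instance {p : ℕ} : FiniteDimensional ℝ (V [⋀^Fin p]→L[ℝ] ℝ) :=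
  FiniteDimensional.of_injective
    ((toExterior : (V [⋀^Fin p]→L[ℝ] ℝ) →ₗ[ℝ] _).codRestrict (⋀[ℝ]^p _) toExterior_mem)
    fun _ _ h => toExterior_injective (congrArg Subtype.val h)

/-- This is the coordinate formula `d = ∑ eʲ ∧ ∂ⱼ` for the exterior derivative, with `T` in the role
of the derivative of the form. -/
theorem toExterior_alternatizeUncurryFin {k : ℕ} (T : V →L[ℝ] V [⋀^Fin k]→L[ℝ] ℝ) :
    toExterior (ContinuousAlternatingMap.alternatizeUncurryFin T) =
      ∑ j, ExteriorAlgebra.ι ℝ ((Module.finBasis ℝ V).coord j) *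
        toExterior (T (Module.finBasis ℝ V j)) := by
  have h : coordSum (ContinuousAlternatingMap.alternatizeUncurryFin T) =
      (k + 1 : ℝ) • ∑ j, ExteriorAlgebra.ι ℝ ((Module.finBasis ℝ V).coord j) *
        coordSum (T (Module.finBasis ℝ V j)) := by
    have h0 : ∀ v, ContinuousAlternatingMap.alternatizeUncurryFin T v =
        ∑ i : Fin (k + 1), (-1 : ℝ) ^ (i : ℕ) * T (v i) (i.removeNth v) := by
      intro v
      rw [ContinuousAlternatingMap.alternatizeUncurryFin_apply]
      simp
    rw [show (⇑(ContinuousAlternatingMap.alternatizeUncurryFin T)) = _ from funext h0, coordSum_sum]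
    -- The sign `(-1)ⁱ` is undone by moving the covector in slot `i` to the front, so all `k + 1`
    -- summands agree.
    have h1 : ∀ i : Fin (k + 1), coordSum (fun v => (-1 : ℝ) ^ (i : ℕ) * T (v i) (i.removeNth v)) =
        ∑ j, ExteriorAlgebra.ι ℝ ((Module.finBasis ℝ V).coord j) *
          coordSum (T (Module.finBasis ℝ V j)) := by
      intro i
      simp only [coordSum, Finset.mul_sum]
      rw [← Fintype.sum_prod_type']
      symm
      refine Fintype.sum_equiv (Fin.insertNthEquiv (fun _ => Fin (Module.finrank ℝ V)) i) _ _
        fun jJ => ?_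
      have e := (ExteriorAlgebra.ιMulti ℝ (k + 1) (M := Module.Dual ℝ V)).map_insertNth i
        ((Module.finBasis ℝ V).coord jJ.1) (fun r => (Module.finBasis ℝ V).coord (jJ.2 r))
      have e1 : (fun r => (Module.finBasis ℝ V).coord
          (Fin.insertNthEquiv (fun _ => Fin (Module.finrank ℝ V)) i jJ r)) =
          i.insertNth ((Module.finBasis ℝ V).coord jJ.1)
            (fun r => (Module.finBasis ℝ V).coord (jJ.2 r)) := by
        funext r
        refine Fin.succAboveCases i ?_ (fun s => ?_) r <;> simp
      rw [e1, e, ExteriorAlgebra.ιMulti_succ_apply]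
      have e2 : (i.removeNth fun r => Module.finBasis ℝ V
          (Fin.insertNthEquiv (fun _ => Fin (Module.finrank ℝ V)) i jJ r)) =
          fun r => Module.finBasis ℝ V (jJ.2 r) := by
        funext r
        simp [Fin.removeNth]
      rw [e2]
      have e3 : Fin.insertNthEquiv (fun _ => Fin (Module.finrank ℝ V)) i jJ i = jJ.1 := by simp
      rw [e3, Matrix.cons_val_zero, show ∀ (a : Module.Dual ℝ V) (f : Fin k → Module.Dual ℝ V), Matrix.vecTail (Matrix.vecCons a f) = f from fun _ _ => rfl,
        mul_smul_comm]
      rcases Nat.even_or_odd (i : ℕ) with hi | hi <;> simp [hi.neg_one_pow]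
    rw [Finset.sum_congr rfl fun i _ => h1 i]
    simp [← Nat.cast_smul_eq_nsmul ℝ]
  rw [toExterior_apply, h, smul_smul, Finset.smul_sum]
  refine Finset.sum_congr rfl fun j _ => ?_
  rw [toExterior_apply, mul_smul_comm]
  congr 1
  rw [Nat.factorial_succ]
  push_cast
  field_simp

end ToExterior

/-! ### Pullback along linear maps as an algebra homomorphism. -/

section Pullback

variable {V V' : Type*} [NormedAddCommGroup V] [NormedSpace ℝ V]
  [NormedAddCommGroup V'] [NormedSpace ℝ V']

/-- The pullback of exterior algebras of dual spaces along a linear map. -/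
def pullbackExterior (A : V →L[ℝ] V') :
    ExteriorAlgebra ℝ (Module.Dual ℝ V') →ₐ[ℝ] ExteriorAlgebra ℝ (Module.Dual ℝ V) :=
  ExteriorAlgebra.map (A : V →ₗ[ℝ] V').dualMap

theorem pullbackExterior_mem (A : V →L[ℝ] V') {p : ℕ}
    {x : ExteriorAlgebra ℝ (Module.Dual ℝ V')} (hx : x ∈ ⋀[ℝ]^p (Module.Dual ℝ V')) :
    pullbackExterior A x ∈ ⋀[ℝ]^p (Module.Dual ℝ V) := by
  rw [← ExteriorAlgebra.ιMulti_span_fixedDegree] at hx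
  induction hx using Submodule.span_induction with
  | mem x hx =>
    obtain ⟨f, rfl⟩ := hx
    rw [pullbackExterior, ExteriorAlgebra.map_apply_ιMulti]
    exact ExteriorAlgebra.ιMulti_range ℝ p ⟨_, rfl⟩
  | zero => rw [map_zero]; exact zero_mem _
  | add x y _ _ hx hy => rw [map_add]; exact add_mem hx hy
  | smul c x _ hx => rw [map_smul]; exact Submodule.smul_mem _ _ hx

theorem evalExterior_pullbackExterior (A : V →L[ℝ] V') {p : ℕ} (v : Fin p → V)
    {x : ExteriorAlgebra ℝ (Module.Dual ℝ V')} (hx : x ∈ ⋀[ℝ]^p (Module.Dual ℝ V')) :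
    evalExterior v (pullbackExterior A x) = evalExterior (fun i => A (v i)) x := by
  rw [← ExteriorAlgebra.ιMulti_span_fixedDegree] at hx
  induction hx using Submodule.span_induction with
  | mem x hx =>
    obtain ⟨f, rfl⟩ := hx
    rw [pullbackExterior, ExteriorAlgebra.map_apply_ιMulti, evalExterior_ιMulti,
      evalExterior_ιMulti]
    rfl
  | zero => simp only [map_zero]
  | add x y _ _ hx hy => simp only [map_add, hx, hy]
  | smul c x _ hx => simp only [map_smul, hx]

theorem pullbackExterior_injective {A : V →L[ℝ] V'} (hA : Function.Surjective A) :
    Function.Injective (pullbackExterior A) := by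
  refine ExteriorAlgebra.map_injective_field ?_
  exact LinearMap.ker_eq_bot.2 (LinearMap.dualMap_injective_of_surjective hA)

theorem toExterior_compContinuousLinearMap [FiniteDimensional ℝ V] [FiniteDimensional ℝ V']
    (A : V →L[ℝ] V') {p : ℕ} (α : V' [⋀^Fin p]→L[ℝ] ℝ) :
    toExterior (α.compContinuousLinearMap A) = pullbackExterior A (toExterior α) := by
  -- The right-hand side is written as the image of a form `γ`, so that the comparison can be made
  -- on vectors.
  obtain ⟨γ, hγ⟩ := exists_toExterior_eq (pullbackExterior_mem A (toExterior_mem α))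
  rw [← hγ]
  congr 1
  ext v
  rw [← evalExterior_toExterior γ, hγ, evalExterior_pullbackExterior A v (toExterior_mem α),
    evalExterior_toExterior]
  rfl

end Pullback

/-! ### Smooth families of alternating forms. -/

theorem contDiffAt_castDeg {p q : ℕ} (h : p = q) {V X : Type*} [NormedAddCommGroup V]
    [NormedSpace ℝ V] [NormedAddCommGroup X] [NormedSpace ℝ X] {α : X → V [⋀^Fin p]→L[ℝ] ℝ} {y : X}
    (hα : ContDiffAt ℝ ∞ α y) : ContDiffAt ℝ ∞ (fun z => castDeg h (α z)) y := by
  subst h; exact hα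

section Calculus

variable {V X : Type*} [NormedAddCommGroup V] [NormedSpace ℝ V] [FiniteDimensional ℝ V]
  [NormedAddCommGroup X] [NormedSpace ℝ X]

section Bilinear

variable {F G H : Type*} [NormedAddCommGroup F] [NormedSpace ℝ F] [FiniteDimensional ℝ F]
  [NormedAddCommGroup G] [NormedSpace ℝ G] [FiniteDimensional ℝ G]
  [NormedAddCommGroup H] [NormedSpace ℝ H]

theorem contDiffAt_bilinear (L : F →ₗ[ℝ] G →ₗ[ℝ] H) {f : X → F} {g : X → G} {y : X}
    (hf : ContDiffAt ℝ ∞ f y) (hg : ContDiffAt ℝ ∞ g y) :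
    ContDiffAt ℝ ∞ (fun z => L (f z) (g z)) y := by
  have h : ContDiffAt ℝ ∞ (fun z => L.toContinuousBilinearMap (f z)) y :=
    L.toContinuousBilinearMap.contDiff.contDiffAt.comp y hf
  exact h.clm_apply hg

theorem hasFDerivAt_bilinear (L : F →ₗ[ℝ] G →ₗ[ℝ] H) {f : X → F} {g : X → G} {y : X}
    {f' : X →L[ℝ] F} {g' : X →L[ℝ] G} (hf : HasFDerivAt f f' y) (hg : HasFDerivAt g g' y) :
    ∃ D : X →L[ℝ] H, HasFDerivAt (fun z => L (f z) (g z)) D y ∧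
      ∀ v, D v = L (f' v) (g y) + L (f y) (g' v) := by
  have h : HasFDerivAt (fun z => L.toContinuousBilinearMap (f z))
      (L.toContinuousBilinearMap.comp f') y := L.toContinuousBilinearMap.hasFDerivAt.comp y hf
  refine ⟨_, h.clm_apply hg, fun v => ?_⟩
  simp [add_comm]

end Bilinear

/-- The wedge product as a bilinear map. -/
def wedgeBilin (V : Type*) [NormedAddCommGroup V] [NormedSpace ℝ V] (p q : ℕ) :
    (V [⋀^Fin p]→L[ℝ] ℝ) →ₗ[ℝ] (V [⋀^Fin q]→L[ℝ] ℝ) →ₗ[ℝ] V [⋀^Fin (p + q)]→L[ℝ] ℝ :=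
  LinearMap.mk₂ ℝ wedge wedge_add_left wedge_smul_left wedge_add_right wedge_smul_right

theorem contDiffAt_wedge {p q : ℕ} {α : X → V [⋀^Fin p]→L[ℝ] ℝ} {β : X → V [⋀^Fin q]→L[ℝ] ℝ}
    {y : X} (hα : ContDiffAt ℝ ∞ α y) (hβ : ContDiffAt ℝ ∞ β y) :
    ContDiffAt ℝ ∞ (fun z => wedge (α z) (β z)) y :=
  contDiffAt_bilinear (wedgeBilin V p q) hα hβ

theorem contDiffAt_wedgePow {p : ℕ} {β : X → V [⋀^Fin 2]→L[ℝ] ℝ} {α : X → V [⋀^Fin p]→L[ℝ] ℝ}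
    {y : X} (hβ : ContDiffAt ℝ ∞ β y) (hα : ContDiffAt ℝ ∞ α y) (j : ℕ) :
    ContDiffAt ℝ ∞ (fun z => wedgePow (β z) j (α z)) y := by
  induction j with
  | zero => exact hα
  | succ j ih =>
    exact contDiffAt_castDeg (show p + 2 * j + 2 = p + 2 * (j + 1) by omega)
      (contDiffAt_wedge ih hβ)

theorem contDiffAt_clm_of_apply {F G : Type*} [NormedAddCommGroup F] [NormedSpace ℝ F]
    [FiniteDimensional ℝ F] [NormedAddCommGroup G] [NormedSpace ℝ G] {T : X → F →L[ℝ] G} {y : X}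
    (h : ∀ v, ContDiffAt ℝ ∞ (fun z => T z v) y) : ContDiffAt ℝ ∞ T y := by
  let b := Module.finBasis ℝ F
  have e : T = fun z => ∑ i, ContinuousLinearMap.smulRightL ℝ F G
      (LinearMap.toContinuousLinearMap (b.coord i)) (T z (b i)) := by
    funext z
    ext v
    conv_lhs => rw [← b.sum_repr v]
    simp [-Module.Basis.sum_repr]
  rw [e]
  exact ContDiffAt.sum fun i _ => ContinuousLinearMap.contDiff _ |>.contDiffAt.comp y (h (b i))

theorem contDiffAt_of_apply {p : ℕ} {f : X → V [⋀^Fin p]→L[ℝ] ℝ} {y : X}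
    (h : ∀ v, ContDiffAt ℝ ∞ (fun z => f z v) y) : ContDiffAt ℝ ∞ f y := by
  let L : (V [⋀^Fin p]→L[ℝ] ℝ) →ₗ[ℝ] ((Fin p → Fin (Module.finrank ℝ V)) → ℝ) :=
    { toFun := fun α i => α fun r => Module.finBasis ℝ V (i r)
      map_add' := fun _ _ => rfl
      map_smul' := fun _ _ => rfl }
  have hL : LinearMap.ker L = ⊥ := by
    rw [LinearMap.ker_eq_bot']
    intro α hα
    ext v
    rw [← sum_coord_mul_apply α v]
    refine Finset.sum_eq_zero fun i _ => ?_
    rw [show α (fun r => Module.finBasis ℝ V (i r)) = 0 from congrFun hα i, zero_mul]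
  obtain ⟨S, hS⟩ := L.exists_leftInverse_of_injective hL
  have e : f = fun z => LinearMap.toContinuousLinearMap S (L (f z)) := by
    funext z
    exact (DFunLike.congr_fun hS (f z)).symm
  rw [e]
  exact (ContinuousLinearMap.contDiff _).contDiffAt.comp y (contDiffAt_pi.2 fun i => h _)

theorem contDiffAt_compContinuousLinearMap {V' : Type*} [NormedAddCommGroup V'] [NormedSpace ℝ V']
    [FiniteDimensional ℝ V'] {p : ℕ} {f : X → V' [⋀^Fin p]→L[ℝ] ℝ} {A : X → V →L[ℝ] V'} {y : X}
    (hf : ContDiffAt ℝ ∞ f y) (hA : ContDiffAt ℝ ∞ A y) :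
    ContDiffAt ℝ ∞ (fun z => (f z).compContinuousLinearMap (A z)) y := by
  refine contDiffAt_of_apply fun v => ?_
  have e : (fun z => (f z).compContinuousLinearMap (A z) v) = fun z =>
      ∑ i : Fin p → Fin (Module.finrank ℝ V'), f z (fun r => Module.finBasis ℝ V' (i r)) *
        ∏ r, LinearMap.toContinuousLinearMap ((Module.finBasis ℝ V').coord (i r)) (A z (v r)) := by
    funext z
    exact (sum_coord_mul_apply (f z) fun r => A z (v r)).symm
  rw [e]
  refine ContDiffAt.sum fun i _ => ContDiffAt.mul ?_ (contDiffAt_prod fun r _ => ?_)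
  · exact (ContinuousAlternatingMap.apply ℝ V' ℝ _).contDiff.contDiffAt.comp y hf
  · exact (ContinuousLinearMap.contDiff _).contDiffAt.comp y (hA.clm_apply contDiffAt_const)

/-- The solution of a linear system with smooth coefficients and injective matrix is smooth. -/
theorem contDiffAt_of_injective {F G : Type*} [NormedAddCommGroup F] [NormedSpace ℝ F]
    [FiniteDimensional ℝ F] [NormedAddCommGroup G] [NormedSpace ℝ G] [FiniteDimensional ℝ G]
    {T : X → F →L[ℝ] G} {u : X → F} {y : X} (hT : ContDiffAt ℝ ∞ T y)
    (hu : ContDiffAt ℝ ∞ (fun z => T z (u z)) y) (hinj : Function.Injective (T y)) :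
    ContDiffAt ℝ ∞ u y := by
  -- A fixed left inverse `S` of `T y` makes `S ∘ T z` invertible for `z` near `y`, and there `u =
  -- (S ∘ T)⁻¹ (S (T u))`, which is smooth.
  obtain ⟨S, hS⟩ := (T y : F →ₗ[ℝ] G).exists_leftInverse_of_injective (LinearMap.ker_eq_bot.2 hinj)
  let S' : G →L[ℝ] F := LinearMap.toContinuousLinearMap S
  have hA : ContDiffAt ℝ ∞ (fun z => S'.comp (T z)) y := contDiffAt_const.clm_comp hT
  have hAy : S'.comp (T y) = 1 := by
    ext v
    exact DFunLike.congr_fun hS v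
  have hev : ∀ᶠ z in 𝓝 y, IsUnit (S'.comp (T z)) :=
    hA.continuousAt.eventually (Units.isOpen.mem_nhds (by change IsUnit (S'.comp (T y)); rw [hAy]; exact isUnit_one))
  have hinv : ContDiffAt ℝ ∞ (fun z => Ring.inverse (S'.comp (T z))) y := by
    refine ContDiffAt.comp y (g := Ring.inverse) ?_ hA
    rw [hAy]
    exact contDiffAt_ringInverse ℝ (1 : (F →L[ℝ] F)ˣ)
  refine (hinv.clm_apply (contDiffAt_const (c := S').clm_apply hu)).congr_of_eventuallyEq ?_
  filter_upwards [hev] with z hz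
  have := DFunLike.congr_fun (Ring.inverse_mul_cancel _ hz) (u z)
  exact this.symm

/-- If `α ∧ η = 0` for a one-form `α`, then `dα ∧ η = α ∧ dη`. -/
theorem extDeriv_mul_eq_of_wedge_eq_zero {k : ℕ} {α : V → V [⋀^Fin 1]→L[ℝ] ℝ}
    {η : V → V [⋀^Fin k]→L[ℝ] ℝ} {y : V} (hα : DifferentiableAt ℝ α y)
    (hη : DifferentiableAt ℝ η y) (h : ∀ᶠ z in 𝓝 y, wedge (α z) (η z) = 0) :
    toExterior (extDeriv α y) * toExterior (η y) =
      toExterior (α y) * toExterior (extDeriv η y) := by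
  -- This differentiates `α ∧ η = 0` in the direction `v`. Summing over a basis after multiplication
  -- by `eʲ` gives the claim: the sign of the product rule cancels the one from swapping `eʲ` and
  -- `α`.
  have hD : ∀ v, wedge (fderiv ℝ α y v) (η y) + wedge (α y) (fderiv ℝ η y v) = 0 := by
    intro v
    obtain ⟨D, h1, hD⟩ := hasFDerivAt_bilinear (wedgeBilin V 1 k) hα.hasFDerivAt hη.hasFDerivAt
    have h2 : HasFDerivAt (fun z => wedge (α z) (η z)) (0 : V →L[ℝ] _) y :=
      (hasFDerivAt_const (0 : V [⋀^Fin (1 + k)]→L[ℝ] ℝ) y).congr_of_eventuallyEq h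
    have h3 := hD v
    rw [h1.unique h2] at h3
    exact h3.symm
  rw [extDeriv, extDeriv, toExterior_alternatizeUncurryFin, toExterior_alternatizeUncurryFin,
    Finset.sum_mul, Finset.mul_sum]
  refine Finset.sum_congr rfl fun j _ => ?_
  obtain ⟨w, hw⟩ := exists_ι_eq (toExterior_mem (α y))
  have h4 := congrArg toExterior (hD (Module.finBasis ℝ V j))
  rw [map_add, map_zero, toExterior_wedge, toExterior_wedge] at h4
  rw [mul_assoc, eq_neg_of_add_eq_zero_left h4, ← hw, ← mul_assoc,
    ι_mul_ι_swap w, mul_neg, neg_mul, mul_assoc]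

end Calculus

/-! ### The equations of `Γ` at a point. -/

section Pointwise

variable {V : Type*} [NormedAddCommGroup V] [NormedSpace ℝ V] [FiniteDimensional ℝ V]

theorem toExterior_mul_comm (β : V [⋀^Fin 2]→L[ℝ] ℝ) (x : ExteriorAlgebra ℝ (Module.Dual ℝ V)) :
    toExterior β * x = x * toExterior β :=
  (commute_of_mem_exteriorPower_two (toExterior_mem β) x).eq

theorem toExterior_pow_mul_comm (β : V [⋀^Fin 2]→L[ℝ] ℝ) (m : ℕ)
    (x : ExteriorAlgebra ℝ (Module.Dual ℝ V)) :
    toExterior β ^ m * x = x * toExterior β ^ m :=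
  ((commute_of_mem_exteriorPower_two (toExterior_mem β) x).pow_left m).eq

theorem eq_of_toExterior_mul_pow_eq {n : ℕ} {α : V [⋀^Fin 1]→L[ℝ] ℝ} {β : V [⋀^Fin 2]→L[ℝ] ℝ}
    (hn : toExterior α * toExterior β ^ n ≠ 0) {p m : ℕ} (hm : p + m = n + 1)
    {x y : V [⋀^Fin p]→L[ℝ] ℝ} (hx : toExterior α * toExterior x = 0)
    (hy : toExterior α * toExterior y = 0)
    (h : toExterior x * toExterior β ^ m = toExterior y * toExterior β ^ m) : x = y := by
  obtain ⟨w, hw⟩ := exists_ι_eq (toExterior_mem α)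
  rw [← hw] at hn hx hy
  refine toExterior_injective (sub_eq_zero.1 ?_)
  refine lefschetz_injective (toExterior_mem β) hn hm
    (sub_mem (toExterior_mem x) (toExterior_mem y)) ?_ ?_
  · rw [mul_sub, hx, hy, sub_zero]
  · rw [toExterior_pow_mul_comm, sub_mul, h, sub_self]

theorem exists_toExterior_mul_pow_eq {n : ℕ} (hV : Module.finrank ℝ V = 2 * n + 1)
    {α : V [⋀^Fin 1]→L[ℝ] ℝ} {β : V [⋀^Fin 2]→L[ℝ] ℝ}
    (hn : toExterior α * toExterior β ^ n ≠ 0) {p m : ℕ} (hm : p + m = n + 1)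
    {y : ExteriorAlgebra ℝ (Module.Dual ℝ V)} (hy : y ∈ ⋀[ℝ]^(p + 2 * m) (Module.Dual ℝ V))
    (hαy : toExterior α * y = 0) :
    ∃ x : V [⋀^Fin p]→L[ℝ] ℝ, toExterior α * toExterior x = 0 ∧
      toExterior x * toExterior β ^ m = y := by
  obtain ⟨w, hw⟩ := exists_ι_eq (toExterior_mem α)
  rw [← hw] at hn hαy
  obtain ⟨x, hx, hwx, h⟩ := lefschetz_surjective (by rw [Subspace.dual_finrank_eq, hV])
    (toExterior_mem β) hn hm hy hαy
  obtain ⟨x, rfl⟩ := exists_toExterior_eq hx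
  exact ⟨x, by rw [← hw, hwx], by rw [← toExterior_pow_mul_comm, h]⟩

theorem toExterior_mul_self_mul (α : V [⋀^Fin 1]→L[ℝ] ℝ)
    (x : ExteriorAlgebra ℝ (Module.Dual ℝ V)) : toExterior α * (toExterior α * x) = 0 := by
  obtain ⟨w, hw⟩ := exists_ι_eq (toExterior_mem α)
  rw [← hw, ← mul_assoc, ExteriorAlgebra.ι_sq_zero, zero_mul]

theorem eq_zero_of_finrank_lt {p : ℕ} (hp : Module.finrank ℝ V < p) (α : V [⋀^Fin p]→L[ℝ] ℝ) :
    α = 0 := by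
  have h0 : Module.finrank ℝ (⋀[ℝ]^p (Module.Dual ℝ V)) = 0 := by
    rw [exteriorPower.finrank_eq, Subspace.dual_finrank_eq, Nat.choose_eq_zero_of_lt hp]
  refine toExterior_injective ?_
  have h := toExterior_mem α
  rw [Submodule.finrank_eq_zero.1 h0, Submodule.mem_bot] at h
  rw [h, map_zero]

/-- The equations defining `g = Γ h` at a point, for `h` of degree `k + 1` and a contact form with
value `α` and exterior derivative `β`. -/
structure IsGammaAt (n : ℕ) (α : V [⋀^Fin 1]→L[ℝ] ℝ) (β : V [⋀^Fin 2]→L[ℝ] ℝ) (k : ℕ)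
    (h : V [⋀^Fin (k + 1)]→L[ℝ] ℝ) (g : V [⋀^Fin k]→L[ℝ] ℝ) : Prop where
  vertical : toExterior α * toExterior g = 0
  low : k + 1 ≤ n → toExterior α * toExterior h * toExterior β ^ (n - k) =
    toExterior g * toExterior β ^ (n + 1 - k)
  high : n ≤ k → toExterior α * toExterior h = toExterior g * toExterior β
  factor : n ≤ k → k ≤ 2 * n → ∃ ζ : V [⋀^Fin (2 * n - k)]→L[ℝ] ℝ,
    toExterior α * toExterior ζ = 0 ∧ toExterior g = toExterior ζ * toExterior β ^ (k - n)
  -- For `k = 2n + 1` the form `h` is zero, but the conditions above would allow any top-degree `g`.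
  -- For a linear operator this field is automatic.
  top : 2 * n < k → g = 0

variable {n k : ℕ} {α : V [⋀^Fin 1]→L[ℝ] ℝ} {β : V [⋀^Fin 2]→L[ℝ] ℝ}
  {h h' : V [⋀^Fin (k + 1)]→L[ℝ] ℝ} {g g' : V [⋀^Fin k]→L[ℝ] ℝ}

/-- For `k < n` Lefschetz injectivity applies to `g` itself. For `k > n` the equation `α ∧ h = g ∧
β` alone is too weak; substituting `g = ζ ∧ βᵏ⁻ⁿ` turns it into an equation for the vertical form
`ζ` with exponent `k - n + 1`, where injectivity holds. -/
theorem IsGammaAt.unique (hn : toExterior α * toExterior β ^ n ≠ 0) (H : IsGammaAt n α β k h g)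
    (H' : IsGammaAt n α β k h g') : g = g' := by
  rcases Nat.lt_or_ge k n with hk | hk
  · refine eq_of_toExterior_mul_pow_eq hn (m := n + 1 - k) (by omega) H.vertical H'.vertical ?_
    rw [← H.low hk, ← H'.low hk]
  rcases Nat.lt_or_ge (2 * n) k with hk2 | hk2
  · rw [H.top hk2, H'.top hk2]
  obtain ⟨ζ, hζ, e⟩ := H.factor hk hk2
  obtain ⟨ζ', hζ', e'⟩ := H'.factor hk hk2
  have : ζ = ζ' := by
    refine eq_of_toExterior_mul_pow_eq hn (m := k - n + 1) (by omega) hζ hζ' ?_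
    rw [pow_succ, ← mul_assoc, ← mul_assoc, ← e, ← e', ← H.high hk, ← H'.high hk]
  exact toExterior_injective (by rw [e, e', this])

/-- The right-hand sides contain the factor `α`, hence are vertical, and Lefschetz surjectivity
inverts the power of `β`: on `g` for `k < n`, on the factor `ζ` for `n ≤ k ≤ 2n`. -/
theorem IsGammaAt.exists (hV : Module.finrank ℝ V = 2 * n + 1)
    (hn : toExterior α * toExterior β ^ n ≠ 0) (h : V [⋀^Fin (k + 1)]→L[ℝ] ℝ) :
    ∃ g, IsGammaAt n α β k h g := by
  rcases Nat.lt_or_ge k n with hk | hk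
  · obtain ⟨g, hg, e⟩ := exists_toExterior_mul_pow_eq hV hn (p := k) (m := n + 1 - k)
      (y := toExterior α * toExterior h * toExterior β ^ (n - k)) (by omega)
      (by
        have := mul_mem_exteriorPower (mul_mem_exteriorPower (toExterior_mem α) (toExterior_mem h))
          (pow_mem_exteriorPower (toExterior_mem β) (n - k))
        rwa [show 1 + (k + 1) + 2 * (n - k) = k + 2 * (n + 1 - k) by omega] at this)
      (by rw [mul_assoc, toExterior_mul_self_mul])
    exact ⟨g, hg, fun _ => e.symm, fun h => by omega, fun h => by omega, fun h => by omega⟩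
  rcases Nat.lt_or_ge (2 * n) k with hk2 | hk2
  · refine ⟨0, by rw [map_zero, mul_zero], fun h => by omega, fun _ => ?_, fun _ h => by omega,
      fun _ => rfl⟩
    rw [eq_zero_of_finrank_lt (by omega) h, map_zero, map_zero, mul_zero, zero_mul]
  · obtain ⟨ζ, hζ, e⟩ := exists_toExterior_mul_pow_eq hV hn (p := 2 * n - k) (m := k - n + 1)
      (y := toExterior α * toExterior h) (by omega)
      (by
        have := mul_mem_exteriorPower (toExterior_mem α) (toExterior_mem h)
        rwa [show 1 + (k + 1) = 2 * n - k + 2 * (k - n + 1) by omega] at this)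
      (toExterior_mul_self_mul _ _)
    obtain ⟨g, hg⟩ := exists_toExterior_eq (p := k)
      (x := toExterior ζ * toExterior β ^ (k - n)) (by
        have := mul_mem_exteriorPower (toExterior_mem ζ)
          (pow_mem_exteriorPower (toExterior_mem β) (k - n))
        rwa [show 2 * n - k + 2 * (k - n) = k by omega] at this)
    refine ⟨g, by rw [hg, ← mul_assoc, hζ, zero_mul], fun h => by omega, fun _ => ?_,
      fun _ _ => ⟨ζ, hζ, hg⟩, fun h => by omega⟩
    rw [hg, mul_assoc, ← pow_succ, e]

theorem IsGammaAt.add (H : IsGammaAt n α β k h g) (H' : IsGammaAt n α β k h' g') :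
    IsGammaAt n α β k (h + h') (g + g') where
  vertical := by rw [map_add, mul_add, H.vertical, H'.vertical, add_zero]
  low hk := by rw [map_add, map_add, mul_add, add_mul, add_mul, H.low hk, H'.low hk]
  high hk := by rw [map_add, map_add, mul_add, add_mul, H.high hk, H'.high hk]
  factor hk hk' := by
    obtain ⟨ζ, hζ, e⟩ := H.factor hk hk'
    obtain ⟨ζ', hζ', e'⟩ := H'.factor hk hk'
    exact ⟨ζ + ζ', by rw [map_add, mul_add, hζ, hζ', add_zero],
      by rw [map_add, map_add, add_mul, e, e']⟩
  top hk := by rw [H.top hk, H'.top hk, add_zero]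

theorem IsGammaAt.smul (c : ℝ) (H : IsGammaAt n α β k h g) :
    IsGammaAt n α β k (c • h) (c • g) where
  vertical := by rw [map_smul, mul_smul_comm, H.vertical, smul_zero]
  low hk := by
    rw [map_smul, map_smul, mul_smul_comm, smul_mul_assoc, smul_mul_assoc, H.low hk]
  high hk := by rw [map_smul, map_smul, mul_smul_comm, smul_mul_assoc, H.high hk]
  factor hk hk' := by
    obtain ⟨ζ, hζ, e⟩ := H.factor hk hk'
    exact ⟨c • ζ, by rw [map_smul, mul_smul_comm, hζ, smul_zero],
      by rw [map_smul, map_smul, smul_mul_assoc, e]⟩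
  top hk := by rw [H.top hk, smul_zero]

theorem isGammaAt_zero (h0 : (k + 1 ≤ n → toExterior α * toExterior h * toExterior β ^ (n - k) = 0))
    (h1 : n ≤ k → toExterior α * toExterior h = 0) : IsGammaAt n α β k h 0 where
  vertical := by rw [map_zero, mul_zero]
  low hk := by rw [h0 hk, map_zero, zero_mul]
  high hk := by rw [h1 hk, map_zero, zero_mul]
  factor _ _ := ⟨0, by rw [map_zero, mul_zero], by rw [map_zero, map_zero, zero_mul]⟩
  top _ := rfl

/-- Pointwise source of `Γ² = 0`. -/
theorem isGammaAt_zero_of_vertical (h0 : toExterior α * toExterior h = 0) :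
    IsGammaAt n α β k h 0 :=
  isGammaAt_zero (fun _ => by rw [h0, zero_mul]) fun _ => h0

/-- If `g = Γ h` and `α ∧ dg = g ∧ β`, then `g = Γ dg`. -/
theorem IsGammaAt.of_mul_eq (H : IsGammaAt n α β k h g)
    (e : toExterior α * toExterior h' = toExterior g * toExterior β) :
    IsGammaAt n α β k h' g where
  vertical := H.vertical
  low hk := by rw [e, mul_assoc, ← pow_succ', show n - k + 1 = n + 1 - k by omega]
  high _ := e
  factor := H.factor
  top := H.top

theorem IsGammaAt.pullback {V' : Type*} [NormedAddCommGroup V'] [NormedSpace ℝ V']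
    [FiniteDimensional ℝ V'] (A : V' →L[ℝ] V) (H : IsGammaAt n α β k h g) :
    IsGammaAt n (α.compContinuousLinearMap A) (β.compContinuousLinearMap A) k
      (h.compContinuousLinearMap A) (g.compContinuousLinearMap A) := by
  constructor
  · rw [toExterior_compContinuousLinearMap, toExterior_compContinuousLinearMap, ← map_mul,
      H.vertical, map_zero]
  · intro hk
    simp only [toExterior_compContinuousLinearMap, ← map_mul, ← map_pow, H.low hk]
  · intro hk
    simp only [toExterior_compContinuousLinearMap, ← map_mul, H.high hk]
  · intro hk hk'
    obtain ⟨ζ, hζ, e⟩ := H.factor hk hk'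
    refine ⟨ζ.compContinuousLinearMap A, ?_, ?_⟩
    · simp only [toExterior_compContinuousLinearMap, ← map_mul, hζ, map_zero]
    · simp only [toExterior_compContinuousLinearMap, ← map_mul, ← map_pow, e]
  · intro hk
    rw [H.top hk]
    rfl

theorem nondegenerate_pullback {V' : Type*} [NormedAddCommGroup V'] [NormedSpace ℝ V']
    [FiniteDimensional ℝ V'] {A : V' →L[ℝ] V} (hA : Function.Surjective A)
    (hn : toExterior α * toExterior β ^ n ≠ 0) :
    toExterior (α.compContinuousLinearMap A) * toExterior (β.compContinuousLinearMap A) ^ n ≠ 0 := by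
  rw [toExterior_compContinuousLinearMap, toExterior_compContinuousLinearMap, ← map_pow, ← map_mul,
    Ne, map_eq_zero_iff _ (pullbackExterior_injective hA)]
  exact hn

/-- A vertical form has a factor `α`, and `α` does not distinguish `β'` from `cβ`. Hence each factor
`β'` can be traded for `cβ`. -/
theorem mul_two_form_eq_of_rescale {α : V [⋀^Fin 1]→L[ℝ] ℝ} {β β' : V [⋀^Fin 2]→L[ℝ] ℝ} {c : ℝ}
    (hα : α ≠ 0) (hβ : toExterior α * toExterior β' = c • (toExterior α * toExterior β))
    (j : ℕ) {x : ExteriorAlgebra ℝ (Module.Dual ℝ V)} (hx : toExterior α * x = 0) :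
    x * toExterior β' ^ j = c ^ j • (x * toExterior β ^ j) := by
  obtain ⟨w, hw⟩ := exists_ι_eq (toExterior_mem α)
  have hw0 : w ≠ 0 := by
    rintro rfl
    refine hα (toExterior_injective ?_)
    rw [← hw, map_zero, map_zero]
  obtain ⟨d, hd⟩ := Module.Projective.exists_dual_eq_one ℝ hw0
  rw [← hw] at hx hβ
  rw [eq_ι_mul_contractLeft hd hx]
  generalize CliffordAlgebra.contractLeft d x = a
  have key : ExteriorAlgebra.ι ℝ w * a * toExterior β' =
      c • (ExteriorAlgebra.ι ℝ w * a * toExterior β) := by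
    rw [mul_assoc, ← toExterior_mul_comm, ← mul_assoc, hβ, smul_mul_assoc, mul_assoc,
      toExterior_mul_comm, ← mul_assoc]
  induction j with
  | zero => simp
  | succ j ih =>
    rw [pow_succ, ← mul_assoc, ih, smul_mul_assoc, mul_assoc, toExterior_pow_mul_comm, ← mul_assoc,
      key, smul_mul_assoc, smul_smul, ← pow_succ, mul_assoc, ← pow_succ']

theorem nondegenerate_rescale {α' : V [⋀^Fin 1]→L[ℝ] ℝ} {β' : V [⋀^Fin 2]→L[ℝ] ℝ} {c : ℝ}
    (hn : toExterior α * toExterior β ^ n ≠ 0) (hc : c ≠ 0) (hα : α' = c • α)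
    (hβ : toExterior α * toExterior β' = c • (toExterior α * toExterior β)) :
    toExterior α' * toExterior β' ^ n ≠ 0 := by
  have hα0 : α ≠ 0 := by
    rintro rfl
    rw [map_zero, zero_mul] at hn
    exact hn rfl
  -- The form `α` is itself vertical; `α ∧ α = 0` is read off from `α ∧ (α ∧ 1) = 0`.
  rw [hα, map_smul, smul_mul_assoc, mul_two_form_eq_of_rescale hα0 hβ n (by
    rw [← mul_one (_ * _), mul_assoc, toExterior_mul_self_mul])]
  exact smul_ne_zero hc (smul_ne_zero (pow_ne_zero _ hc) hn)

/-- The equations for `Γ` do not depend on the contact form. -/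
theorem IsGammaAt.rescale {α' : V [⋀^Fin 1]→L[ℝ] ℝ} {β' : V [⋀^Fin 2]→L[ℝ] ℝ} {c : ℝ}
    (H : IsGammaAt n α β k h g) (hα0 : α ≠ 0) (hc : c ≠ 0) (hα : α' = c • α)
    (hβ : toExterior α * toExterior β' = c • (toExterior α * toExterior β)) :
    IsGammaAt n α' β' k h g := by
  have hαh : toExterior α * (toExterior α * toExterior h) = 0 := toExterior_mul_self_mul _ _
  constructor
  · rw [hα, map_smul, smul_mul_assoc, H.vertical, smul_zero]
  · intro hk
    -- The left side acquires `c` from `α'` and `cⁿ⁻ᵏ` from the powers of `β'`, the right side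
    -- `cⁿ⁺¹⁻ᵏ`.
    rw [hα, map_smul, smul_mul_assoc, smul_mul_assoc, mul_two_form_eq_of_rescale hα0 hβ _ hαh,
      mul_two_form_eq_of_rescale hα0 hβ _ H.vertical, H.low hk, smul_smul, ← pow_succ',
      show n - k + 1 = n + 1 - k by omega]
  · intro hk
    have := mul_two_form_eq_of_rescale hα0 hβ 1 H.vertical
    rw [pow_one, pow_one, pow_one] at this
    rw [hα, map_smul, smul_mul_assoc, this, H.high hk]
  · intro hk hk'
    obtain ⟨ζ, hζ, e⟩ := H.factor hk hk'
    -- The factor `ζ` does depend on the contact form; its rescaling compensates that of `βᵏ⁻ⁿ`.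
    refine ⟨(c ^ (k - n))⁻¹ • ζ, ?_, ?_⟩
    · rw [hα, map_smul, map_smul, smul_mul_assoc, mul_smul_comm, hζ, smul_zero, smul_zero]
    · rw [map_smul, smul_mul_assoc, mul_two_form_eq_of_rescale hα0 hβ _ hζ, smul_smul,
        inv_mul_cancel₀ (pow_ne_zero _ hc), one_smul, e]
  · exact H.top

end Pointwise

/-! ### Smooth dependence of the Lefschetz inverse and of `Γ`. -/

section Smooth

variable {V X : Type*} [NormedAddCommGroup V] [NormedSpace ℝ V] [FiniteDimensional ℝ V]
  [NormedAddCommGroup X] [NormedSpace ℝ X]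

/-- The two equations form one linear system `T u = (0, b)` with smooth coefficients. Verticality
has to be part of the system, since multiplication by `βᵐ` is known to be injective on vertical
forms only. -/
theorem contDiffAt_of_toExterior_mul_pow {n p q m : ℕ} {α : X → V [⋀^Fin 1]→L[ℝ] ℝ}
    {β : X → V [⋀^Fin 2]→L[ℝ] ℝ} {b : X → V [⋀^Fin q]→L[ℝ] ℝ} {u : X → V [⋀^Fin p]→L[ℝ] ℝ} {y : X}
    (hα : ContDiffAt ℝ ∞ α y) (hβ : ContDiffAt ℝ ∞ β y) (hb : ContDiffAt ℝ ∞ b y)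
    (hn : toExterior (α y) * toExterior (β y) ^ n ≠ 0) (hm : p + m = n + 1) (hq : q = p + 2 * m)
    (hu : ∀ᶠ z in 𝓝 y, toExterior (α z) * toExterior (u z) = 0 ∧
      toExterior (u z) * toExterior (β z) ^ m = toExterior (b z)) : ContDiffAt ℝ ∞ u y := by
  let T : X → (V [⋀^Fin p]→L[ℝ] ℝ) →L[ℝ]
      (V [⋀^Fin (1 + p)]→L[ℝ] ℝ) × (V [⋀^Fin (p + 2 * m)]→L[ℝ] ℝ) := fun z =>
    LinearMap.toContinuousLinearMap
      { toFun := fun a => (wedge (α z) a, wedgePow (β z) m a)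
        map_add' := fun a a' => by rw [wedge_add_right, wedgePow_add]; rfl
        map_smul' := fun c a => by rw [wedge_smul_right, wedgePow_smul]; rfl }
  refine contDiffAt_of_injective (T := T) ?_ ?_ ?_
  · exact contDiffAt_clm_of_apply fun a => (contDiffAt_wedge hα contDiffAt_const).prodMk
      (contDiffAt_wedgePow hβ contDiffAt_const m)
  · have h1 : ContDiffAt ℝ ∞ (fun z => ((0 : V [⋀^Fin (1 + p)]→L[ℝ] ℝ), castDeg hq (b z))) y :=
      contDiffAt_const.prodMk (contDiffAt_castDeg hq hb)
    refine h1.congr_of_eventuallyEq ?_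
    filter_upwards [hu] with z hz
    refine Prod.ext (toExterior_injective ?_) (toExterior_injective ?_)
    · exact (toExterior_wedge _ _).trans (hz.1.trans (map_zero _).symm)
    · exact (toExterior_wedgePow _ _ _).trans (hz.2.trans (toExterior_castDeg _ _).symm)
  · intro a a' haa
    have h1 : ∀ a, toExterior (T y a).1 = toExterior (α y) * toExterior a :=
      fun a => toExterior_wedge _ _
    have h2 : ∀ a, toExterior (T y a).2 = toExterior a * toExterior (β y) ^ m :=
      fun a => toExterior_wedgePow _ _ _
    have e : T y (a - a') = 0 := by rw [map_sub, haa, sub_self]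
    refine sub_eq_zero.1 (eq_of_toExterior_mul_pow_eq hn hm (y := 0) ?_ ?_ ?_)
    · rw [← h1, e]
      exact map_zero _
    · rw [map_zero, mul_zero]
    · rw [← h2, e, map_zero, zero_mul]
      exact map_zero _

theorem contDiffAt_of_isGammaAt {n k : ℕ} {α : X → V [⋀^Fin 1]→L[ℝ] ℝ} {β : X → V [⋀^Fin 2]→L[ℝ] ℝ} {h : X → V [⋀^Fin (k + 1)]→L[ℝ] ℝ}
    {g : X → V [⋀^Fin k]→L[ℝ] ℝ} {y : X} (hα : ContDiffAt ℝ ∞ α y) (hβ : ContDiffAt ℝ ∞ β y)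
    (hh : ContDiffAt ℝ ∞ h y) (hn : toExterior (α y) * toExterior (β y) ^ n ≠ 0)
    (H : ∀ᶠ z in 𝓝 y, IsGammaAt n (α z) (β z) k (h z) (g z)) : ContDiffAt ℝ ∞ g y := by
  rcases Nat.lt_or_ge k n with hk | hk
  · refine contDiffAt_of_toExterior_mul_pow hα hβ (m := n + 1 - k)
      (contDiffAt_wedgePow hβ (contDiffAt_wedge hα hh) (n - k)) hn (by omega) (by omega) ?_
    filter_upwards [H] with z hz
    exact ⟨hz.vertical, by rw [toExterior_wedgePow, toExterior_wedge, hz.low hk]⟩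
  rcases Nat.lt_or_ge (2 * n) k with hk2 | hk2
  · refine (contDiffAt_const (c := 0)).congr_of_eventuallyEq ?_
    filter_upwards [H] with z hz using hz.top hk2
  -- The factors are chosen point by point, with the value `0` where the equations are not known.
  -- The choice is smooth near `y` because `ζ` is the unique solution of a Lefschetz equation there.
  · have H' : ∀ z, ∃ ζ : V [⋀^Fin (2 * n - k)]→L[ℝ] ℝ, IsGammaAt n (α z) (β z) k (h z) (g z) →
        toExterior (α z) * toExterior ζ = 0 ∧
          toExterior (g z) = toExterior ζ * toExterior (β z) ^ (k - n) := fun z => by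
      by_cases hz : IsGammaAt n (α z) (β z) k (h z) (g z)
      · obtain ⟨ζ, hζ⟩ := hz.factor hk hk2
        exact ⟨ζ, fun _ => hζ⟩
      · exact ⟨0, fun h => (hz h).elim⟩
    choose ζ hζ using H'
    have hζs : ContDiffAt ℝ ∞ ζ y := by
      refine contDiffAt_of_toExterior_mul_pow hα hβ (m := k - n + 1) (contDiffAt_wedge hα hh) hn
        (by omega) (by omega) ?_
      filter_upwards [H] with z hz
      refine ⟨(hζ z hz).1, ?_⟩
      rw [pow_succ, ← mul_assoc, ← (hζ z hz).2, toExterior_wedge, hz.high hk]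
    refine (contDiffAt_castDeg (show 2 * n - k + 2 * (k - n) = k by omega)
      (contDiffAt_wedgePow hβ hζs (k - n))).congr_of_eventuallyEq ?_
    filter_upwards [H] with z hz
    refine toExterior_injective ?_
    rw [toExterior_castDeg, toExterior_wedgePow, (hζ z hz).2]

end Smooth

/-! ### Forms on the manifold in charts, and `d² = 0`. -/

section ManifoldForms

variable {n : ℕ} {M : Type*} [TopologicalSpace M]
  [ChartedSpace (EuclideanSpace ℝ (Fin (2 * n + 1))) M]

/-- The value of a form at a point, on the model space of the tangent space. -/
def atPoint {k : ℕ} (η : RawForm n M k) (x : M) :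
    EuclideanSpace ℝ (Fin (2 * n + 1)) [⋀^Fin k]→L[ℝ] ℝ := η x

/-- The derivative of the chart at `c`, as a map of model spaces. -/
def chartDeriv (c x : M) :
    EuclideanSpace ℝ (Fin (2 * n + 1)) →L[ℝ] EuclideanSpace ℝ (Fin (2 * n + 1)) :=
  mfderiv (𝓡 (2 * n + 1)) 𝓘(ℝ, EuclideanSpace ℝ (Fin (2 * n + 1)))
    (extChartAt (𝓡 (2 * n + 1)) c) x

/-- The derivative of the inverse of the chart at `c`, as a map of model spaces. -/
def chartSymmDeriv (c : M) (y : EuclideanSpace ℝ (Fin (2 * n + 1))) :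
    EuclideanSpace ℝ (Fin (2 * n + 1)) →L[ℝ] EuclideanSpace ℝ (Fin (2 * n + 1)) :=
  mfderiv 𝓘(ℝ, EuclideanSpace ℝ (Fin (2 * n + 1))) (𝓡 (2 * n + 1))
    (extChartAt (𝓡 (2 * n + 1)) c).symm y

theorem inChart_eq (c : M) {k : ℕ} (η : RawForm n M k) (y : EuclideanSpace ℝ (Fin (2 * n + 1))) :
    inChart c η y = (atPoint η ((extChartAt (𝓡 (2 * n + 1)) c).symm y)).compContinuousLinearMap
      (chartSymmDeriv c y) := rfl

theorem atPoint_extD (x : M) {k : ℕ} (η : RawForm n M k) :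
    atPoint (extD η) x = (extDeriv (inChart x η)
      (extChartAt (𝓡 (2 * n + 1)) x x)).compContinuousLinearMap (chartDeriv x x) := rfl

theorem SmoothFormOn.contDiffAt {k : ℕ} {η : RawForm n M k} {U : Set M} (hU : IsOpen U)
    (h : SmoothFormOn η U) (c : M) {y : EuclideanSpace ℝ (Fin (2 * n + 1))}
    (hy : y ∈ (extChartAt (𝓡 (2 * n + 1)) c).target)
    (hyU : (extChartAt (𝓡 (2 * n + 1)) c).symm y ∈ U) : ContDiffAt ℝ ∞ (inChart c η) y :=
  (h c).contDiffAt ((isOpen_chart_preimage hU c).mem_nhds ⟨hy, hyU⟩)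

theorem SmoothFormOn.mono {k : ℕ} {η : RawForm n M k} {U U' : Set M} (h : SmoothFormOn η U)
    (hU : U' ⊆ U) : SmoothFormOn η U' :=
  fun c => (h c).mono (Set.inter_subset_inter_right _ (Set.preimage_mono hU))

theorem smoothFormOn_of_contDiffAt {k : ℕ} {η : RawForm n M k} {U : Set M}
    (h : ∀ (c : M), ∀ y ∈ (extChartAt (𝓡 (2 * n + 1)) c).target,
      (extChartAt (𝓡 (2 * n + 1)) c).symm y ∈ U → ContDiffAt ℝ ∞ (inChart c η) y) :
    SmoothFormOn η U :=
  fun c y hy => (h c y hy.1 hy.2).contDiffWithinAt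

theorem eventually_chart_symm_mem {U : Set M} (hU : IsOpen U) (c : M)
    {y : EuclideanSpace ℝ (Fin (2 * n + 1))} (hy : y ∈ (extChartAt (𝓡 (2 * n + 1)) c).target)
    (hyU : (extChartAt (𝓡 (2 * n + 1)) c).symm y ∈ U) :
    ∀ᶠ z in 𝓝 y, z ∈ (extChartAt (𝓡 (2 * n + 1)) c).target ∧
      (extChartAt (𝓡 (2 * n + 1)) c).symm z ∈ U :=
  (isOpen_chart_preimage hU c).mem_nhds ⟨hy, hyU⟩

theorem wedge_eq_zero_iff {V : Type*} [NormedAddCommGroup V] [NormedSpace ℝ V]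
    [FiniteDimensional ℝ V] {p q : ℕ} (α : V [⋀^Fin p]→L[ℝ] ℝ) (β : V [⋀^Fin q]→L[ℝ] ℝ) :
    wedge α β = 0 ↔ toExterior α * toExterior β = 0 := by
  rw [← toExterior_wedge, map_eq_zero_iff _ toExterior_injective]

variable [IsManifold (𝓡 (2 * n + 1)) ∞ M]

theorem chartSymmDeriv_chartDeriv (c : M) {x : M} (hx : x ∈ (extChartAt (𝓡 (2 * n + 1)) c).source)
    (v : EuclideanSpace ℝ (Fin (2 * n + 1))) :
    chartSymmDeriv c (extChartAt (𝓡 (2 * n + 1)) c x) (chartDeriv c x v) = v := by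
  have : IsManifold (𝓡 (2 * n + 1)) 1 M := IsManifold.of_le (n := ∞) (by norm_num)
  have h := mfderivWithin_extChartAt_symm_comp_mfderiv_extChartAt' (I := 𝓡 (2 * n + 1)) hx
  rw [ModelWithCorners.range_eq_univ, mfderivWithin_univ] at h
  exact DFunLike.congr_fun h v

theorem chartSymmDeriv_surjective (c : M) {y : EuclideanSpace ℝ (Fin (2 * n + 1))}
    (hy : y ∈ (extChartAt (𝓡 (2 * n + 1)) c).target) :
    Function.Surjective (chartSymmDeriv c y) := fun v => by
  have h := chartSymmDeriv_chartDeriv c ((extChartAt (𝓡 (2 * n + 1)) c).map_target hy) v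
  rw [(extChartAt (𝓡 (2 * n + 1)) c).right_inv hy] at h
  exact ⟨_, h⟩

theorem nondegenerate_inChart (c : M) {y : EuclideanSpace ℝ (Fin (2 * n + 1))}
    (hy : y ∈ (extChartAt (𝓡 (2 * n + 1)) c).target) {θ : RawForm n M 1} {β : RawForm n M 2}
    {m : ℕ} (h : toExterior (atPoint θ ((extChartAt (𝓡 (2 * n + 1)) c).symm y)) *
      toExterior (atPoint β ((extChartAt (𝓡 (2 * n + 1)) c).symm y)) ^ m ≠ 0) :
    toExterior (inChart c θ y) * toExterior (inChart c β y) ^ m ≠ 0 := by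
  rw [inChart_eq, inChart_eq]
  exact nondegenerate_pullback (chartSymmDeriv_surjective c hy) h

theorem atPoint_eq (c : M) {k : ℕ} (η : RawForm n M k) {x : M}
    (hx : x ∈ (extChartAt (𝓡 (2 * n + 1)) c).source) :
    atPoint η x = (inChart c η (extChartAt (𝓡 (2 * n + 1)) c x)).compContinuousLinearMap
      (chartDeriv c x) := by
  ext v
  have h : (fun i => chartSymmDeriv c (extChartAt (𝓡 (2 * n + 1)) c x) (chartDeriv c x (v i))) =
      v := funext fun i => chartSymmDeriv_chartDeriv c hx (v i)
  refine Eq.trans ?_ (RawForm.congr_point η ((extChartAt (𝓡 (2 * n + 1)) c).left_inv hx) _).symm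
  exact congrArg (η x) h.symm

/-- If `θ ∧ η = 0` for a one-form `θ`, then `dθ ∧ η = θ ∧ dη`. -/
theorem extD_mul_eq_of_wedge_eq_zero {k : ℕ} {θ : RawForm n M 1} {η : RawForm n M k} {U : Set M}
    (hU : IsOpen U) (hθ : SmoothFormOn θ U) (hη : SmoothFormOn η U)
    (h : ∀ x ∈ U, wedge (atPoint θ x) (atPoint η x) = 0) {x : M} (hx : x ∈ U) :
    toExterior (atPoint (extD θ) x) * toExterior (atPoint η x) =
      toExterior (atPoint θ x) * toExterior (atPoint (extD η) x) := by
  have hxs : x ∈ (extChartAt (𝓡 (2 * n + 1)) x).source := mem_extChartAt_source x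
  have hy := (extChartAt (𝓡 (2 * n + 1)) x).map_source hxs
  have hyU : (extChartAt (𝓡 (2 * n + 1)) x).symm (extChartAt (𝓡 (2 * n + 1)) x x) ∈ U := by
    rwa [(extChartAt (𝓡 (2 * n + 1)) x).left_inv hxs]
  have key := extDeriv_mul_eq_of_wedge_eq_zero (hθ.differentiableAt hU x hy hyU)
    (hη.differentiableAt hU x hy hyU) (by
      filter_upwards [eventually_chart_symm_mem hU x hy hyU] with z hz
      rw [wedge_eq_zero_iff, inChart_eq, inChart_eq, toExterior_compContinuousLinearMap,
        toExterior_compContinuousLinearMap, ← map_mul, (wedge_eq_zero_iff _ _).1 (h _ hz.2),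
        map_zero])
  rw [atPoint_extD, atPoint_extD, atPoint_eq x η hxs, atPoint_eq x θ hxs]
  simp only [toExterior_compContinuousLinearMap]
  rw [← map_mul, key, map_mul]

theorem inChart_extD_extD (x : M) {k : ℕ} {η : RawForm n M k} (hη : SmoothFormOn η Set.univ) :
    extD (extD η) x = 0 := by
  have hxs : x ∈ (extChartAt (𝓡 (2 * n + 1)) x).source := mem_extChartAt_source x
  have hy := (extChartAt (𝓡 (2 * n + 1)) x).map_source hxs
  have h1 : inChart x (extD η) =ᶠ[𝓝 (extChartAt (𝓡 (2 * n + 1)) x x)]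
      extDeriv (inChart x η) := by
    filter_upwards [eventually_chart_symm_mem isOpen_univ x hy (Set.mem_univ _)] with z hz
    exact inChart_extD x η hz.1 (hη.differentiableAt isOpen_univ x hz.1 hz.2)
  have h2 : extDeriv (extDeriv (inChart x η)) (extChartAt (𝓡 (2 * n + 1)) x x) = 0 :=
    extDeriv_extDeriv_apply (hη.contDiffAt isOpen_univ x hy (Set.mem_univ _))
      (by simpa using! (WithTop.coe_le_coe.2 le_top : ((2 : ℕ∞) : WithTop ℕ∞) ≤ ∞))
  change (extDeriv (inChart x (extD η)) _).compContinuousLinearMap _ = 0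
  rw [h1.extDeriv_eq, h2]
  rfl

theorem dForm_dForm {k : ℕ} (η : Form n M k) : dForm n M (k + 1) (dForm n M k η) = 0 :=
  Subtype.ext (funext fun x => inChart_extD_extD x η.2)

end ManifoldForms

/-! ### Comparison of contact forms, and construction of `Γ`. -/

section ContactForms

theorem exists_smul_eq_of_ker_eq {V : Type*} [NormedAddCommGroup V] [NormedSpace ℝ V]
    {α β : V [⋀^Fin 1]→L[ℝ] ℝ} (hα : α ≠ 0)
    (h : ∀ v, α (fun _ => v) = 0 ↔ β (fun _ => v) = 0) : ∃ c : ℝ, c ≠ 0 ∧ β = c • α := by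
  have hc : ∀ v : Fin 1 → V, v = fun _ => v 0 := fun v => funext fun i => by
    rw [Subsingleton.elim i 0]
  have hlin : ∀ (γ : V [⋀^Fin 1]→L[ℝ] ℝ) (a : ℝ) (v w : V),
      γ (fun _ => v - a • w) = γ (fun _ => v) - a * γ (fun _ => w) := by
    intro γ a v w
    have e := γ.map_update_sub (fun _ => v) 0 v (a • w)
    rw [γ.map_update_smul] at e
    have e' : ∀ u : V, Function.update (fun _ : Fin 1 => v) 0 u = fun _ => u := fun u => by
      rw [hc (Function.update _ _ _), Function.update_self]
    simpa only [e', smul_eq_mul] using e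
  obtain ⟨R, hR⟩ : ∃ R, α (fun _ => R) ≠ 0 := by
    by_contra! hR
    refine hα ?_
    ext v
    rw [hc v, hR]
    rfl
  -- The factor is fixed by one vector `R` outside the kernel of `α`; every `v` differs from a
  -- multiple of `R` by a vector in the common kernel.
  refine ⟨β (fun _ => R) / α (fun _ => R), div_ne_zero (fun h0 => hR ((h R).2 h0)) hR, ?_⟩
  ext v
  rw [hc v, ContinuousAlternatingMap.smul_apply, smul_eq_mul]
  have h1 := (h (v 0 - (α (fun _ => v 0) / α (fun _ => R)) • R)).1 (by
    rw [hlin, div_mul_cancel₀ _ hR, sub_self])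
  rw [hlin] at h1
  field_simp
  field_simp at h1
  linarith

variable {n : ℕ} {M : Type*} [TopologicalSpace M]
  [ChartedSpace (EuclideanSpace ℝ (Fin (2 * n + 1))) M]

theorem ContactStructure.exists_nondegenerate (ξ : ContactStructure n M) (x : M) :
    ∃ (U : Set M) (θ : RawForm n M 1), x ∈ U ∧ IsContactForm ξ.dist U θ ∧
      ∀ y ∈ U, toExterior (atPoint θ y) * toExterior (atPoint (extD θ) y) ^ n ≠ 0 := by
  obtain ⟨U, θ, hx, hθ, hn⟩ := ξ.exists_contactForm x
  refine ⟨U, θ, hx, hθ, fun y hy h0 => hn y hy ?_⟩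
  rw [← toExterior_wedgePow] at h0
  exact toExterior_injective (h0.trans (map_zero _).symm)

variable [IsManifold (𝓡 (2 * n + 1)) ∞ M]

/-- Two contact forms are proportional, and so are their exterior derivatives on vertical forms. -/
theorem IsContactForm.exists_rescale
    {dist : (x : M) → Submodule ℝ (TangentSpace (𝓡 (2 * n + 1)) x)} {U U' : Set M}
    {θ θ' : RawForm n M 1} (h : IsContactForm dist U θ)
    (hn : ∀ y ∈ U, toExterior (atPoint θ y) * toExterior (atPoint (extD θ) y) ^ n ≠ 0)
    (h' : IsContactForm dist U' θ') {x : M} (hx : x ∈ U) (hx' : x ∈ U') :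
    ∃ c : ℝ, c ≠ 0 ∧ atPoint θ' x = c • atPoint θ x ∧
      toExterior (atPoint θ x) * toExterior (atPoint (extD θ') x) =
        c • (toExterior (atPoint θ x) * toExterior (atPoint (extD θ) x)) := by
  have hne : ∀ y ∈ U, atPoint θ y ≠ 0 := fun y hy h0 => hn y hy (by rw [h0, map_zero, zero_mul])
  have hsc : ∀ y ∈ U ∩ U', ∃ c : ℝ, c ≠ 0 ∧ atPoint θ' y = c • atPoint θ y := fun y hy =>
    exists_smul_eq_of_ker_eq (hne y hy.1) fun v => (h.ker y hy.1 v).symm.trans (h'.ker y hy.2 v)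
  obtain ⟨c, hc, e⟩ := hsc x ⟨hx, hx'⟩
  refine ⟨c, hc, e, ?_⟩
  -- Applying the identity to `θ ∧ θ' = 0` gives `θ ∧ dθ' = dθ ∧ θ'`, so the proportionality factor
  -- never has to be differentiated, nor known to be smooth.
  have key := extD_mul_eq_of_wedge_eq_zero (h.isOpen.inter h'.isOpen)
    (h.smooth.mono Set.inter_subset_left) (h'.smooth.mono Set.inter_subset_right)
    (fun y hy => by
      obtain ⟨a, _, ha⟩ := hsc y hy
      rw [wedge_eq_zero_iff, ha, map_smul, mul_smul_comm, ← mul_one (toExterior (atPoint θ y)),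
        mul_assoc, one_mul, toExterior_mul_self_mul, smul_zero]) ⟨hx, hx'⟩
  rw [← key, e, map_smul, mul_smul_comm, toExterior_mul_comm]

/-- A contact form is only required to have kernel `ξ`. Nondegeneracy is inherited from the
nondegenerate form that exists near each point, by rescaling. -/
theorem IsContactForm.nondegenerate {ξ : ContactStructure n M} {U : Set M} {θ : RawForm n M 1}
    (h : IsContactForm ξ.dist U θ) {x : M} (hx : x ∈ U) :
    toExterior (atPoint θ x) * toExterior (atPoint (extD θ) x) ^ n ≠ 0 := by
  obtain ⟨U₀, θ₀, hx₀, h₀, hn⟩ := ξ.exists_nondegenerate x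
  obtain ⟨c, hc, e, e'⟩ := h₀.exists_rescale hn h hx₀ hx
  exact nondegenerate_rescale (hn x hx₀) hc e e'

/-- The solution for one nondegenerate contact form solves the equations of all others, by
`IsGammaAt.rescale`. This order of quantifiers makes `Γ` an invariant of `ξ`. -/
theorem ContactStructure.exists_isGammaAt (ξ : ContactStructure n M) (x : M) {k : ℕ}
    (h : EuclideanSpace ℝ (Fin (2 * n + 1)) [⋀^Fin (k + 1)]→L[ℝ] ℝ) :
    ∃ g, ∀ (U : Set M) (θ : RawForm n M 1), IsContactForm ξ.dist U θ → x ∈ U →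
      IsGammaAt n (atPoint θ x) (atPoint (extD θ) x) k h g := by
  obtain ⟨U₀, θ₀, hx₀, h₀, hn⟩ := ξ.exists_nondegenerate x
  obtain ⟨g, hg⟩ := IsGammaAt.exists (by simp) (hn x hx₀) h
  refine ⟨g, fun U θ hθ hx => ?_⟩
  obtain ⟨c, hc, e, e'⟩ := h₀.exists_rescale hn hθ hx₀ hx
  exact hg.rescale (fun h0 => hn x hx₀ (by rw [h0, map_zero, zero_mul])) hc e e'

/-- The value of `Γ η` at each point. -/
def ContactStructure.rawGamma (ξ : ContactStructure n M) (k : ℕ) (η : RawForm n M (k + 1)) :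
    RawForm n M k := fun x => (ξ.exists_isGammaAt x (atPoint η x)).choose

theorem ContactStructure.rawGamma_spec (ξ : ContactStructure n M) {k : ℕ} (η : RawForm n M (k + 1))
    {U : Set M} {θ : RawForm n M 1} (hθ : IsContactForm ξ.dist U θ) {x : M} (hx : x ∈ U) :
    IsGammaAt n (atPoint θ x) (atPoint (extD θ) x) k (atPoint η x) (atPoint (ξ.rawGamma k η) x) :=
  (ξ.exists_isGammaAt x (atPoint η x)).choose_spec U θ hθ hx

theorem ContactStructure.eq_of_isGammaAt (ξ : ContactStructure n M) {k : ℕ} {x : M}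
    {h : EuclideanSpace ℝ (Fin (2 * n + 1)) [⋀^Fin (k + 1)]→L[ℝ] ℝ}
    {g g' : EuclideanSpace ℝ (Fin (2 * n + 1)) [⋀^Fin k]→L[ℝ] ℝ}
    (hg : ∀ (U : Set M) (θ : RawForm n M 1), IsContactForm ξ.dist U θ → x ∈ U →
      IsGammaAt n (atPoint θ x) (atPoint (extD θ) x) k h g)
    (hg' : ∀ (U : Set M) (θ : RawForm n M 1), IsContactForm ξ.dist U θ → x ∈ U →
      IsGammaAt n (atPoint θ x) (atPoint (extD θ) x) k h g') : g = g' := by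
  obtain ⟨U, θ, hx, hθ, -⟩ := ξ.exists_nondegenerate x
  exact (hg U θ hθ hx).unique (hθ.nondegenerate hx) (hg' U θ hθ hx)

/-- Smoothness is local: in a chart, on the domain of one contact form, the pulled-back values solve
the pulled-back equations, whose coefficients are smooth. -/
theorem ContactStructure.smooth_rawGamma (ξ : ContactStructure n M) {k : ℕ}
    {η : RawForm n M (k + 1)} (hη : SmoothFormOn η Set.univ) :
    SmoothFormOn (ξ.rawGamma k η) Set.univ := by
  refine smoothFormOn_of_contDiffAt fun c y hy _ => ?_
  obtain ⟨U, θ, hyU, hθ, -⟩ := ξ.exists_nondegenerate ((extChartAt (𝓡 (2 * n + 1)) c).symm y)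
  have h1 := hθ.smooth.contDiffAt hθ.isOpen c hy hyU
  have h2 := (SmoothFormOn.extD hθ.isOpen hθ.smooth).contDiffAt hθ.isOpen c hy hyU
  have h3 := hη.contDiffAt isOpen_univ c hy (Set.mem_univ _)
  have h4 := nondegenerate_inChart c hy (hθ.nondegenerate hyU)
  refine contDiffAt_of_isGammaAt h1 h2 h3 h4 ?_
  filter_upwards [eventually_chart_symm_mem hθ.isOpen c hy hyU] with z hz
  exact (ξ.rawGamma_spec η hθ hz.2).pullback (chartSymmDeriv c z)

/-- The operator `Γ` of a contact manifold. -/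
def ContactStructure.gamma (ξ : ContactStructure n M) (k : ℕ) :
    Form n M (k + 1) →ₗ[ℝ] Form n M k where
  toFun η := ⟨ξ.rawGamma k η.1, ξ.smooth_rawGamma η.2⟩
  -- Linearity comes from uniqueness, since the equations are linear in the pair consisting of `η`
  -- and its image.
  map_add' η ζ := Subtype.ext <| funext fun x =>
    ξ.eq_of_isGammaAt (x := x) (fun _ _ hθ hx => ξ.rawGamma_spec (η.1 + ζ.1) hθ hx)
      fun _ _ hθ hx => (ξ.rawGamma_spec η.1 hθ hx).add (ξ.rawGamma_spec ζ.1 hθ hx)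
  map_smul' c η := Subtype.ext <| funext fun x =>
    ξ.eq_of_isGammaAt (x := x) (fun _ _ hθ hx => ξ.rawGamma_spec (c • η.1) hθ hx)
      fun _ _ hθ hx => (ξ.rawGamma_spec η.1 hθ hx).smul c

end ContactForms

/-! ### Identities for `Γ` and the Rumin spaces as kernels. -/

section Gamma

variable {n : ℕ} {M : Type*} [TopologicalSpace M]
  [ChartedSpace (EuclideanSpace ℝ (Fin (2 * n + 1))) M]

theorem Form.ext_atPoint {k : ℕ} {η ζ : Form n M k} (h : ∀ x, atPoint η.1 x = atPoint ζ.1 x) :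
    η = ζ :=
  Subtype.ext (funext h)

theorem Form.eq_zero_of_lt {k : ℕ} (hk : 2 * n + 1 < k) (η : Form n M k) : η = 0 :=
  Form.ext_atPoint fun x => eq_zero_of_finrank_lt (by simpa using hk) (atPoint η.1 x)

variable [IsManifold (𝓡 (2 * n + 1)) ∞ M]
  {ξ : ContactStructure n M} {Γ : (k : ℕ) → Form n M (k + 1) →ₗ[ℝ] Form n M k}

/-- A vertical form `ζ` that solves `ζ ∧ dθᵐ = θ ∧ η` is smooth. -/
theorem IsContactForm.smoothFormOn_of_mul_pow {U : Set M} {θ : RawForm n M 1}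
    (hθ : IsContactForm ξ.dist U θ) {p q m : ℕ} {η : RawForm n M q} {ζ : RawForm n M p}
    (hη : SmoothFormOn η U) (hm : p + m = n + 1) (hq : 1 + q = p + 2 * m)
    (h : ∀ x ∈ U, toExterior (atPoint θ x) * toExterior (atPoint ζ x) = 0 ∧
      toExterior (atPoint ζ x) * toExterior (atPoint (extD θ) x) ^ m =
        toExterior (atPoint θ x) * toExterior (atPoint η x)) : SmoothFormOn ζ U := by
  refine smoothFormOn_of_contDiffAt fun c y hy hyU => ?_
  have h1 := hθ.smooth.contDiffAt hθ.isOpen c hy hyU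
  have h2 := (SmoothFormOn.extD hθ.isOpen hθ.smooth).contDiffAt hθ.isOpen c hy hyU
  have h3 := hη.contDiffAt hθ.isOpen c hy hyU
  have h4 := nondegenerate_inChart c hy (hθ.nondegenerate hyU)
  refine contDiffAt_of_toExterior_mul_pow h1 h2 (contDiffAt_wedge h1 h3) h4 hm hq ?_
  filter_upwards [eventually_chart_symm_mem hθ.isOpen c hy hyU] with z hz
  obtain ⟨e1, e2⟩ := h _ hz.2
  simp only [toExterior_wedge, inChart_eq, toExterior_compContinuousLinearMap, ← map_mul,
    ← map_pow, e1, e2, map_zero, and_self]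

theorem ContactStructure.isGamma_gamma (ξ : ContactStructure n M) : ξ.IsGamma ξ.gamma where
  vertical k η U θ hθ x hx := (wedge_eq_zero_iff (atPoint θ x) (atPoint (ξ.gamma k η).1 x)).2
    (ξ.rawGamma_spec η.1 hθ hx).vertical
  low k hk η U θ hθ x hx := by
    change wedgePow (atPoint (extD θ) x) _ (wedge (atPoint θ x) (atPoint η.1 x)) =
      castDeg _ (wedgePow (atPoint (extD θ) x) _ (atPoint (ξ.rawGamma k η.1) x))
    refine toExterior_injective ?_
    rw [toExterior_castDeg, toExterior_wedgePow, toExterior_wedgePow, toExterior_wedge,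
      (ξ.rawGamma_spec η.1 hθ hx).low hk]
  high k hk η U θ hθ x hx := by
    change wedge (atPoint θ x) (atPoint η.1 x) =
      castDeg _ (wedge (atPoint (ξ.rawGamma k η.1) x) (atPoint (extD θ) x))
    refine toExterior_injective ?_
    rw [toExterior_castDeg, toExterior_wedge, toExterior_wedge,
      (ξ.rawGamma_spec η.1 hθ hx).high hk]
  exists_factor k hk hk' η U θ hθ := by
    -- The factor is chosen pointwise, with the irrelevant value `0` off `U`. It is smooth on `U`
    -- because `ζ ∧ dθᵏ⁻ⁿ⁺¹ = θ ∧ η` determines it among vertical forms.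
    have H : ∀ x, ∃ ζ : EuclideanSpace ℝ (Fin (2 * n + 1)) [⋀^Fin (2 * n - k)]→L[ℝ] ℝ, x ∈ U →
        toExterior (atPoint θ x) * toExterior ζ = 0 ∧ toExterior (atPoint (ξ.rawGamma k η.1) x) =
          toExterior ζ * toExterior (atPoint (extD θ) x) ^ (k - n) := fun x => by
      by_cases hx : x ∈ U
      · obtain ⟨ζ, hζ⟩ := (ξ.rawGamma_spec η.1 hθ hx).factor hk hk'
        exact ⟨ζ, fun _ => hζ⟩
      · exact ⟨0, fun h => (hx h).elim⟩
    choose ζ hζ using H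
    refine ⟨ζ, ?_, fun x hx => ⟨?_, ?_⟩⟩
    · refine hθ.smoothFormOn_of_mul_pow (m := k - n + 1) (q := k + 1) (η := η.1)
        (SmoothFormOn.mono η.2 (Set.subset_univ U)) (by omega) (by omega) fun x hx => ⟨(hζ x hx).1, ?_⟩
      rw [(ξ.rawGamma_spec η.1 hθ hx).high hk, (hζ x hx).2, mul_assoc, ← pow_succ]
      rfl
    · exact (wedge_eq_zero_iff (atPoint θ x) (ζ x)).2 (hζ x hx).1
    · change atPoint (ξ.rawGamma k η.1) x =
        castDeg _ (wedgePow (atPoint (extD θ) x) (k - n) (ζ x))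
      refine toExterior_injective ?_
      rw [toExterior_castDeg, toExterior_wedgePow, (hζ x hx).2]

omit [IsManifold (𝓡 (2 * n + 1)) ∞ M] in
theorem ContactStructure.IsGamma.isGammaAt (hΓ : ξ.IsGamma Γ) {k : ℕ} (η : Form n M (k + 1))
    {U : Set M} {θ : RawForm n M 1} (hθ : IsContactForm ξ.dist U θ) {x : M} (hx : x ∈ U) :
    IsGammaAt n (atPoint θ x) (atPoint (extD θ) x) k (atPoint η.1 x) (atPoint (Γ k η).1 x) where
  vertical := (wedge_eq_zero_iff _ _).1 (hΓ.vertical k η U θ hθ x hx)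
  low hk := by
    have h : wedgePow (atPoint (extD θ) x) _ (wedge (atPoint θ x) (atPoint η.1 x)) =
      castDeg _ (wedgePow (atPoint (extD θ) x) _ (atPoint (Γ k η).1 x)) :=
      hΓ.low k hk η U θ hθ x hx
    rw [← toExterior_wedge, ← toExterior_wedgePow, h, toExterior_castDeg, toExterior_wedgePow]
  high hk := by
    have h : wedge (atPoint θ x) (atPoint η.1 x) =
      castDeg _ (wedge (atPoint (Γ k η).1 x) (atPoint (extD θ) x)) := hΓ.high k hk η U θ hθ x hx
    rw [← toExterior_wedge, h, toExterior_castDeg, toExterior_wedge]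
  factor hk hk' := by
    obtain ⟨ζ, -, hζ⟩ := hΓ.exists_factor k hk hk' η U θ hθ
    obtain ⟨h1, h2⟩ := hζ x hx
    have h : atPoint (Γ k η).1 x =
      castDeg _ (wedgePow (atPoint (extD θ) x) (k - n) (atPoint ζ x)) := h2
    refine ⟨atPoint ζ x, (wedge_eq_zero_iff _ _).1 h1, ?_⟩
    rw [h, toExterior_castDeg, toExterior_wedgePow]
  top hk := by
    rw [Form.eq_zero_of_lt (by omega) η, map_zero]
    rfl

/-- By uniqueness, `Γη` is computed by exhibiting any form that satisfies the pointwise equations.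
Most identities for `Γ` below follow in this way. -/
theorem ContactStructure.IsGamma.eq_of_isGammaAt (hΓ : ξ.IsGamma Γ) {k : ℕ} {η : Form n M (k + 1)}
    {ζ : Form n M k} (h : ∀ (x : M) (U : Set M) (θ : RawForm n M 1), IsContactForm ξ.dist U θ →
      x ∈ U → IsGammaAt n (atPoint θ x) (atPoint (extD θ) x) k (atPoint η.1 x) (atPoint ζ.1 x)) :
    Γ k η = ζ :=
  Form.ext_atPoint fun x => ξ.eq_of_isGammaAt (fun _ _ hθ hx => hΓ.isGammaAt η hθ hx) (h x)

theorem ContactStructure.IsGamma.unique (hΓ : ξ.IsGamma Γ)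
    {Γ' : (k : ℕ) → Form n M (k + 1) →ₗ[ℝ] Form n M k} (hΓ' : ξ.IsGamma Γ') : Γ' = Γ := by
  funext k
  ext1 η
  exact hΓ'.eq_of_isGammaAt fun x U θ hθ hx => hΓ.isGammaAt η hθ hx

/-- The values of `Γ` are vertical, and for a vertical form the zero form solves the equations. -/
theorem ContactStructure.IsGamma.gamma_gamma (hΓ : ξ.IsGamma Γ) {k : ℕ} (η : Form n M (k + 2)) :
    Γ k (Γ (k + 1) η) = 0 :=
  hΓ.eq_of_isGammaAt fun _ _ _ hθ hx => isGammaAt_zero_of_vertical (hΓ.isGammaAt η hθ hx).vertical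

/-- Differentiating `θ ∧ Γη = 0` gives `θ ∧ dΓη = Γη ∧ dθ`, so `Γη` solves the equations for `dΓη`
as well. -/
theorem ContactStructure.IsGamma.gamma_d_gamma (hΓ : ξ.IsGamma Γ) {k : ℕ}
    (η : Form n M (k + 1)) : Γ k (dForm n M k (Γ k η)) = Γ k η :=
  hΓ.eq_of_isGammaAt fun x U θ hθ hx => (hΓ.isGammaAt η hθ hx).of_mul_eq <| by
    have h := extD_mul_eq_of_wedge_eq_zero hθ.isOpen hθ.smooth
      (SmoothFormOn.mono (Γ k η).2 (Set.subset_univ U))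
      (fun y hy => hΓ.vertical k η U θ hθ y hy) hx
    rw [toExterior_mul_comm] at h
    exact h.symm

theorem ContactStructure.IsGamma.gamma_eq_zero_iff (hΓ : ξ.IsGamma Γ) {k : ℕ}
    (η : Form n M (k + 1)) :
    Γ k η = 0 ↔ ∀ (x : M) (U : Set M) (θ : RawForm n M 1), IsContactForm ξ.dist U θ → x ∈ U →
      (k + 1 ≤ n → toExterior (atPoint θ x) * toExterior (atPoint η.1 x) *
        toExterior (atPoint (extD θ) x) ^ (n - k) = 0) ∧
      (n ≤ k → toExterior (atPoint θ x) * toExterior (atPoint η.1 x) = 0) := by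
  refine ⟨fun h x U θ hθ hx => ?_, fun h => hΓ.eq_of_isGammaAt fun x U θ hθ hx =>
    isGammaAt_zero (h x U θ hθ hx).1 (h x U θ hθ hx).2⟩
  have H := hΓ.isGammaAt η hθ hx
  have h0 : toExterior (atPoint (Γ k η).1 x) = 0 := by
    rw [h]
    exact map_zero _
  exact ⟨fun hk => by rw [H.low hk, h0, zero_mul], fun hk => by rw [H.high hk, h0, zero_mul]⟩

theorem ContactStructure.mem_ruminForm_iff {k : ℕ} {η : Form n M k} :
    η ∈ ξ.ruminForm k ↔ ∀ (x : M) (U : Set M) (θ : RawForm n M 1), IsContactForm ξ.dist U θ →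
      x ∈ U → (k ≤ n →
        toExterior (atPoint θ x) * toExterior (atPoint η.1 x) *
          toExterior (atPoint (extD θ) x) ^ (n + 1 - k) = 0 ∧
        toExterior (atPoint θ x) * toExterior (atPoint (dForm n M k η).1 x) *
          toExterior (atPoint (extD θ) x) ^ (n - k) = 0) ∧
      (n + 1 ≤ k → toExterior (atPoint θ x) * toExterior (atPoint η.1 x) = 0 ∧
        toExterior (atPoint θ x) * toExterior (atPoint (dForm n M k η).1 x) = 0) := by
  have e : ∀ (α : EuclideanSpace ℝ (Fin (2 * n + 1)) [⋀^Fin 1]→L[ℝ] ℝ)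
      (β : EuclideanSpace ℝ (Fin (2 * n + 1)) [⋀^Fin 2]→L[ℝ] ℝ) (p j : ℕ)
      (γ : EuclideanSpace ℝ (Fin (2 * n + 1)) [⋀^Fin p]→L[ℝ] ℝ), wedgeWith α β p j γ = 0 ↔
        toExterior α * toExterior γ * toExterior β ^ j = 0 := by
    intro α β p j γ
    rw [← toExterior_wedge, ← toExterior_wedgePow, map_eq_zero_iff _ toExterior_injective]
    rfl
  have e' := fun (x : M) (θ : RawForm n M 1) (p : ℕ) (ζ : RawForm n M p) =>
    wedge_eq_zero_iff (atPoint θ x) (atPoint ζ x)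
  constructor
  · intro h x U θ hθ hx
    obtain ⟨h1, h2⟩ := h U θ hθ x hx
    exact ⟨fun hk => ⟨(e _ _ _ _ _).1 (h1 hk).1, (e _ _ _ _ _).1 (h1 hk).2⟩,
      fun hk => ⟨(e' _ _ _ _).1 (h2 hk).1, (e' _ _ _ _).1 (h2 hk).2⟩⟩
  · intro h U θ hθ x hx
    obtain ⟨h1, h2⟩ := h x U θ hθ hx
    exact ⟨fun hk => ⟨(e _ _ _ _ _).2 (h1 hk).1, (e _ _ _ _ _).2 (h1 hk).2⟩,
      fun hk => ⟨(e' _ _ _ _).2 (h2 hk).1, (e' _ _ _ _).2 (h2 hk).2⟩⟩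

theorem toExterior_top_eq_zero {p : ℕ} (hp : 2 * n + 1 < p)
    {x : ExteriorAlgebra ℝ (Module.Dual ℝ (EuclideanSpace ℝ (Fin (2 * n + 1))))}
    (hx : x ∈ ⋀[ℝ]^p (Module.Dual ℝ (EuclideanSpace ℝ (Fin (2 * n + 1))))) : x = 0 := by
  obtain ⟨α, rfl⟩ := exists_toExterior_eq hx
  rw [eq_zero_of_finrank_lt (by simpa using hp) α, map_zero]

/-- Functions have no `Γ`, so only the condition on `dη` remains. -/
theorem ContactStructure.IsGamma.mem_ruminForm_zero_iff (hΓ : ξ.IsGamma Γ) {η : Form n M 0} :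
    η ∈ ξ.ruminForm 0 ↔ Γ 0 (dForm n M 0 η) = 0 := by
  rw [mem_ruminForm_iff, hΓ.gamma_eq_zero_iff]
  refine forall₅_congr fun x U θ hθ hx => ?_
  constructor
  · rintro ⟨h, -⟩
    refine ⟨fun hk => (h (Nat.zero_le n)).2, fun hk => ?_⟩
    obtain rfl : n = 0 := by omega
    simpa using (h le_rfl).2
  · rintro ⟨h1, h2⟩
    refine ⟨fun _ => ⟨?_, ?_⟩, fun h => by omega⟩
    -- The condition on `η` itself is void, as `θ ∧ η ∧ dθⁿ⁺¹` has degree `2n + 3`.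
    · refine toExterior_top_eq_zero (n := n) (p := 1 + 0 + 2 * (n + 1 - 0)) (by omega) ?_
      exact mul_mem_exteriorPower (mul_mem_exteriorPower (toExterior_mem _) (toExterior_mem _))
        (pow_mem_exteriorPower (toExterior_mem _) _)
    -- For `n = 0` the one-form `dη` already lies in the high range of `Γ`, although `η` is in the
    -- low range of `ℛ`.
    · rcases Nat.eq_zero_or_pos n with h0 | h0
      · rw [h2 (by omega), zero_mul]
      · exact h1 h0

theorem ContactStructure.IsGamma.mem_ruminForm_succ_iff (hΓ : ξ.IsGamma Γ) {k : ℕ}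
    {η : Form n M (k + 1)} :
    η ∈ ξ.ruminForm (k + 1) ↔ Γ k η = 0 ∧ Γ (k + 1) (dForm n M (k + 1) η) = 0 := by
  rw [mem_ruminForm_iff, hΓ.gamma_eq_zero_iff, hΓ.gamma_eq_zero_iff]
  simp only [← forall_and]
  refine forall₅_congr fun x U θ hθ hx => ?_
  rw [show n + 1 - (k + 1) = n - k by omega]
  constructor
  · rintro ⟨h1, h2⟩
    refine ⟨⟨fun hk => (h1 hk).1, fun hk => (h2 (by omega)).1⟩, fun hk => (h1 (by omega)).2,
      fun hk => ?_⟩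
    -- The ranges of `ℛ` and `Γ` differ at `k + 1 = n`: `η` is in the low range while `dη`, of
    -- degree `n + 1`, is in the high one. The conditions agree because the exponent `n - (k + 1)`
    -- is zero.
    rcases hk.lt_or_eq with hk | hk
    · exact (h2 hk).2
    · have h := (h1 hk.ge).2
      rwa [show n - (k + 1) = 0 by omega, pow_zero, mul_one] at h
  · rintro ⟨⟨h1, h2⟩, h3, h4⟩
    refine ⟨fun hk => ⟨h1 hk, ?_⟩, fun hk => ⟨h2 (by omega), h4 (by omega)⟩⟩
    rcases hk.lt_or_eq with hk | hk
    · exact h3 hk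
    · rw [h4 hk.ge, zero_mul]

end Gamma

/-! ### Pullback of forms by smooth maps and naturality of `d`. -/

section PullbackForms

variable {n : ℕ} {M M' : Type*} [TopologicalSpace M]
  [ChartedSpace (EuclideanSpace ℝ (Fin (2 * n + 1))) M] [TopologicalSpace M']
  [ChartedSpace (EuclideanSpace ℝ (Fin (2 * n + 1))) M']

/-- The derivative of a map of manifolds, as a map of model spaces. -/
def modelDeriv (Φ : M → M') (x : M) :
    EuclideanSpace ℝ (Fin (2 * n + 1)) →L[ℝ] EuclideanSpace ℝ (Fin (2 * n + 1)) :=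
  mfderiv (𝓡 (2 * n + 1)) (𝓡 (2 * n + 1)) Φ x

/-- The pullback of a form. -/
def pullbackForm (Φ : M → M') {k : ℕ} (η : RawForm n M' k) : RawForm n M k := fun x =>
  (atPoint η (Φ x)).compContinuousLinearMap (modelDeriv Φ x)

theorem atPoint_pullbackForm (Φ : M → M') {k : ℕ} (η : RawForm n M' k) (x : M) :
    atPoint (pullbackForm Φ η) x =
      (atPoint η (Φ x)).compContinuousLinearMap (modelDeriv Φ x) := rfl

/-- The coordinate expression of a map. -/
def inCharts (Φ : M → M') (c : M) (c' : M') :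
    EuclideanSpace ℝ (Fin (2 * n + 1)) → EuclideanSpace ℝ (Fin (2 * n + 1)) :=
  extChartAt (𝓡 (2 * n + 1)) c' ∘ Φ ∘ (extChartAt (𝓡 (2 * n + 1)) c).symm

theorem eventually_inCharts {Φ : M → M'} (hΦ : Continuous Φ) (c : M) (c' : M')
    {y : EuclideanSpace ℝ (Fin (2 * n + 1))} (hy : y ∈ (extChartAt (𝓡 (2 * n + 1)) c).target)
    (hc : Φ ((extChartAt (𝓡 (2 * n + 1)) c).symm y) ∈ (extChartAt (𝓡 (2 * n + 1)) c').source) :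
    ∀ᶠ z in 𝓝 y, z ∈ (extChartAt (𝓡 (2 * n + 1)) c).target ∧
      Φ ((extChartAt (𝓡 (2 * n + 1)) c).symm z) ∈ (extChartAt (𝓡 (2 * n + 1)) c').source :=
  eventually_chart_symm_mem ((isOpen_extChartAt_source c').preimage hΦ) c hy hc

variable [IsManifold (𝓡 (2 * n + 1)) ∞ M] [IsManifold (𝓡 (2 * n + 1)) ∞ M'] {Φ : M → M'}

theorem contDiffAt_inCharts (hΦ : ContMDiff (𝓡 (2 * n + 1)) (𝓡 (2 * n + 1)) ∞ Φ) (c : M) (c' : M')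
    {y : EuclideanSpace ℝ (Fin (2 * n + 1))} (hy : y ∈ (extChartAt (𝓡 (2 * n + 1)) c).target)
    (hc : Φ ((extChartAt (𝓡 (2 * n + 1)) c).symm y) ∈ (extChartAt (𝓡 (2 * n + 1)) c').source) :
    ContDiffAt ℝ ∞ (inCharts Φ c c') y := by
  have h1 : ContMDiffAt 𝓘(ℝ, EuclideanSpace ℝ (Fin (2 * n + 1))) (𝓡 (2 * n + 1)) ∞
      (extChartAt (𝓡 (2 * n + 1)) c).symm y :=
    (contMDiffOn_extChartAt_symm c).contMDiffAt ((isOpen_extChartAt_target c).mem_nhds hy)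
  have h2 : ContMDiffAt (𝓡 (2 * n + 1)) 𝓘(ℝ, EuclideanSpace ℝ (Fin (2 * n + 1))) ∞
      (extChartAt (𝓡 (2 * n + 1)) c') (Φ ((extChartAt (𝓡 (2 * n + 1)) c).symm y)) :=
    contMDiffAt_extChartAt' (by rwa [extChartAt_source] at hc)
  exact ((h2.comp _ hΦ.contMDiffAt).comp y h1).contDiffAt

theorem modelDeriv_chartSymmDeriv (hΦ : ContMDiff (𝓡 (2 * n + 1)) (𝓡 (2 * n + 1)) ∞ Φ) (c : M)
    (c' : M') {y : EuclideanSpace ℝ (Fin (2 * n + 1))}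
    (hy : y ∈ (extChartAt (𝓡 (2 * n + 1)) c).target)
    (hc : Φ ((extChartAt (𝓡 (2 * n + 1)) c).symm y) ∈ (extChartAt (𝓡 (2 * n + 1)) c').source)
    (w : EuclideanSpace ℝ (Fin (2 * n + 1))) :
    modelDeriv Φ ((extChartAt (𝓡 (2 * n + 1)) c).symm y) (chartSymmDeriv c y w) =
      chartSymmDeriv c' (inCharts Φ c c' y) (fderiv ℝ (inCharts Φ c c') y w) := by
  set C := extChartAt (𝓡 (2 * n + 1)) c with hC
  set C' := extChartAt (𝓡 (2 * n + 1)) c' with hC'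
  have hs := mdifferentiableAt_symm c hy
  have hm : MDifferentiableAt (𝓡 (2 * n + 1)) (𝓡 (2 * n + 1)) Φ (C.symm y) :=
    hΦ.mdifferentiable (by norm_num) _
  have hd : DifferentiableAt ℝ (inCharts Φ c c') y :=
    (contDiffAt_inCharts hΦ c c' hy hc).differentiableAt (by norm_num)
  have hs' := mdifferentiableAt_symm c' (C'.map_source hc)
  have hev : Φ ∘ C.symm =ᶠ[𝓝 y] C'.symm ∘ inCharts Φ c c' := by
    filter_upwards [eventually_inCharts hΦ.continuous c c' hy hc] with z hz
    exact (C'.left_inv hz.2).symm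
  have h1 := mfderiv_comp y (g := Φ) (f := C.symm) hm hs
  have h2 := mfderiv_comp y (g := C'.symm) (f := inCharts Φ c c') hs' hd.mdifferentiableAt
  rw [← hev.mfderiv_eq, h1, mfderiv_eq_fderiv] at h2
  exact DFunLike.congr_fun h2 w

theorem inChart_pullbackForm (hΦ : ContMDiff (𝓡 (2 * n + 1)) (𝓡 (2 * n + 1)) ∞ Φ) (c : M)
    (c' : M') {y : EuclideanSpace ℝ (Fin (2 * n + 1))}
    (hy : y ∈ (extChartAt (𝓡 (2 * n + 1)) c).target)
    (hc : Φ ((extChartAt (𝓡 (2 * n + 1)) c).symm y) ∈ (extChartAt (𝓡 (2 * n + 1)) c').source)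
    {k : ℕ} (η : RawForm n M' k) :
    inChart c (pullbackForm Φ η) y =
      (inChart c' η (inCharts Φ c c' y)).compContinuousLinearMap
        (fderiv ℝ (inCharts Φ c c') y) := by
  ext v
  refine (congrArg (η (Φ ((extChartAt (𝓡 (2 * n + 1)) c).symm y))) (funext fun i =>
    modelDeriv_chartSymmDeriv hΦ c c' hy hc (v i))).trans ?_
  exact (RawForm.congr_point η ((extChartAt (𝓡 (2 * n + 1)) c').left_inv hc) _).symm

theorem smoothFormOn_pullbackForm (hΦ : ContMDiff (𝓡 (2 * n + 1)) (𝓡 (2 * n + 1)) ∞ Φ) {k : ℕ}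
    {η : RawForm n M' k} {U : Set M'} (hU : IsOpen U) (hη : SmoothFormOn η U) :
    SmoothFormOn (pullbackForm Φ η) (Φ ⁻¹' U) := by
  refine smoothFormOn_of_contDiffAt fun c y hy hyU => ?_
  set c' := Φ ((extChartAt (𝓡 (2 * n + 1)) c).symm y) with hc'
  have hc : c' ∈ (extChartAt (𝓡 (2 * n + 1)) c').source := mem_extChartAt_source c'
  have h1 := contDiffAt_inCharts hΦ c c' hy hc
  have h2 : ContDiffAt ℝ ∞ (inChart c' η) (inCharts Φ c c' y) :=
    hη.contDiffAt hU c' ((extChartAt (𝓡 (2 * n + 1)) c').map_source hc) (by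
      change (extChartAt (𝓡 (2 * n + 1)) c').symm (extChartAt (𝓡 (2 * n + 1)) c' c') ∈ U
      rwa [(extChartAt (𝓡 (2 * n + 1)) c').left_inv hc])
  have h3 : ContDiffAt ℝ ∞ (fun z => (inChart c' η (inCharts Φ c c' z)).compContinuousLinearMap
      (fderiv ℝ (inCharts Φ c c') z)) y :=
    contDiffAt_compContinuousLinearMap (h2.comp y h1) (h1.fderiv_right (by norm_num))
  refine h3.congr_of_eventuallyEq ?_
  filter_upwards [eventually_inCharts hΦ.continuous c c' hy hc] with z hz
  exact inChart_pullbackForm hΦ c c' hz.1 hz.2 η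

/-- The exterior derivative commutes with pullback. -/
theorem extD_pullbackForm (hΦ : ContMDiff (𝓡 (2 * n + 1)) (𝓡 (2 * n + 1)) ∞ Φ) {k : ℕ}
    {η : RawForm n M' k} {U : Set M'} (hU : IsOpen U) (hη : SmoothFormOn η U) {x : M}
    (hx : Φ x ∈ U) : atPoint (extD (pullbackForm Φ η)) x = atPoint (pullbackForm Φ (extD η)) x := by
  have hxs : x ∈ (extChartAt (𝓡 (2 * n + 1)) x).source := mem_extChartAt_source x
  have hxs' : Φ x ∈ (extChartAt (𝓡 (2 * n + 1)) (Φ x)).source := mem_extChartAt_source (Φ x)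
  have hy := (extChartAt (𝓡 (2 * n + 1)) x).map_source hxs
  have hsymm := (extChartAt (𝓡 (2 * n + 1)) x).left_inv hxs
  have hc : Φ ((extChartAt (𝓡 (2 * n + 1)) x).symm (extChartAt (𝓡 (2 * n + 1)) x x)) ∈
      (extChartAt (𝓡 (2 * n + 1)) (Φ x)).source := by rwa [hsymm]
  have hval : inCharts Φ x (Φ x) (extChartAt (𝓡 (2 * n + 1)) x x) =
      extChartAt (𝓡 (2 * n + 1)) (Φ x) (Φ x) := by
    simp only [inCharts, Function.comp_apply, hsymm]
  have h1 := contDiffAt_inCharts hΦ x (Φ x) hy hc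
  have h2 : DifferentiableAt ℝ (inChart (Φ x) η)
      (inCharts Φ x (Φ x) (extChartAt (𝓡 (2 * n + 1)) x x)) := by
    rw [hval]
    refine hη.differentiableAt hU (Φ x) ((extChartAt (𝓡 (2 * n + 1)) (Φ x)).map_source hxs') ?_
    rwa [(extChartAt (𝓡 (2 * n + 1)) (Φ x)).left_inv hxs']
  have h3 : inChart x (pullbackForm Φ η) =ᶠ[𝓝 (extChartAt (𝓡 (2 * n + 1)) x x)] fun z =>
      (inChart (Φ x) η (inCharts Φ x (Φ x) z)).compContinuousLinearMap
        (fderiv ℝ (inCharts Φ x (Φ x)) z) := by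
    filter_upwards [eventually_inCharts hΦ.continuous x (Φ x) hy hc] with z hz
    exact inChart_pullbackForm hΦ x (Φ x) hz.1 hz.2 η
  have h4 := extDeriv_pullback h2 h1
    (by simpa using! (WithTop.coe_le_coe.2 le_top : ((2 : ℕ∞) : WithTop ℕ∞) ≤ ∞))
  -- The chain rule for the two factorizations of `Φ` read in the target chart.
  have h5 : ∀ v, chartDeriv (Φ x) (Φ x) (modelDeriv Φ x v) =
      fderiv ℝ (inCharts Φ x (Φ x)) (extChartAt (𝓡 (2 * n + 1)) x x) (chartDeriv x x v) := by
    intro v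
    have hm : MDifferentiableAt (𝓡 (2 * n + 1)) (𝓡 (2 * n + 1)) Φ x :=
      hΦ.mdifferentiable (by norm_num) _
    have hd : DifferentiableAt ℝ (inCharts Φ x (Φ x)) (extChartAt (𝓡 (2 * n + 1)) x x) :=
      h1.differentiableAt (by norm_num)
    have hev : extChartAt (𝓡 (2 * n + 1)) (Φ x) ∘ Φ =ᶠ[𝓝 x]
        inCharts Φ x (Φ x) ∘ extChartAt (𝓡 (2 * n + 1)) x := by
      filter_upwards [(isOpen_extChartAt_source (I := 𝓡 (2 * n + 1)) x).mem_nhds hxs] with z hz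
      simp only [inCharts, Function.comp_apply, (extChartAt (𝓡 (2 * n + 1)) x).left_inv hz]
    have e1 := mfderiv_comp x (mdifferentiableAt_chart (Φ x) hxs') hm
    have e2 := mfderiv_comp x hd.mdifferentiableAt (mdifferentiableAt_chart x hxs)
    rw [← hev.mfderiv_eq, e1, mfderiv_eq_fderiv] at e2
    exact DFunLike.congr_fun e2 v
  rw [atPoint_extD, h3.extDeriv_eq, h4, hval, atPoint_pullbackForm, atPoint_extD]
  ext v
  exact congrArg (extDeriv (inChart (Φ x) η) (extChartAt (𝓡 (2 * n + 1)) (Φ x) (Φ x)))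
    (funext fun i => (h5 (v i)).symm)

end PullbackForms

/-! ### Behaviour of `d` and `Γ` under contactomorphisms. -/

section ContactInvariance

variable {n : ℕ} {M M' : Type*} [TopologicalSpace M]
  [ChartedSpace (EuclideanSpace ℝ (Fin (2 * n + 1))) M] [TopologicalSpace M']
  [ChartedSpace (EuclideanSpace ℝ (Fin (2 * n + 1))) M']

/-- `η` is the pullback of `η'`. -/
def Form.IsPullback (Φ : M → M') {k : ℕ} (η : Form n M k) (η' : Form n M' k) : Prop :=
  η.1 = pullbackForm Φ η'.1

theorem Form.IsPullback.sub {Φ : M → M'} {k : ℕ} {η ζ : Form n M k} {η' ζ' : Form n M' k}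
    (h : Form.IsPullback Φ η η') (h' : Form.IsPullback Φ ζ ζ') :
    Form.IsPullback Φ (η - ζ) (η' - ζ') := by
  change η.1 - ζ.1 = _
  rw [h, h']
  rfl

theorem Form.isPullback_zero {Φ : M → M'} {k : ℕ} :
    Form.IsPullback Φ (0 : Form n M k) (0 : Form n M' k) := rfl

variable [IsManifold (𝓡 (2 * n + 1)) ∞ M] [IsManifold (𝓡 (2 * n + 1)) ∞ M']
  {ξ : ContactStructure n M} {ξ' : ContactStructure n M'}
  {Φ : Diffeomorph (𝓡 (2 * n + 1)) (𝓡 (2 * n + 1)) M M' ∞}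

theorem IsContactomorphism.isContactForm_pullbackForm (hΦ : IsContactomorphism ξ ξ' Φ) {U : Set M'}
    {θ : RawForm n M' 1} (hθ : IsContactForm ξ'.dist U θ) :
    IsContactForm ξ.dist (Φ ⁻¹' U) (pullbackForm Φ θ) where
  isOpen := hθ.isOpen.preimage Φ.continuous
  smooth := smoothFormOn_pullbackForm Φ.contMDiff hθ.isOpen hθ.smooth
  ker x hx v := (hΦ x v).trans (hθ.ker (Φ x) hx _)

theorem Form.IsPullback.dForm {k : ℕ} {η : Form n M k} {η' : Form n M' k}
    (h : Form.IsPullback Φ η η') : Form.IsPullback Φ (dForm n M k η) (dForm n M' k η') := by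
  funext x
  change extD η.1 x = _
  rw [h]
  exact extD_pullbackForm Φ.contMDiff isOpen_univ η'.2 (Set.mem_univ _)

/-- If `θ` is a contact form near `Φ x`, then `Φ^*θ` is one near `x`, and `d(Φ^*θ) = Φ^*dθ`. The
equations at `Φ x` pull back to those at `x`, and uniqueness identifies the solutions. -/
theorem Form.IsPullback.gamma (hΦ : IsContactomorphism ξ ξ' Φ)
    {Γ : (k : ℕ) → Form n M (k + 1) →ₗ[ℝ] Form n M k} (hΓ : ξ.IsGamma Γ)
    {Γ' : (k : ℕ) → Form n M' (k + 1) →ₗ[ℝ] Form n M' k} (hΓ' : ξ'.IsGamma Γ') {k : ℕ}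
    {η : Form n M (k + 1)} {η' : Form n M' (k + 1)} (h : Form.IsPullback Φ η η') :
    Form.IsPullback Φ (Γ k η) (Γ' k η') := by
  funext x
  obtain ⟨U, θ, hx, hθ, -⟩ := ξ'.exists_nondegenerate (Φ x)
  have hθ' := hΦ.isContactForm_pullbackForm hθ
  have h1 := hΓ.isGammaAt η hθ' (x := x) hx
  have h2 := (hΓ'.isGammaAt η' hθ hx).pullback (modelDeriv Φ x)
  refine h1.unique (hθ'.nondegenerate (ξ := ξ) (x := x) hx) ?_
  rw [extD_pullbackForm Φ.contMDiff hθ.isOpen hθ.smooth hx, h]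
  exact h2

-- Pullback by a diffeomorphism is injective, because `Φ` and its differentials are surjective.
omit [IsManifold (𝓡 (2 * n + 1)) ∞ M] [IsManifold (𝓡 (2 * n + 1)) ∞ M'] in
theorem Form.IsPullback.eq_zero_iff {k : ℕ} {η : Form n M k} {η' : Form n M' k}
    (h : Form.IsPullback Φ η η') : η = 0 ↔ η' = 0 := by
  constructor
  · rintro rfl
    refine Form.ext_atPoint fun y => ?_
    obtain ⟨x, rfl⟩ := Φ.surjective y
    have hs : Function.Surjective (modelDeriv (n := n) Φ x) :=
      (Φ.mfderivToContinuousLinearEquiv (by norm_num) x).surjective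
    have e : (atPoint η'.1 (Φ x)).compContinuousLinearMap (modelDeriv (n := n) Φ x) = 0 :=
      (congrFun h x).symm
    ext v
    choose w hw using fun i => hs (v i)
    rw [show v = fun i => modelDeriv (n := n) Φ x (w i) from funext fun i => (hw i).symm]
    exact DFunLike.congr_fun e w
  · rintro rfl
    exact Subtype.ext h

end ContactInvariance

/-! ### The total complex, the projection and the deformation retract. -/

section Total

variable {n : ℕ} {M : Type*} [TopologicalSpace M]
  [ChartedSpace (EuclideanSpace ℝ (Fin (2 * n + 1))) M]
  {Γ : (k : ℕ) → Form n M (k + 1) →ₗ[ℝ] Form n M k}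

theorem lower_apply (a : DeRham n M) (k : ℕ) : lower Γ a k = Γ k (a (k + 1)) := by
  induction a using DirectSum.induction_on with
  | zero => rw [map_zero, DirectSum.zero_apply, DirectSum.zero_apply, map_zero]
  | add a b ha hb => rw [map_add, DirectSum.add_apply, DirectSum.add_apply, map_add, ha, hb]
  | of i x =>
    have e : lower Γ (DirectSum.of (fun k => Form n M k) i x) = _ := DirectSum.toModule_lof ℝ i x
    rw [e]
    rcases i with _ | i
    · rw [DirectSum.of_eq_of_ne _ _ _ (by omega), map_zero]
      rfl
    · change DirectSum.of (fun k => Form n M k) i (Γ i x) k = _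
      by_cases h : i = k
      · subst h
        rw [DirectSum.of_eq_same, DirectSum.of_eq_same]
      · rw [DirectSum.of_eq_of_ne _ _ _ (by omega), DirectSum.of_eq_of_ne _ _ _ (by omega),
          map_zero]

variable [IsManifold (𝓡 (2 * n + 1)) ∞ M]

theorem dTotal_apply_zero (a : DeRham n M) : dTotal n M a 0 = 0 := by
  induction a using DirectSum.induction_on with
  | zero => rw [map_zero, DirectSum.zero_apply]
  | add a b ha hb => rw [map_add, DirectSum.add_apply, ha, hb, add_zero]
  | of i x =>
    have e : dTotal n M (DirectSum.of (fun k => Form n M k) i x) = _ :=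
      DirectSum.toModule_lof ℝ i x
    rw [e]
    exact DirectSum.of_eq_of_ne _ _ _ (by omega)

theorem dTotal_apply_succ (a : DeRham n M) (k : ℕ) :
    dTotal n M a (k + 1) = dForm n M k (a k) := by
  induction a using DirectSum.induction_on with
  | zero => rw [map_zero, DirectSum.zero_apply, DirectSum.zero_apply, map_zero]
  | add a b ha hb => rw [map_add, DirectSum.add_apply, DirectSum.add_apply, map_add, ha, hb]
  | of i x =>
    have e : dTotal n M (DirectSum.of (fun k => Form n M k) i x) = _ :=
      DirectSum.toModule_lof ℝ i x
    rw [e]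
    change DirectSum.of (fun k => Form n M k) (i + 1) (dForm n M i x) (k + 1) = _
    by_cases h : i = k
    · subst h
      rw [DirectSum.of_eq_same, DirectSum.of_eq_same]
    · rw [DirectSum.of_eq_of_ne _ _ _ (by omega), DirectSum.of_eq_of_ne _ _ _ (by omega), map_zero]

theorem dTotal_dTotal (a : DeRham n M) : dTotal n M (dTotal n M a) = 0 := by
  refine DFinsupp.ext fun k => ?_
  rcases k with _ | _ | k
  · exact dTotal_apply_zero _
  · exact (dTotal_apply_succ _ _).trans (by rw [dTotal_apply_zero, map_zero]; rfl)
  · exact (dTotal_apply_succ _ _).trans (by rw [dTotal_apply_succ, dForm_dForm]; rfl)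

theorem projection_apply (a : DeRham n M) :
    projection Γ a = a - dTotal n M (lower Γ a) - lower Γ (dTotal n M a) := rfl

theorem isHomogeneousMap_dTotal : IsHomogeneousMap (A := DeRham n M) (B := DeRham n M)
    (degreePart n M) (degreePart n M) 1 (dTotal n M) := by
  intro i a ha k hk
  rcases k with _ | k
  · exact dTotal_apply_zero a
  · rw [dTotal_apply_succ, ha k (by push_cast at hk; omega), map_zero]

omit [IsManifold (𝓡 (2 * n + 1)) ∞ M] in
theorem isHomogeneousMap_lower : IsHomogeneousMap (A := DeRham n M) (B := DeRham n M)
    (degreePart n M) (degreePart n M) (-1) (lower Γ) := by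
  intro i a ha k hk
  rw [lower_apply, ha (k + 1) (by push_cast; omega), map_zero]

theorem isHomogeneousMap_projection : IsHomogeneousMap (A := DeRham n M) (B := DeRham n M)
    (degreePart n M) (degreePart n M) 0 (projection Γ) := by
  intro i a ha
  rw [projection_apply]
  have h1 := isHomogeneousMap_dTotal _ _ (isHomogeneousMap_lower (Γ := Γ) i a ha)
  have h2 := isHomogeneousMap_lower (Γ := Γ) _ _ (isHomogeneousMap_dTotal i a ha)
  rw [neg_add_cancel_right] at h1
  rw [add_neg_cancel_right] at h2
  rw [add_zero]
  exact sub_mem (sub_mem ha h1) h2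

variable {ξ : ContactStructure n M}

namespace ContactStructure.IsGamma

theorem lower_lower (hΓ : ξ.IsGamma Γ) (a : DeRham n M) : lower Γ (lower Γ a) = 0 :=
  DFinsupp.ext fun k => by
    refine (lower_apply _ _).trans ?_
    rw [lower_apply, hΓ.gamma_gamma]
    rfl

theorem lower_dTotal_lower (hΓ : ξ.IsGamma Γ) (a : DeRham n M) :
    lower Γ (dTotal n M (lower Γ a)) = lower Γ a :=
  DFinsupp.ext fun k => by
    refine (lower_apply _ _).trans ?_
    rw [dTotal_apply_succ, lower_apply, hΓ.gamma_d_gamma]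

/-- With `ℛ = ker Γ ∩ ker Γd`, the retract properties follow from `d² = 0`, `Γ² = 0` and `ΓdΓ = Γ`
alone. -/
theorem mem_rumin_iff (hΓ : ξ.IsGamma Γ) {a : DeRham n M} :
    a ∈ ξ.rumin ↔ lower Γ a = 0 ∧ lower Γ (dTotal n M a) = 0 := by
  have e : ∀ b : DeRham n M, lower Γ b = 0 ↔ ∀ k, Γ k (b (k + 1)) = 0 := fun b =>
    ⟨fun h k => by rw [← lower_apply, h, DirectSum.zero_apply],
      fun h => DFinsupp.ext fun k => (lower_apply _ _).trans (h k)⟩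
  rw [e, e]
  simp only [dTotal_apply_succ]
  constructor
  · intro h
    exact ⟨fun k => (hΓ.mem_ruminForm_succ_iff.1 (h (k + 1))).1, fun k => match k with
      | 0 => hΓ.mem_ruminForm_zero_iff.1 (h 0)
      | k + 1 => (hΓ.mem_ruminForm_succ_iff.1 (h (k + 1))).2⟩
  · rintro ⟨h1, h2⟩ k
    match k with
    | 0 => exact hΓ.mem_ruminForm_zero_iff.2 (h2 0)
    | k + 1 => exact hΓ.mem_ruminForm_succ_iff.2 ⟨h1 k, h2 (k + 1)⟩

/-- Writing `π` for the projection, `Γπ = Γ - ΓdΓ - Γ²d = 0` and `Γdπ = Γd - ΓdΓd = 0`. On `ℛ` both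
correction terms vanish. -/
theorem isProj_projection (hΓ : ξ.IsGamma Γ) : LinearMap.IsProj ξ.rumin (projection Γ) where
  map_mem a := by
    rw [hΓ.mem_rumin_iff]
    constructor
    · rw [projection_apply, map_sub, map_sub, hΓ.lower_dTotal_lower, hΓ.lower_lower, sub_self,
        sub_zero]
    · simp only [projection_apply, map_sub, dTotal_dTotal, sub_zero, hΓ.lower_dTotal_lower,
        sub_self]
  map_id a ha := by
    obtain ⟨h1, h2⟩ := hΓ.mem_rumin_iff.1 ha
    rw [projection_apply, h1, h2, map_zero, sub_zero, sub_zero]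

theorem dTotal_mem_rumin (hΓ : ξ.IsGamma Γ) {a : DeRham n M} (ha : a ∈ ξ.rumin) :
    dTotal n M a ∈ ξ.rumin :=
  hΓ.mem_rumin_iff.2 ⟨(hΓ.mem_rumin_iff.1 ha).2, by rw [dTotal_dTotal, map_zero]⟩

/-- The homotopy identity is the definition of the projection, and both `πd` and `dπ` equal `d -
dΓd`. -/
theorem isDeformationRetract (hΓ : ξ.IsGamma Γ) :
    IsDeformationRetract (A := DeRham n M) (B := ξ.rumin) (degreePart n M) ξ.ruminDegreePart
      (dTotal n M) ((dTotal n M).restrict fun _ => hΓ.dTotal_mem_rumin)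
      ((projection Γ).codRestrict ξ.rumin hΓ.isProj_projection.map_mem) ξ.rumin.subtype
      (lower Γ) where
  complexA := ⟨isHomogeneousMap_dTotal, LinearMap.ext dTotal_dTotal⟩
  complexB := ⟨fun i a ha => isHomogeneousMap_dTotal i a.1 ha,
    LinearMap.ext fun a => Subtype.ext (dTotal_dTotal a.1)⟩
  cochain_π := ⟨fun i a ha => isHomogeneousMap_projection i a ha,
    LinearMap.ext fun a => Subtype.ext <| by
      change projection Γ (dTotal n M a) = dTotal n M (projection Γ a)
      simp only [projection_apply, map_sub, dTotal_dTotal, map_zero, sub_zero]⟩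
  cochain_i := ⟨fun i a ha => by rw [add_zero]; exact ha, rfl⟩
  homogeneous_h := isHomogeneousMap_lower
  homotopy := rfl
  retract := LinearMap.ext fun a => Subtype.ext (hΓ.isProj_projection.map_id a.1 a.2)

end ContactStructure.IsGamma

variable {M' : Type*} [TopologicalSpace M'] [ChartedSpace (EuclideanSpace ℝ (Fin (2 * n + 1))) M']
  [IsManifold (𝓡 (2 * n + 1)) ∞ M'] {ξ' : ContactStructure n M'}
  {Γ' : (k : ℕ) → Form n M' (k + 1) →ₗ[ℝ] Form n M' k}
  {Φ : Diffeomorph (𝓡 (2 * n + 1)) (𝓡 (2 * n + 1)) M M' ∞} {a : DeRham n M} {a' : DeRham n M'}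

omit [IsManifold (𝓡 (2 * n + 1)) ∞ M] [IsManifold (𝓡 (2 * n + 1)) ∞ M'] in
theorem isPullback_iff : IsPullback Φ a a' ↔ ∀ k, Form.IsPullback Φ (a k) (a' k) :=
  forall_congr' fun _ => funext_iff.symm

theorem IsPullback.dTotal (h : IsPullback Φ a a') :
    IsPullback Φ (dTotal n M a) (dTotal n M' a') := by
  rw [isPullback_iff] at h ⊢
  rintro (_ | k)
  · rw [dTotal_apply_zero, dTotal_apply_zero]
    exact Form.isPullback_zero
  · rw [dTotal_apply_succ, dTotal_apply_succ]
    exact (h k).dForm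

theorem IsPullback.lower (hΦ : IsContactomorphism ξ ξ' Φ) (hΓ : ξ.IsGamma Γ) (hΓ' : ξ'.IsGamma Γ')
    (h : IsPullback Φ a a') : IsPullback Φ (lower Γ a) (lower Γ' a') := by
  rw [isPullback_iff] at h ⊢
  intro k
  rw [lower_apply, lower_apply]
  exact (h (k + 1)).gamma hΦ hΓ hΓ'

omit [IsManifold (𝓡 (2 * n + 1)) ∞ M] [IsManifold (𝓡 (2 * n + 1)) ∞ M'] in
theorem IsPullback.sub {b : DeRham n M} {b' : DeRham n M'} (h : IsPullback Φ a a')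
    (h' : IsPullback Φ b b') : IsPullback Φ (a - b) (a' - b') := by
  rw [isPullback_iff] at h h' ⊢
  intro k
  rw [DirectSum.sub_apply, DirectSum.sub_apply]
  exact (h k).sub (h' k)

theorem IsPullback.projection (hΦ : IsContactomorphism ξ ξ' Φ) (hΓ : ξ.IsGamma Γ)
    (hΓ' : ξ'.IsGamma Γ') (h : IsPullback Φ a a') :
    IsPullback Φ (projection Γ a) (projection Γ' a') := by
  rw [projection_apply, projection_apply]
  exact (h.sub (h.lower hΦ hΓ hΓ').dTotal).sub (h.dTotal.lower hΦ hΓ hΓ')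

omit [IsManifold (𝓡 (2 * n + 1)) ∞ M] [IsManifold (𝓡 (2 * n + 1)) ∞ M'] in
theorem IsPullback.eq_zero_iff (h : IsPullback Φ a a') : a = 0 ↔ a' = 0 := by
  rw [isPullback_iff] at h
  exact ⟨fun h0 => DFinsupp.ext fun k => ((h k).eq_zero_iff).1 (by rw [h0]; rfl),
    fun h0 => DFinsupp.ext fun k => ((h k).eq_zero_iff).2 (by rw [h0]; rfl)⟩

/-- Pullback commutes with `Γ` and `Γd` and detects zero, so it preserves and reflects their common
kernel. -/
theorem IsPullback.mem_rumin_iff (hΦ : IsContactomorphism ξ ξ' Φ) (hΓ : ξ.IsGamma Γ)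
    (hΓ' : ξ'.IsGamma Γ') (h : IsPullback Φ a a') : a ∈ ξ.rumin ↔ a' ∈ ξ'.rumin := by
  rw [hΓ.mem_rumin_iff, hΓ'.mem_rumin_iff, (h.lower hΦ hΓ hΓ').eq_zero_iff,
    (h.dTotal.lower hΦ hΓ hΓ').eq_zero_iff]

end Total

end Contact

end

theorem theorem4p1 (n : ℕ) (M : Type u) [TopologicalSpace M] [T2Space M]
    [SecondCountableTopology M] [ChartedSpace (EuclideanSpace ℝ (Fin (2 * n + 1))) M]
    [IsManifold (𝓡 (2 * n + 1)) ∞ M] (ξ : Contact.ContactStructure n M) :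
    ∃ Γ : (k : ℕ) → Contact.Form n M (k + 1) →ₗ[ℝ] Contact.Form n M k,
      -- `Γ` is the unique operator with the defining properties
      ξ.IsGamma Γ ∧ (∀ Γ', ξ.IsGamma Γ' → Γ' = Γ) ∧
      -- `π = 1 - dΓ - Γd` is a homogeneous projection of degree zero from `𝒜` onto `ℛ`
      Contact.IsHomogeneousMap (A := Contact.DeRham n M) (B := Contact.DeRham n M)
        (Contact.degreePart n M) (Contact.degreePart n M) 0
        (Contact.projection Γ) ∧
      LinearMap.IsProj ξ.rumin (Contact.projection Γ) ∧
      -- `(ℛ, d)` is a subcomplex of `(𝒜, d)`, and a deformation retract via `π`, `i` and `Γ`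
      (∃ (hd : ∀ a ∈ ξ.rumin, Contact.dTotal n M a ∈ ξ.rumin)
        (π : Contact.DeRham n M →ₗ[ℝ] ξ.rumin),
        (∀ a, (π a : Contact.DeRham n M) = Contact.projection Γ a) ∧
        Contact.IsDeformationRetract (A := Contact.DeRham n M) (B := ξ.rumin)
          (Contact.degreePart n M) ξ.ruminDegreePart
          (Contact.dTotal n M) ((Contact.dTotal n M).restrict hd) π ξ.rumin.subtype
          (Contact.lower Γ)) ∧
      -- contact invariance
      ∀ (M' : Type u) [TopologicalSpace M'] [T2Space M'] [SecondCountableTopology M']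
        [ChartedSpace (EuclideanSpace ℝ (Fin (2 * n + 1))) M'] [IsManifold (𝓡 (2 * n + 1)) ∞ M']
        (ξ' : Contact.ContactStructure n M')
        (Γ' : (k : ℕ) → Contact.Form n M' (k + 1) →ₗ[ℝ] Contact.Form n M' k),
        ξ'.IsGamma Γ' →
        ∀ Φ : Diffeomorph (𝓡 (2 * n + 1)) (𝓡 (2 * n + 1)) M M' ∞,
          Contact.IsContactomorphism ξ ξ' Φ →
          ∀ (a : Contact.DeRham n M) (a' : Contact.DeRham n M'), Contact.IsPullback Φ a a' →
            Contact.IsPullback Φ (Contact.lower Γ a) (Contact.lower Γ' a') ∧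
            Contact.IsPullback Φ (Contact.projection Γ a) (Contact.projection Γ' a') ∧
            (a ∈ ξ.rumin ↔ a' ∈ ξ'.rumin) := by
  have hΓ := ξ.isGamma_gamma
  exact ⟨ξ.gamma, hΓ, fun _ h => hΓ.unique h, Contact.isHomogeneousMap_projection,
    hΓ.isProj_projection, ⟨fun _ => hΓ.dTotal_mem_rumin, _, fun _ => rfl, hΓ.isDeformationRetract⟩,
    fun _ _ _ _ _ _ _ _ hΓ' _ hΦ _ _ h =>
      ⟨h.lower hΦ hΓ hΓ', h.projection hΦ hΓ hΓ', h.mem_rumin_iff hΦ hΓ hΓ'⟩⟩
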